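/- Let $K$ be a field of characteristic $0$ and let $X$ be a smooth scheme over $K$. For $n\ge 0$ let $\mathrm{D}^n_{poly}(X)$ be the sheaf of polydifferential operators in $n$ arguments: over an affine open $U=\operatorname{Spec}R$ its sections are the $K$-multilinear maps $D:R^n\to R$ that are differential operators of finite order in each argument (the order in an argument being bounded uniformly in the other arguments), and it is an $\mathcal O_X$-module by multiplication of values; in particular $\mathrm{D}^0_{poly}(X)=\mathcal O_X$. The $\mathcal O_X$-modules $\mathrm{D}^n_{poly}(X)$ form a complex $\mathrm{D}^\bullet_{poly}(X)$ with the ($\mathcal O_X$-linear) Hochschild differential $$dD(a_0,\dots,a_n)=a_0D(a_1,\dots,a_n)+\sum_{i=1}^n(-1)^iD(\dots,a_{i-1}a_i,\dots)+(-1)^{n+1}D(a_0,\dots,a_{n-1})a_n ,$$ and a graded algebra over $\mathcal O_X$ with the product $$(D_1\otimes D_2)(a_1,\dots,a_{k+l})=D_1(a_1,\dots,a_k)\,D_2(a_{k+1},\dots,a_{k+l}).$$ Let $L=L(\mathrm{D}^1_{poly}(X))$ be the sheaf of free graded Lie algebras generated over $\mathcal O_X$ by the left $\mathcal O_X$-module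 $\mathrm{D}^1_{poly}(X)$ placed in degree $1$, with $L\to \mathrm{D}^\bullet_{poly}(X)$ the homomorphism of graded Lie algebras that is the identity on $\mathrm{D}^1_{poly}(X)$, the bracket on the target being the graded commutator $[x,y]=x\otimes y-(-1)^{|x||y|}y\otimes x$. Then: 1. The map $L\to \mathrm{D}^\bullet_{poly}(X)$ is injective, so that $L$ is a graded $\mathcal O_X$-submodule of $\mathrm{D}^\bullet_{poly}(X)$. 2. The Hochschild differential preserves $L$, i.e. it restricts to an $\mathcal O_X$-linear differential $d_L:L^n\to L^{n+1}$. 3. Extend $d_L$ to $\bigoplus_k\mathrm{Sym}^k(L)$ (graded symmetric powers over $\mathcal O_X$, graded by total degree) by the graded Leibniz rule $d(z_1\cdots z_k)=\sum_i(-1)^{d_1+\dots+d_{i-1}}z_1\cdots d_L(z_i)\cdots z_k$ for $z_i$ homogeneous of degree $d_i$. This makes $\bigoplus_k\mathrm{Sym}^k(L)$ a complex of $\mathcal O_X$-modules, and the symmetrization map $$I:\bigoplus_k\mathrm{Sym}^k(L)\to \mathrm{D}^\bullet_{poly}(X),\qquad I(z_1\cdots z_k)=\frac1{k!}\sum_{\sigma\in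 S_k}s(\sigma)\,z_{\sigma(1)}\otimes\dots\otimes z_{\sigma(k)},$$ where $s(\sigma)$ is the sign with $z_1\cdots z_k=s(\sigma)\,z_{\sigma(1)}\cdots z_{\sigma(k)}$ in $\mathrm{Sym}^k(L)$, is an isomorphism of complexes of $\mathcal O_X$-modules. -/

import Mathlib

open CategoryTheory AlgebraicGeometry Opposite

universe u

namespace PolyDiff


section Cochains

set_option linter.unusedSectionVars false

variable {K : Type*} {A : Type*} [Field K] [CommRing A]

/-- Functions of `n` arguments in a commutative ring `A` with values in `A`. -/
abbrev Coch (n : ℕ) (A : Type*) := (Fin n → A) → A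

/-- The commutator of `F` with multiplication by `b` in the `i`-th argument. -/
def comm {n : ℕ} (i : Fin n) (b : A) (F : Coch n A) : Coch n A :=
  fun a => F (Function.update a i (b * a i)) - b * F a

/-- `IsDO i N F`: as a function of its `i`-th argument, `F` is a differential operator of order
`< N` in the sense of Grothendieck: all `N`-fold iterated commutators with multiplication
operators vanish. -/
def IsDO {n : ℕ} (i : Fin n) : ℕ → Coch n A → Prop
  | 0, F => F = 0
  | N + 1, F => ∀ b : A, IsDO i N (comm i b F)

/-- `F` is a polydifferential operator over the field `K`, where `κ : K → A` is the structure map: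
it is `K`-multilinear, and a differential operator (of some finite order) in each argument. -/
structure IsPolyDiff (κ : K →+* A) {n : ℕ} (F : Coch n A) : Prop where
  map_add : ∀ (i : Fin n) (a : Fin n → A) (x y : A),
    F (Function.update a i (x + y)) = F (Function.update a i x) + F (Function.update a i y)
  map_smul : ∀ (i : Fin n) (a : Fin n → A) (c : K) (x : A),
    F (Function.update a i (κ c * x)) = κ c * F (Function.update a i x)
  diff : ∀ i : Fin n, ∃ N : ℕ, IsDO i N F

/-- The product `(F, G) ↦ (a ↦ F (a₁, …, a_p) G (a_{p+1}, …, a_{p+q}))`. -/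
def cmul {p q : ℕ} (F : Coch p A) (G : Coch q A) : Coch (p + q) A :=
  fun a => F (fun i => a (Fin.castAdd q i)) * G (fun i => a (Fin.natAdd p i))

/-- `merge j (a₀, …, a_n) = (a₀, …, a_j a_{j+1}, …, a_n)`. -/
def merge {n : ℕ} (j : ℕ) (a : Fin (n + 1) → A) : Fin n → A := fun k =>
  if (k : ℕ) < j then a k.castSucc
  else if (k : ℕ) = j then a k.castSucc * a k.succ else a k.succ

/-- The Hochschild coboundary
`dF (a₀, …, a_n) = a₀ F (a₁, …, a_n) + ∑_{i=1}^n (-1)^i F (…, a_{i-1} a_i, …)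
  + (-1)^(n+1) F (a₀, …, a_{n-1}) a_n`. -/
def hoch {n : ℕ} (F : Coch n A) : Coch (n + 1) A := fun a =>
  a 0 * F (fun i => a i.succ)
    + ∑ i ∈ Finset.range n, (-1) ^ (i + 1) * F (merge i a)
    + (-1) ^ (n + 1) * (F (fun i => a i.castSucc) * a (Fin.last n))

/-! Differential operators are stable under the operations above. -/

lemma comm_add {n : ℕ} (i : Fin n) (b : A) (F G : Coch n A) :
    comm i b (F + G) = comm i b F + comm i b G := by
  funext a; simp [comm]; ring

lemma IsDO.zero {n : ℕ} (i : Fin n) (N : ℕ) : IsDO i N (0 : Coch n A) := by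
  induction N with
  | zero => rfl
  | succ N ih => intro b; convert ih; funext a; simp [comm]

lemma IsDO.succ {n : ℕ} {i : Fin n} {N : ℕ} : ∀ {F : Coch n A}, IsDO i N F → IsDO i (N + 1) F := by
  induction N with
  | zero => intro F h b; obtain rfl : F = 0 := h; exact IsDO.zero i 1 b
  | succ N ih => intro F h b; exact ih (h b)

lemma IsDO.mono {n : ℕ} {i : Fin n} {N M : ℕ} (h : N ≤ M) {F : Coch n A} (hF : IsDO i N F) :
    IsDO i M F := by
  induction h with
  | refl => exact hF
  | step _ ih => exact ih.succ

lemma IsDO.add {n : ℕ} {i : Fin n} {N : ℕ} :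
    ∀ {F G : Coch n A}, IsDO i N F → IsDO i N G → IsDO i N (F + G) := by
  induction N with
  | zero =>
    intro F G hF hG
    change F = 0 at hF
    change G = 0 at hG
    subst hF hG
    exact add_zero _
  | succ N ih => intro F G hF hG b; rw [comm_add]; exact ih (hF b) (hG b)

/-- Transport of differential operators along an operation compatible with commutators. -/
lemma IsDO.transfer {n m : ℕ} {i : Fin n} {i' : Fin m} (T : Coch n A → Coch m A) (h0 : T 0 = 0)
    (hT : ∀ (b : A) (F : Coch n A), comm i' b (T F) = T (comm i b F)) {N : ℕ} :
    ∀ {F : Coch n A}, IsDO i N F → IsDO i' N (T F) := by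
  induction N with
  | zero => intro F h; obtain rfl : F = 0 := h; exact h0
  | succ N ih => intro F h b; rw [hT]; exact ih (h b)

lemma IsPolyDiff.zero (κ : K →+* A) {n : ℕ} : IsPolyDiff κ (0 : Coch n A) :=
  ⟨by simp, by simp, fun i => ⟨0, rfl⟩⟩

lemma IsPolyDiff.add {κ : K →+* A} {n : ℕ} {F G : Coch n A} (hF : IsPolyDiff κ F)
    (hG : IsPolyDiff κ G) : IsPolyDiff κ (F + G) where
  map_add i a x y := by simp only [Pi.add_apply, hF.map_add, hG.map_add]; ring
  map_smul i a c x := by simp only [Pi.add_apply, hF.map_smul, hG.map_smul]; ring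
  diff i := by
    obtain ⟨N, hN⟩ := hF.diff i
    obtain ⟨M, hM⟩ := hG.diff i
    exact ⟨max N M, (hN.mono (le_max_left _ _)).add (hM.mono (le_max_right _ _))⟩

lemma IsPolyDiff.smul {κ : K →+* A} {n : ℕ} {F : Coch n A} (c : A) (hF : IsPolyDiff κ F) :
    IsPolyDiff κ (fun a => c * F a) where
  map_add i a x y := by simp only [hF.map_add]; ring
  map_smul i a k x := by simp only [hF.map_smul]; ring
  diff i := by
    obtain ⟨N, hN⟩ := hF.diff i
    refine ⟨N, hN.transfer (fun F a => c * F a) (by funext a; simp) fun b F => ?_⟩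
    funext a; simp only [comm]; ring

lemma IsPolyDiff.const (κ : K →+* A) (c : A) : IsPolyDiff κ (fun _ : Fin 0 → A => c) :=
  ⟨fun i => i.elim0, fun i => i.elim0, fun i => i.elim0⟩

lemma upd_castAdd_left {p q : ℕ} (a : Fin (p + q) → A) (i : Fin p) (x : A) :
    (fun j => Function.update a (Fin.castAdd q i) x (Fin.castAdd q j)) =
      Function.update (fun j => a (Fin.castAdd q j)) i x := by
  funext j; simp [Function.update_apply]

lemma upd_castAdd_right {p q : ℕ} (a : Fin (p + q) → A) (i : Fin p) (x : A) :
    (fun j => Function.update a (Fin.castAdd q i) x (Fin.natAdd p j)) =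
      fun j => a (Fin.natAdd p j) := by
  funext j; rw [Function.update_of_ne]; simp [Fin.ext_iff]; omega

lemma upd_natAdd_left {p q : ℕ} (a : Fin (p + q) → A) (i : Fin q) (x : A) :
    (fun j => Function.update a (Fin.natAdd p i) x (Fin.castAdd q j)) =
      fun j => a (Fin.castAdd q j) := by
  funext j; rw [Function.update_of_ne]; simp [Fin.ext_iff]; omega

lemma upd_natAdd_right {p q : ℕ} (a : Fin (p + q) → A) (i : Fin q) (x : A) :
    (fun j => Function.update a (Fin.natAdd p i) x (Fin.natAdd p j)) =
      Function.update (fun j => a (Fin.natAdd p j)) i x := by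
  funext j; simp [Function.update_apply]

lemma IsPolyDiff.cmul {κ : K →+* A} {p q : ℕ} {F : Coch p A} {G : Coch q A}
    (hF : IsPolyDiff κ F) (hG : IsPolyDiff κ G) : IsPolyDiff κ (cmul F G) where
  map_add i a x y := by
    refine Fin.addCases (fun i => ?_) (fun i => ?_) i
    · simp only [PolyDiff.cmul, upd_castAdd_left, upd_castAdd_right, hF.map_add]; ring
    · simp only [PolyDiff.cmul, upd_natAdd_left, upd_natAdd_right, hG.map_add]; ring
  map_smul i a c x := by
    refine Fin.addCases (fun i => ?_) (fun i => ?_) i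
    · simp only [PolyDiff.cmul, upd_castAdd_left, upd_castAdd_right, hF.map_smul]; ring
    · simp only [PolyDiff.cmul, upd_natAdd_left, upd_natAdd_right, hG.map_smul]; ring
  diff i := by
    refine Fin.addCases (fun i => ?_) (fun i => ?_) i
    · obtain ⟨N, hN⟩ := hF.diff i
      refine ⟨N, hN.transfer (fun F => PolyDiff.cmul F G)
        (by funext a; simp [PolyDiff.cmul]) fun b F => ?_⟩
      funext a
      simp only [comm, PolyDiff.cmul, upd_castAdd_left, upd_castAdd_right]; ring
    · obtain ⟨N, hN⟩ := hG.diff i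
      refine ⟨N, hN.transfer (fun G => PolyDiff.cmul F G)
        (by funext a; simp [PolyDiff.cmul]) fun b G => ?_⟩
      funext a
      simp only [comm, PolyDiff.cmul, upd_natAdd_left, upd_natAdd_right]; ring

lemma hoch_add {n : ℕ} (F G : Coch n A) : hoch (F + G) = hoch F + hoch G := by
  funext a
  simp only [hoch, Pi.add_apply, mul_add, add_mul, Finset.sum_add_distrib]; ring

lemma hoch_smul {n : ℕ} (c : A) (F : Coch n A) :
    hoch (fun a => c * F a) = fun a => c * hoch F a := by
  funext a
  simp only [hoch, mul_add, Finset.mul_sum]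
  congr 1
  · congr 1
    · ring
    · exact Finset.sum_congr rfl fun _ _ => by ring
  · ring

/-- The `j`-th coface of the Hochschild complex. -/
def coface {n : ℕ} (j : ℕ) (F : Coch n A) : Coch (n + 1) A := fun a =>
  if j = 0 then a 0 * F (fun i => a i.succ)
  else if j = n + 1 then F (fun i => a i.castSucc) * a (Fin.last n)
  else F (merge (j - 1) a)

lemma hoch_eq_sum {n : ℕ} (F : Coch n A) (a : Fin (n + 1) → A) :
    hoch F a = ∑ j ∈ Finset.range (n + 2), (-1) ^ j * coface j F a := by
  rw [Finset.sum_range_succ, Finset.sum_range_succ']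
  have : ∀ i ∈ Finset.range n, (-1 : A) ^ (i + 1) * coface (i + 1) F a =
      (-1) ^ (i + 1) * F (merge i a) := by
    intro i hi
    have := Finset.mem_range.1 hi
    rw [coface, if_neg (by omega), if_neg (by omega)]
    simp
  rw [Finset.sum_congr rfl this]
  simp only [hoch, coface]
  simp
  ring

/-- The argument `x` inserted at place `k` ends up, after the `j`-th merge, at this place. -/
lemma merge_update {n : ℕ} (j : ℕ) (hj : j < n) (k : Fin (n + 1)) :
    ∃ k' : Fin n, ∀ a : Fin (n + 1) → A, ∃ c : A, ∀ x, merge j (Function.update a k x) =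
      Function.update (merge j a) k' (c * x) := by
  by_cases h1 : (k : ℕ) < j
  · refine ⟨⟨k, by omega⟩, fun a => ⟨1, fun x => ?_⟩⟩
    funext l
    simp only [merge, Function.update_apply, Fin.ext_iff, Fin.val_castSucc, Fin.val_succ]
    grind
  · by_cases h2 : (k : ℕ) = j
    · refine ⟨⟨j, hj⟩, fun a => ⟨a ⟨j + 1, by omega⟩, fun x => ?_⟩⟩
      funext l
      simp only [merge, Function.update_apply, Fin.ext_iff, Fin.val_castSucc, Fin.val_succ]
      by_cases hl : (l : ℕ) = j
      · have : l.succ = ⟨j + 1, by omega⟩ := by ext; simp [hl]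
        simp [hl, h2, this, mul_comm]
      · grind
    · by_cases h3 : (k : ℕ) = j + 1
      · refine ⟨⟨j, hj⟩, fun a => ⟨a ⟨j, by omega⟩, fun x => ?_⟩⟩
        funext l
        simp only [merge, Function.update_apply, Fin.ext_iff, Fin.val_castSucc, Fin.val_succ]
        by_cases hl : (l : ℕ) = j
        · have : l.castSucc = ⟨j, by omega⟩ := by ext; simp [hl]
          simp [hl, h3, this]
        · grind
      · refine ⟨⟨k - 1, by omega⟩, fun a => ⟨1, fun x => ?_⟩⟩
        funext l
        simp only [merge, Function.update_apply, Fin.ext_iff, Fin.val_castSucc, Fin.val_succ]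
        grind

lemma IsPolyDiff.comp_merge {κ : K →+* A} {n : ℕ} {F : Coch n A} (hF : IsPolyDiff κ F)
    (j : ℕ) (hj : j < n) : IsPolyDiff κ (fun a => F (merge j a)) where
  map_add k a x y := by
    obtain ⟨k', h⟩ := merge_update (A := A) j hj k
    obtain ⟨c, hc⟩ := h a
    simp only [hc, mul_add, hF.map_add]
  map_smul k a r x := by
    obtain ⟨k', h⟩ := merge_update (A := A) j hj k
    obtain ⟨c, hc⟩ := h a
    simp only [hc, ← hF.map_smul]
    congr 2; ring
  diff k := by
    obtain ⟨k', h⟩ := merge_update (A := A) j hj k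
    obtain ⟨N, hN⟩ := hF.diff k'
    refine ⟨N, hN.transfer (fun F a => F (merge j a)) rfl fun b F => ?_⟩
    funext a
    obtain ⟨c, hc⟩ := h a
    have h1 : merge j a k' = c * a k := by
      have := congrFun (hc (a k)) k'
      simpa using this
    simp only [comm, hc, h1]
    congr 3; ring

lemma upd_zero_succ {n : ℕ} (a : Fin (n + 1) → A) (x : A) :
    (fun i : Fin n => Function.update a 0 x i.succ) = fun i => a i.succ := by
  funext i; simp

lemma upd_succ_succ {n : ℕ} (a : Fin (n + 1) → A) (k : Fin n) (x : A) :
    (fun i : Fin n => Function.update a k.succ x i.succ) =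
      Function.update (fun i => a i.succ) k x := by
  funext i; simp [Function.update_apply]

lemma upd_last_castSucc {n : ℕ} (a : Fin (n + 1) → A) (x : A) :
    (fun i : Fin n => Function.update a (Fin.last n) x i.castSucc) = fun i => a i.castSucc := by
  funext i; rw [Function.update_of_ne]; exact (Fin.castSucc_lt_last i).ne

lemma upd_castSucc_castSucc {n : ℕ} (a : Fin (n + 1) → A) (k : Fin n) (x : A) :
    (fun i : Fin n => Function.update a k.castSucc x i.castSucc) =
      Function.update (fun i => a i.castSucc) k x := by
  funext i; simp [Function.update_apply]

lemma IsPolyDiff.coface_zero {κ : K →+* A} {n : ℕ} {F : Coch n A} (hF : IsPolyDiff κ F) :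
    IsPolyDiff κ (fun a : Fin (n + 1) → A => a 0 * F (fun i => a i.succ)) where
  map_add k a x y := by
    refine Fin.cases ?_ (fun k => ?_) k
    · simp only [upd_zero_succ, Function.update_self]; ring
    · simp only [upd_succ_succ, hF.map_add, Function.update_of_ne (Fin.succ_ne_zero k).symm]; ring
  map_smul k a r x := by
    refine Fin.cases ?_ (fun k => ?_) k
    · simp only [upd_zero_succ, Function.update_self]; ring
    · simp only [upd_succ_succ, hF.map_smul, Function.update_of_ne (Fin.succ_ne_zero k).symm]; ring
  diff k := by
    refine Fin.cases ?_ (fun k => ?_) k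
    · refine ⟨1, fun b => ?_⟩
      change _ = _
      funext a
      simp only [comm, upd_zero_succ, Function.update_self, Pi.zero_apply]; ring
    · obtain ⟨N, hN⟩ := hF.diff k
      refine ⟨N, hN.transfer (fun F a => a 0 * F (fun i => a i.succ))
        (by funext a; simp) fun b F => ?_⟩
      funext a
      simp only [comm, upd_succ_succ, Function.update_of_ne (Fin.succ_ne_zero k).symm]; ring

lemma IsPolyDiff.coface_last {κ : K →+* A} {n : ℕ} {F : Coch n A} (hF : IsPolyDiff κ F) :
    IsPolyDiff κ (fun a : Fin (n + 1) → A => F (fun i => a i.castSucc) * a (Fin.last n)) where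
  map_add k a x y := by
    refine Fin.lastCases ?_ (fun k => ?_) k
    · simp only [upd_last_castSucc, Function.update_self]; ring
    · simp only [upd_castSucc_castSucc, hF.map_add,
        Function.update_of_ne (Fin.castSucc_lt_last k).ne']; ring
  map_smul k a r x := by
    refine Fin.lastCases ?_ (fun k => ?_) k
    · simp only [upd_last_castSucc, Function.update_self]; ring
    · simp only [upd_castSucc_castSucc, hF.map_smul,
        Function.update_of_ne (Fin.castSucc_lt_last k).ne']; ring
  diff k := by
    refine Fin.lastCases ?_ (fun k => ?_) k
    · refine ⟨1, fun b => ?_⟩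
      change _ = _
      funext a
      simp only [comm, upd_last_castSucc, Function.update_self, Pi.zero_apply]; ring
    · obtain ⟨N, hN⟩ := hF.diff k
      refine ⟨N, hN.transfer (fun F a => F (fun i => a i.castSucc) * a (Fin.last n))
        (by funext a; simp) fun b F => ?_⟩
      funext a
      simp only [comm, upd_castSucc_castSucc, Function.update_of_ne (Fin.castSucc_lt_last k).ne']
      ring

lemma IsPolyDiff.hoch {κ : K →+* A} {n : ℕ} {F : Coch n A} (hF : IsPolyDiff κ F) :
    IsPolyDiff κ (hoch F) := by
  have key : ∀ s : Finset ℕ, s ⊆ Finset.range n →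
      IsPolyDiff κ (fun a : Fin (n + 1) → A => ∑ i ∈ s, (-1) ^ (i + 1) * F (merge i a)) := by
    intro s
    induction s using Finset.induction_on with
    | empty =>
      intro _
      simp only [Finset.sum_empty]
      exact IsPolyDiff.zero κ
    | insert i s hi ih =>
      intro hs
      simp only [Finset.sum_insert hi]
      exact ((hF.comp_merge i (Finset.mem_range.1 (hs (Finset.mem_insert_self i s)))).smul _).add
        (ih fun x hx => hs (Finset.mem_insert_of_mem hx))
  exact (hF.coface_zero.add (key _ subset_rfl)).add (hF.coface_last.smul _)

/-! The Hochschild coboundary squares to zero. -/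

lemma merge_merge {n : ℕ} {i j : ℕ} (h : i < j) (a : Fin (n + 2) → A) :
    merge i (merge j a) = merge (j - 1) (merge i a) := by
  funext k
  simp only [merge, Fin.val_castSucc, Fin.val_succ]
  split_ifs <;> first | omega | rfl | simp only [Fin.succ_castSucc, mul_assoc]

lemma coface_coface {n : ℕ} (F : Coch n A) {i j : ℕ} (hij : i < j) (hj : j ≤ n + 2) :
    coface j (coface i F) = coface i (coface (j - 1) F) := by
  funext a
  rcases Nat.eq_zero_or_pos i with rfl | hi
  · rcases Nat.lt_or_ge 1 j with h1 | h1
    · rcases Nat.lt_or_ge j (n + 2) with h2 | h2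
      · simp only [coface, if_true, if_neg (show j ≠ 0 by omega), if_neg (show j - 1 ≠ 0 by omega),
          if_neg (show j ≠ n + 1 + 1 by omega), if_neg (show j - 1 ≠ n + 1 by omega)]
        congr 1
        · simp [merge, show 0 < j - 1 by omega]
        · congr 1
          funext k
          simp only [merge, Fin.val_succ, Fin.succ_castSucc]
          split_ifs <;> first | omega | rfl
      · obtain rfl : j = n + 2 := by omega
        simp only [coface, if_true, if_neg (show n + 2 ≠ 0 by omega),
          if_neg (show n + 2 - 1 ≠ 0 by omega),
          if_pos (show n + 2 - 1 = n + 1 by omega), Fin.castSucc_zero, Fin.succ_last,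
          Fin.succ_castSucc, mul_assoc]
    · obtain rfl : j = 1 := by omega
      simp only [coface, if_true, if_neg (show 1 ≠ 0 by omega),
        if_neg (show 1 ≠ n + 1 + 1 by omega)]
      simp [merge, mul_assoc]
  · rcases Nat.lt_or_ge j (n + 2) with h2 | h2
    · simp only [coface, if_neg (show i ≠ 0 by omega), if_neg (show j ≠ 0 by omega),
        if_neg (show j - 1 ≠ 0 by omega), if_neg (show j ≠ n + 1 + 1 by omega),
        if_neg (show i ≠ n + 1 by omega), if_neg (show i ≠ n + 1 + 1 by omega),
        if_neg (show j - 1 ≠ n + 1 by omega)]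
      rw [merge_merge (by omega)]
    · obtain rfl : j = n + 2 := by omega
      rcases Nat.lt_or_ge i (n + 1) with h3 | h3
      · simp only [coface, if_neg (show i ≠ 0 by omega), if_neg (show n + 2 ≠ 0 by omega),
          if_neg (show n + 2 - 1 ≠ 0 by omega),
          if_neg (show i ≠ n + 1 by omega), if_neg (show i ≠ n + 1 + 1 by omega), if_true,
          if_pos (show n + 2 - 1 = n + 1 by omega)]
        congr 1
        simp only [merge, Fin.val_last, Fin.succ_last]
        rw [if_neg (by omega), if_neg (by omega)]
      · obtain rfl : i = n + 1 := by omega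
        simp only [coface, if_neg (show n + 1 ≠ 0 by omega), if_neg (show n + 2 ≠ 0 by omega),
          if_neg (show n + 2 - 1 ≠ 0 by omega),
          if_true, if_neg (show n + 1 ≠ n + 1 + 1 by omega),
          if_pos (show n + 2 - 1 = n + 1 by omega)]
        simp only [merge, Fin.val_last, Fin.succ_last, Fin.val_castSucc]
        rw [if_neg (by omega), if_pos (by omega), mul_assoc]
        congr 2
        funext k
        rw [if_pos (by omega)]

lemma coface_hoch {n : ℕ} (j : ℕ) (F : Coch n A) (a : Fin (n + 2) → A) :
    coface j (hoch F) a = ∑ i ∈ Finset.range (n + 2), (-1) ^ i * coface j (coface i F) a := by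
  unfold coface
  split_ifs with h1 h2
  · simp only [hoch_eq_sum, Finset.mul_sum]
    exact Finset.sum_congr rfl fun i _ => by simp only [coface]; ring
  · simp only [hoch_eq_sum, Finset.sum_mul]
    exact Finset.sum_congr rfl fun i _ => by simp only [coface]; ring
  · simp only [hoch_eq_sum]
    exact Finset.sum_congr rfl fun i _ => by simp only [coface]

lemma hoch_hoch {n : ℕ} (F : Coch n A) : hoch (hoch F) = 0 := by
  funext a
  rw [hoch_eq_sum]
  simp only [coface_hoch, Finset.mul_sum, Pi.zero_apply]
  rw [← Finset.sum_product']
  set S := Finset.range (n + 1 + 2) ×ˢ Finset.range (n + 2) with hS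
  rw [← Finset.sum_filter_add_sum_filter_not S (fun p => p.2 < p.1), add_eq_zero_iff_eq_neg,
    ← Finset.sum_neg_distrib]
  refine Finset.sum_bij' (fun p _ => (p.2, p.1 - 1)) (fun p _ => (p.2 + 1, p.1)) ?_ ?_ ?_ ?_ ?_
  · rintro ⟨j, i⟩ h
    simp only [hS, Finset.mem_filter, Finset.mem_product, Finset.mem_range] at h ⊢
    omega
  · rintro ⟨j, i⟩ h
    simp only [hS, Finset.mem_filter, Finset.mem_product, Finset.mem_range] at h ⊢
    omega
  · rintro ⟨j, i⟩ h
    simp only [hS, Finset.mem_filter, Finset.mem_product, Finset.mem_range] at h ⊢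
    simp only [Prod.mk.injEq, and_true]; omega
  · rintro ⟨j, i⟩ h
    simp
  · rintro ⟨j, i⟩ h
    simp only [hS, Finset.mem_filter, Finset.mem_product, Finset.mem_range] at h
    simp only
    rw [coface_coface F h.2 (by omega)]
    obtain ⟨j, rfl⟩ : ∃ j', j = j' + 1 := ⟨j - 1, by omega⟩
    simp only [Nat.add_sub_cancel, pow_succ]
    ring

end Cochains


section Sections

set_option linter.unusedVariables false

variable {K : Type u} [Field K] {X : Scheme.{u}}

/-- Restriction of functions. -/
def rs {U V : X.Opens} (h : V ≤ U) : Γ(X, U) →+* Γ(X, V) := (X.presheaf.map (homOfLE h).op).hom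

lemma rs_rs {U V W : X.Opens} (h : V ≤ U) (h' : W ≤ V) (a : Γ(X, U)) :
    rs h' (rs h a) = rs (h'.trans h) a := by
  simp only [rs, ← CommRingCat.comp_apply, ← Functor.map_comp]
  rfl

lemma rs_self {U : X.Opens} (a : Γ(X, U)) : rs le_rfl a = a := by
  have : (homOfLE (le_refl U)).op = 𝟙 (op U) := rfl
  simp only [rs, this, CategoryTheory.Functor.map_id]
  rfl

/-- The structure map `K → Γ(X, U)` of a `K`-scheme. -/
noncomputable def structMap (f : X ⟶ Spec (.of K)) (U : X.Opens) : K →+* Γ(X, U) :=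
  ((Scheme.ΓSpecIso (.of K)).inv ≫ f.appLE ⊤ U (fun _ _ => trivial)).hom

lemma rs_structMap (f : X ⟶ Spec (.of K)) {U V : X.Opens} (h : V ≤ U) (c : K) :
    rs h (structMap f U c) = structMap f V c := by
  have : f.appLE ⊤ U (fun _ _ => trivial) ≫ X.presheaf.map (homOfLE h).op =
      f.appLE ⊤ V (fun _ _ => trivial) := Scheme.Hom.appLE_map f _ _
  simp only [structMap, rs, ← this]
  rfl

variable (f : X ⟶ Spec (.of K))

/-- The polydifferential operators in `n` arguments on the open set `U`: the morphisms of sheaves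
of sets `𝒪_U^n → 𝒪_U`, given by a compatible family of maps `F V : 𝒪(V)^n → 𝒪(V)` for all open
`V ⊆ U`, such that on every affine open `V` the map `F V` is `K`-multilinear and a differential
operator in each argument. -/
def polyFam (n : ℕ) (U : X.Opens) : AddSubgroup (∀ V : {V : X.Opens // V ≤ U}, Coch n Γ(X, V)) where
  carrier := {F |
    (∀ (V W : {V : X.Opens // V ≤ U}) (h : W.1 ≤ V.1) (a : Fin n → Γ(X, V)),
      rs h (F V a) = F W (fun i => rs h (a i))) ∧
    ∀ V : {V : X.Opens // V ≤ U}, IsAffineOpen V.1 → IsPolyDiff (structMap f V) (F V)}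
  zero_mem' := ⟨fun V W h a => map_zero _, fun V _ => IsPolyDiff.zero _⟩
  add_mem' := fun {F G} hF hG =>
    ⟨fun V W h a => by
      simp only [Pi.add_apply, map_add]
      rw [hF.1 V W h, hG.1 V W h], fun V hV => (hF.2 V hV).add (hG.2 V hV)⟩
  neg_mem' := fun {F} hF =>
    ⟨fun V W h a => by
      simp only [Pi.neg_apply, map_neg]
      rw [hF.1 V W h], fun V hV => by
      convert (hF.2 V hV).smul (-1) using 1
      funext a; simp⟩

/-- The group of polydifferential operators in `n` arguments on `U`. -/
def DSec (n : ℕ) (U : X.Opens) : Type u := polyFam f n U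

instance (n : ℕ) (U : X.Opens) : AddCommGroup (DSec f n U) :=
  inferInstanceAs (AddCommGroup (polyFam f n U))

variable {f}

/-- The component of a polydifferential operator on a smaller open set. -/
def DSec.on {n : ℕ} {U : X.Opens} (F : DSec f n U) (V : X.Opens) (h : V ≤ U) : Coch n Γ(X, V) :=
  F.1 ⟨V, h⟩

@[ext]
lemma DSec.ext {n : ℕ} {U : X.Opens} {F G : DSec f n U}
    (h : ∀ (V : X.Opens) (hV : V ≤ U) (a : Fin n → Γ(X, V)), F.on V hV a = G.on V hV a) : F = G :=
  Subtype.ext (funext fun V => funext fun a => h V.1 V.2 a)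

lemma DSec.rs_on {n : ℕ} {U V W : X.Opens} (F : DSec f n U) (hV : V ≤ U) (h : W ≤ V)
    (a : Fin n → Γ(X, V)) : rs h (F.on V hV a) = F.on W (h.trans hV) (fun i => rs h (a i)) :=
  F.2.1 ⟨V, hV⟩ ⟨W, h.trans hV⟩ h a

lemma DSec.isPolyDiff {n : ℕ} {U V : X.Opens} (F : DSec f n U) (hV : V ≤ U)
    (h : IsAffineOpen V) : IsPolyDiff (structMap f V) (F.on V hV) :=
  F.2.2 ⟨V, hV⟩ h

/-- Constructor for polydifferential operators. -/
def DSec.mk {n : ℕ} {U : X.Opens} (F : ∀ V : X.Opens, V ≤ U → Coch n Γ(X, V))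
    (h1 : ∀ (V W : X.Opens) (hV : V ≤ U) (h : W ≤ V) (a : Fin n → Γ(X, V)),
      rs h (F V hV a) = F W (h.trans hV) (fun i => rs h (a i)))
    (h2 : ∀ (V : X.Opens) (hV : V ≤ U), IsAffineOpen V → IsPolyDiff (structMap f V) (F V hV)) :
    DSec f n U :=
  ⟨fun V => F V.1 V.2, fun V W h a => h1 V.1 W.1 V.2 h a, fun V h => h2 V.1 V.2 h⟩

@[simp] lemma DSec.on_mk {n : ℕ} {U : X.Opens} (F : ∀ V : X.Opens, V ≤ U → Coch n Γ(X, V))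
    (h1) (h2) (V : X.Opens) (hV : V ≤ U) : (DSec.mk (f := f) F h1 h2).on V hV = F V hV := rfl

@[simp] lemma DSec.on_add {n : ℕ} {U : X.Opens} (F G : DSec f n U) (V : X.Opens) (hV : V ≤ U) :
    (F + G).on V hV = F.on V hV + G.on V hV := rfl

@[simp] lemma DSec.on_zero {n : ℕ} {U : X.Opens} (V : X.Opens) (hV : V ≤ U) :
    (0 : DSec f n U).on V hV = 0 := rfl

/-- `𝒪(U)` acts on polydifferential operators by multiplication of the values. -/
instance (n : ℕ) (U : X.Opens) : Module Γ(X, U) (DSec f n U) where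
  smul c F := DSec.mk (fun V hV a => rs hV c * F.on V hV a)
    (fun V W hV h a => by rw [map_mul, rs_rs, F.rs_on])
    (fun V hV h => (F.isPolyDiff hV h).smul _)
  one_smul F := by
    ext V hV a; change rs hV 1 * F.on V hV a = _; rw [map_one, one_mul]
  mul_smul c c' F := by
    ext V hV a
    change rs hV (c * c') * F.on V hV a = rs hV c * (rs hV c' * F.on V hV a)
    rw [map_mul, mul_assoc]
  smul_zero c := by
    ext V hV a; change rs hV c * (0 : Γ(X, V)) = 0; rw [mul_zero]
  smul_add c F G := by
    ext V hV a
    change rs hV c * (F.on V hV a + G.on V hV a) = rs hV c * F.on V hV a + rs hV c * G.on V hV a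
    rw [mul_add]
  add_smul c c' F := by
    ext V hV a
    change rs hV (c + c') * F.on V hV a = rs hV c * F.on V hV a + rs hV c' * F.on V hV a
    rw [map_add, add_mul]
  zero_smul F := by
    ext V hV a; change rs hV 0 * F.on V hV a = 0; rw [map_zero, zero_mul]

@[simp] lemma DSec.on_smul {n : ℕ} {U : X.Opens} (c : Γ(X, U)) (F : DSec f n U) (V : X.Opens)
    (hV : V ≤ U) (a : Fin n → Γ(X, V)) : (c • F).on V hV a = rs hV c * F.on V hV a := rfl

/-- Restriction of polydifferential operators. -/
def DSec.res {n : ℕ} {U U' : X.Opens} (h : U' ≤ U) : DSec f n U →+ DSec f n U' where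
  toFun F := DSec.mk (fun V hV => F.on V (hV.trans h)) (fun V W hV h' a => F.rs_on _ _ _)
    (fun V hV h' => F.isPolyDiff _ h')
  map_zero' := rfl
  map_add' _ _ := rfl

@[simp] lemma DSec.on_res {n : ℕ} {U U' V : X.Opens} (h : U' ≤ U) (F : DSec f n U) (hV : V ≤ U') :
    (DSec.res h F).on V hV = F.on V (hV.trans h) := rfl

lemma DSec.res_smul {n : ℕ} {U U' : X.Opens} (h : U' ≤ U) (c : Γ(X, U)) (F : DSec f n U) :
    DSec.res h (c • F) = rs h c • DSec.res h F := by
  ext V hV a; simp [rs_rs]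

/-- The Hochschild coboundary on sections. -/
def DSec.hoch {n : ℕ} {U : X.Opens} : DSec f n U →ₗ[Γ(X, U)] DSec f (n + 1) U where
  toFun F := DSec.mk (fun V hV => PolyDiff.hoch (F.on V hV))
    (fun V W hV h a => by
      have hm : ∀ i : ℕ, (fun k => rs h (merge i a k)) = merge i (fun k => rs h (a k)) := by
        intro i
        funext k
        simp only [merge]
        split_ifs <;> simp
      simp only [PolyDiff.hoch, hm, map_add, map_mul, map_sum, map_pow, map_neg, map_one, F.rs_on])
    (fun V hV h => (F.isPolyDiff hV h).hoch)
  map_add' F G := by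
    ext V hV a
    exact congrFun (hoch_add (F.on V hV) (G.on V hV)) a
  map_smul' c F := by
    ext V hV a
    exact congrFun (hoch_smul (rs hV c) (F.on V hV)) a

@[simp] lemma DSec.on_hoch {n : ℕ} {U V : X.Opens} (F : DSec f n U) (hV : V ≤ U) :
    (DSec.hoch F).on V hV = PolyDiff.hoch (F.on V hV) := rfl

/-- The product of polydifferential operators. -/
def DSec.mul {p q : ℕ} {U : X.Opens} (F : DSec f p U) (G : DSec f q U) : DSec f (p + q) U :=
  DSec.mk (fun V hV => cmul (F.on V hV) (G.on V hV))
    (fun V W hV h a => by simp only [cmul, map_mul, F.rs_on, G.rs_on])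
    (fun V hV h => (F.isPolyDiff hV h).cmul (G.isPolyDiff hV h))

@[simp] lemma DSec.on_mul {p q : ℕ} {U V : X.Opens} (F : DSec f p U) (G : DSec f q U)
    (hV : V ≤ U) : (DSec.mul F G).on V hV = cmul (F.on V hV) (G.on V hV) := rfl

/-- A function is a polydifferential operator without arguments. -/
def DSec.const {U : X.Opens} (c : Γ(X, U)) : DSec f 0 U :=
  DSec.mk (fun V hV _ => rs hV c) (fun V W hV h a => rs_rs hV h c)
    (fun V hV _ => IsPolyDiff.const _ _)

@[simp] lemma DSec.on_const {U V : X.Opens} (c : Γ(X, U)) (hV : V ≤ U)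
    (a : Fin 0 → Γ(X, V)) : (DSec.const (f := f) c).on V hV a = rs hV c := rfl

lemma DSec.sigma_ext {U : X.Opens} {m n : ℕ} (hmn : m = n) (F : DSec f m U) (G : DSec f n U)
    (h : ∀ (V : X.Opens) (hV : V ≤ U) (a : ℕ → Γ(X, V)),
      F.on V hV (fun i => a i) = G.on V hV (fun i => a i)) :
    (⟨m, F⟩ : GradedMonoid fun n => DSec f n U) = ⟨n, G⟩ := by
  subst hmn
  congr 1
  ext V hV a
  have := h V hV (fun i => if hi : i < m then a ⟨i, hi⟩ else 0)
  simpa using this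

instance (U : X.Opens) : GradedMonoid.GMul (fun n => DSec f n U) := ⟨DSec.mul⟩

instance (U : X.Opens) : GradedMonoid.GOne (fun n => DSec f n U) := ⟨DSec.const 1⟩

instance (U : X.Opens) : DirectSum.GRing (fun n => DSec f n U) where
  mul_zero F := by ext V hV a; exact mul_zero _
  zero_mul F := by ext V hV a; exact zero_mul _
  mul_add F G H := by ext V hV a; exact mul_add _ _ _
  add_mul F G H := by ext V hV a; exact add_mul _ _ _
  one_mul F := by
    refine DSec.sigma_ext (zero_add _) _ _ fun V hV a => ?_
    change (DSec.mul (DSec.const 1) F.2).on V hV _ = _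
    simp [cmul]
  mul_one F := by
    refine DSec.sigma_ext (add_zero _) _ _ fun V hV a => ?_
    change (DSec.mul F.2 (DSec.const 1)).on V hV _ = _
    simp [cmul]
  mul_assoc F G H := by
    refine DSec.sigma_ext (add_assoc _ _ _) _ _ fun V hV a => ?_
    change (DSec.mul (DSec.mul F.2 G.2) H.2).on V hV _ = (DSec.mul F.2 (DSec.mul G.2 H.2)).on V hV _
    simp [cmul, mul_assoc, add_assoc]
  natCast k := DSec.const k
  natCast_zero := by ext V hV a; simp
  natCast_succ k := by ext V hV a; change rs hV _ = rs hV _ + rs hV _; simp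
  intCast k := DSec.const k
  intCast_ofNat k := by ext V hV a; change rs hV _ = rs hV _; simp
  intCast_negSucc_ofNat k := by ext V hV a; change rs hV _ = - rs hV _; simp

variable (f) in
/-- The graded algebra of polydifferential operators on `U`. -/
abbrev DAlg (U : X.Opens) : Type u := DirectSum ℕ (fun n => DSec f n U)

instance (U : X.Opens) : IsScalarTower Γ(X, U) (DAlg f U) (DAlg f U) where
  smul_assoc c x y := by
    simp only [smul_eq_mul]
    induction x using DirectSum.induction_on with
    | zero => simp
    | add x x' hx hx' => rw [smul_add, add_mul, add_mul, hx, hx', smul_add]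
    | of p F =>
      induction y using DirectSum.induction_on with
      | zero => simp
      | add x x' hx hx' => rw [mul_add, mul_add, hx, hx', smul_add]
      | of q G =>
        simp only [← DirectSum.lof_eq_of Γ(X, U), ← map_smul]
        simp only [DirectSum.lof_eq_of, DirectSum.of_mul_of]
        simp only [← DirectSum.lof_eq_of Γ(X, U), ← map_smul]
        congr 1
        ext V hV a
        exact mul_assoc _ _ _

instance (U : X.Opens) : SMulCommClass Γ(X, U) (DAlg f U) (DAlg f U) where
  smul_comm c x y := by
    simp only [smul_eq_mul]
    induction x using DirectSum.induction_on with
    | zero => simp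
    | add x x' hx hx' => rw [add_mul, add_mul, ← hx, ← hx', smul_add]
    | of p F =>
      induction y using DirectSum.induction_on with
      | zero => simp
      | add x x' hx hx' => rw [smul_add, mul_add, mul_add, smul_add, hx, hx']
      | of q G =>
        simp only [← DirectSum.lof_eq_of Γ(X, U), ← map_smul]
        simp only [DirectSum.lof_eq_of, DirectSum.of_mul_of]
        simp only [← DirectSum.lof_eq_of Γ(X, U), ← map_smul]
        congr 1
        ext V hV a
        exact mul_left_comm _ _ _

/-- Restriction as a ring homomorphism of the graded algebras. -/
noncomputable def DAlg.res {U V : X.Opens} (h : V ≤ U) : DAlg f U →+* DAlg f V :=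
  DirectSum.toSemiring (fun n => (DirectSum.of (fun n => DSec f n V) n).comp (DSec.res h))
    (by
      change DirectSum.of (fun n => DSec f n V) 0 _ = DirectSum.of (fun n => DSec f n V) 0 _
      congr 1
      ext W hW a
      change rs _ _ = rs _ _
      simp)
    (fun F G => by
      simp only [AddMonoidHom.comp_apply, DirectSum.of_mul_of]
      rfl)

@[simp] lemma DAlg.res_of {U V : X.Opens} (h : V ≤ U) (n : ℕ) (F : DSec f n U) :
    DAlg.res h (DirectSum.of (fun n => DSec f n U) n F) =
      DirectSum.of (fun n => DSec f n V) n (DSec.res h F) := by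
  simp [DAlg.res]

lemma DAlg.res_smul {U V : X.Opens} (h : V ≤ U) (c : Γ(X, U)) (x : DAlg f U) :
    DAlg.res h (c • x) = rs h c • DAlg.res h x := by
  induction x using DirectSum.induction_on with
  | zero => simp
  | add x y hx hy => rw [smul_add, map_add, hx, hy, map_add, smul_add]
  | of n F =>
    rw [← DirectSum.lof_eq_of Γ(X, U), ← map_smul, DirectSum.lof_eq_of, DAlg.res_of,
      DSec.res_smul, DirectSum.lof_eq_of, DAlg.res_of, ← DirectSum.lof_eq_of Γ(X, V),
      ← DirectSum.lof_eq_of Γ(X, V), map_smul]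

lemma DAlg.res_apply {U V : X.Opens} (h : V ≤ U) (x : DAlg f U) (n : ℕ) :
    (DAlg.res h x) n = DSec.res h (x n) := by
  induction x using DirectSum.induction_on with
  | zero => simp
  | add x y hx hy => rw [map_add, DirectSum.add_apply, hx, hy, DirectSum.add_apply, map_add]
  | of m F =>
    rw [DAlg.res_of]
    by_cases hmn : m = n
    · subst hmn; rw [DirectSum.of_eq_same, DirectSum.of_eq_same]
    · rw [DirectSum.of_eq_of_ne _ _ _ (Ne.symm hmn), DirectSum.of_eq_of_ne _ _ _ (Ne.symm hmn), map_zero]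

end Sections


section Presheaves

variable {X : Scheme.{u}}

/-- A presheaf of abelian groups, given by its sections and restriction maps. -/
def mkAb (M : X.Opens → Type u) [∀ U, AddCommGroup (M U)]
    (res : ∀ {U V : X.Opens}, V ≤ U → M U →+ M V)
    (res_id : ∀ (U : X.Opens) (x : M U), res le_rfl x = x)
    (res_res : ∀ {U V W : X.Opens} (h : V ≤ U) (h' : W ≤ V) (x : M U),
      res h' (res h x) = res (h'.trans h) x) : X.Opensᵒᵖ ⥤ Ab.{u} where
  obj U := AddCommGrpCat.of (M U.unop)
  map i := AddCommGrpCat.ofHom (res i.unop.le)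
  map_id U := by ext x; exact res_id _ x
  map_comp i j := by ext x; exact (res_res _ _ x).symm

/-- A presheaf of `𝒪_X`-modules, given by its sections and restriction maps. -/
noncomputable def mkPresheaf (M : X.Opens → Type u) [∀ U, AddCommGroup (M U)]
    [inst : ∀ U, Module Γ(X, U) (M U)] (res : ∀ {U V : X.Opens}, V ≤ U → M U →+ M V)
    (res_id : ∀ (U : X.Opens) (x : M U), res le_rfl x = x)
    (res_res : ∀ {U V W : X.Opens} (h : V ≤ U) (h' : W ≤ V) (x : M U),
      res h' (res h x) = res (h'.trans h) x)
    (res_smul : ∀ {U V : X.Opens} (h : V ≤ U) (c : Γ(X, U)) (x : M U),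
      res h (c • x) = rs h c • res h x) : X.PresheafOfModules :=
  @PresheafOfModules.ofPresheaf _ _ X.ringCatSheaf.obj (mkAb M res res_id res_res)
    (fun U => inst U.unop) fun _ _ i c x => res_smul i.unop.le c x

end Presheaves

section Sheaf

variable {K : Type u} [Field K] {X : Scheme.{u}} (f : X ⟶ Spec (.of K))

/-- The presheaf of `𝒪_X`-modules of polydifferential operators in `n` arguments. -/
noncomputable def DPre (n : ℕ) : X.PresheafOfModules :=
  mkPresheaf (DSec f n) DSec.res (fun _ _ => rfl) (fun _ _ _ => rfl) DSec.res_smul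

/-- Being a differential operator can be checked on a finite affine cover. -/
lemma IsDO.of_cover {n : ℕ} (i : Fin n) (N : ℕ) {V : X.Opens} {ι : Type*} (W : ι → X.Opens)
    (hW : ∀ j, W j ≤ V) (hcov : V ≤ iSup W) (F : Coch n Γ(X, V)) (G : ∀ j, Coch n Γ(X, W j))
    (hFG : ∀ j a, rs (hW j) (F a) = G j (fun k => rs (hW j) (a k)))
    (hG : ∀ j, IsDO i N (G j)) : IsDO i N F := by
  induction N generalizing F G with
  | zero =>
    change F = 0
    funext a
    refine TopCat.Sheaf.eq_of_locally_eq' X.sheaf W V (fun j => homOfLE (hW j)) hcov _ _ fun j => ?_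
    have := hFG j a
    rw [show G j = 0 from hG j] at this
    exact this.trans (map_zero (rs (hW j))).symm
  | succ N ih =>
    intro b
    refine ih (comm i b F) (fun j => comm i (rs (hW j) b) (G j)) (fun j a => ?_) fun j => hG j _
    simp only [comm, map_sub, map_mul, hFG]
    congr 2
    funext k
    by_cases hk : k = i
    · subst hk; simp
    · simp [hk]

lemma DPre_isSheaf (n : ℕ) : Presheaf.IsSheaf (Opens.grothendieckTopology X) (DPre f n).presheaf := by
  change TopCat.Presheaf.IsSheaf (C := Ab.{u}) (X := X.toTopCat) (DPre f n).presheaf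
  rw [TopCat.Presheaf.isSheaf_iff_isSheafUniqueGluing]
  intro ι U s hs
  -- `s i` is a polydifferential operator on `U i`
  have hs' : ∀ i : ι, ∃ F : DSec f n (U i), F = s i := fun i => ⟨s i, rfl⟩
  choose F hF using hs'
  have hc : ∀ (i j : ι) (V : X.Opens) (hi : V ≤ U i) (hj : V ≤ U j) (a : Fin n → Γ(X, V)),
      (F i).on V hi a = (F j).on V hj a := by
    intro i j V hi hj a
    have h := hs i j
    rw [← hF i, ← hF j] at h
    have h' : DSec.res (inf_le_left : U i ⊓ U j ≤ U i) (F i) =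
      DSec.res (inf_le_right : U i ⊓ U j ≤ U j) (F j) := h
    have := congrArg (fun G : DSec f n (U i ⊓ U j) => G.on V (le_inf hi hj) a) h'
    exact this
  have hex : ∀ (V : X.Opens) (hV : V ≤ iSup U) (a : Fin n → Γ(X, V)),
      ∃! t : Γ(X, V), ∀ i : ι, rs (inf_le_left : V ⊓ U i ≤ V) t =
        (F i).on (V ⊓ U i) inf_le_right (fun k => rs inf_le_left (a k)) := by
    intro V hV a
    refine TopCat.Sheaf.existsUnique_gluing' X.sheaf (fun i => V ⊓ U i) V
      (fun i => homOfLE inf_le_left) (by rw [← inf_iSup_eq]; exact le_inf le_rfl hV)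
      (fun i => (F i).on (V ⊓ U i) inf_le_right (fun k => rs inf_le_left (a k))) fun i j => ?_
    have h1 := (F i).rs_on (inf_le_right : V ⊓ U i ≤ U i)
      (inf_le_left : (V ⊓ U i) ⊓ (V ⊓ U j) ≤ V ⊓ U i) (fun k => rs inf_le_left (a k))
    have h2 := (F j).rs_on (inf_le_right : V ⊓ U j ≤ U j)
      (inf_le_right : (V ⊓ U i) ⊓ (V ⊓ U j) ≤ V ⊓ U j) (fun k => rs inf_le_left (a k))
    refine h1.trans (Eq.trans ?_ h2.symm)
    simp only [rs_rs]
    exact hc i j _ _ _ _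
  choose G hG hGu using hex
  have huniq : ∀ {V : X.Opens} (hV : V ≤ iSup U) (x y : Γ(X, V)),
      (∀ i, rs (inf_le_left : V ⊓ U i ≤ V) x = rs (inf_le_left : V ⊓ U i ≤ V) y) → x = y := by
    intro V hV x y hxy
    exact TopCat.Sheaf.eq_of_locally_eq' X.sheaf (fun i => V ⊓ U i) V
      (fun i => homOfLE inf_le_left) (by rw [← inf_iSup_eq]; exact le_inf le_rfl hV) x y hxy
  -- on an open set contained in `U i`, the glued operator is the `i`-th one
  have hGF : ∀ (i : ι) (V W : X.Opens) (hV : V ≤ iSup U) (hW : W ≤ V) (hi : W ≤ U i)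
      (a : Fin n → Γ(X, V)), rs hW (G V hV a) = (F i).on W hi (fun k => rs hW (a k)) := by
    intro i V W hV hW hi a
    have h := congrArg (rs (le_inf hW hi : W ≤ V ⊓ U i)) (hG V hV a i)
    rw [rs_rs, (F i).rs_on] at h
    simpa only [rs_rs] using h
  have hres : ∀ (V W : X.Opens) (hV : V ≤ iSup U) (h : W ≤ V) (a : Fin n → Γ(X, V)),
      rs h (G V hV a) = G W (h.trans hV) (fun k => rs h (a k)) := by
    intro V W hV h a
    refine huniq (h.trans hV) _ _ fun i => ?_
    rw [rs_rs, hGF i V (W ⊓ U i) hV (inf_le_left.trans h) inf_le_right,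
      hGF i W (W ⊓ U i) (h.trans hV) inf_le_left inf_le_right]
    simp only [rs_rs]
  have hpd : ∀ (V : X.Opens) (hV : V ≤ iSup U), IsAffineOpen V →
      IsPolyDiff (structMap f V) (G V hV) := by
    intro V hV hVa
    -- a finite affine cover of `V` subordinate to `U`
    have hpt : ∀ x : V, ∃ W : X.Opens, IsAffineOpen W ∧ x.1 ∈ W ∧ W ≤ V ∧ ∃ i, W ≤ U i := by
      intro x
      obtain ⟨i, hi⟩ := TopologicalSpace.Opens.mem_iSup.1 (hV x.2)
      obtain ⟨W, hW, hxW, hWV⟩ := exists_isAffineOpen_mem_and_subset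
        (x := x.1) (U := V ⊓ U i) ⟨x.2, hi⟩
      exact ⟨W, hW, hxW, fun y hy => (hWV hy).1, i, fun y hy => (hWV hy).2⟩
    choose W hWa hxW hWV idx hWU using hpt
    obtain ⟨t, ht⟩ := hVa.isCompact.elim_finite_subcover (fun x : V => (W x : Set X))
      (fun x => (W x).2) (fun x hx => Set.mem_iUnion.2 ⟨⟨x, hx⟩, hxW ⟨x, hx⟩⟩)
    have hcov : V ≤ iSup (fun x : t => W x.1) := by
      intro x hx
      obtain ⟨y, hy, hxy⟩ := Set.mem_iUnion₂.1 (ht hx)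
      exact TopologicalSpace.Opens.mem_iSup.2 ⟨⟨y, hy⟩, hxy⟩
    have hGW : ∀ (x : V) (a : Fin n → Γ(X, V)), rs (hWV x) (G V hV a) =
        (F (idx x)).on (W x) (hWU x) (fun k => rs (hWV x) (a k)) :=
      fun x a => hGF (idx x) V (W x) hV (hWV x) (hWU x) a
    have hP : ∀ x : V, IsPolyDiff (structMap f (W x)) ((F (idx x)).on (W x) (hWU x)) :=
      fun x => (F (idx x)).isPolyDiff (hWU x) (hWa x)
    have hu : ∀ x y : Γ(X, V), (∀ z : t, rs (hWV z.1) x = rs (hWV z.1) y) → x = y := fun x y h =>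
      TopCat.Sheaf.eq_of_locally_eq' X.sheaf (fun z : t => W z.1) V (fun z => homOfLE (hWV z.1))
        hcov x y h
    have hupd : ∀ (z : V) (i : Fin n) (a : Fin n → Γ(X, V)) (x : Γ(X, V)),
        (fun k => rs (hWV z) (Function.update a i x k)) =
          Function.update (fun k => rs (hWV z) (a k)) i (rs (hWV z) x) := by
      intro z i a x
      funext k
      by_cases hk : k = i
      · subst hk; simp
      · simp [hk]
    refine ⟨fun i a x y => hu _ _ fun z => ?_, fun i a c x => hu _ _ fun z => ?_, fun i => ?_⟩
    · simp only [map_add, hGW, hupd, (hP z.1).map_add]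
    · simp only [map_mul, hGW, hupd, rs_structMap, (hP z.1).map_smul]
    · choose N hN using fun z : V => (hP z).diff i
      refine ⟨t.sup N, IsDO.of_cover i _ (fun z : t => W z.1) (fun z => hWV z.1) hcov _
        (fun z => (F (idx z.1)).on (W z.1) (hWU z.1)) (fun z a => hGW z.1 a) fun z => ?_⟩
      exact (hN z.1).mono (Finset.le_sup z.2)
  let S : DSec f n (iSup U) := DSec.mk G hres hpd
  have hu : ∀ T : DSec f n (iSup U), (∀ i, DSec.res (le_iSup U i) T = F i) → T = S := by
    intro T hT
    refine DSec.ext fun V hV a => hGu V hV a _ fun i => ?_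
    rw [DSec.rs_on, ← hT i]
    rfl
  refine ⟨S, fun i => ?_, fun T hT => ?_⟩
  · rw [← hF i]
    change DSec.res (le_iSup U i) S = F i
    ext V hV a
    have := hGF i V V (hV.trans (le_iSup U i)) le_rfl hV a
    simp only [rs_self] at this
    exact this
  · exact hu T fun i => (hT i).trans (hF i).symm

/-- The sheaf of `𝒪_X`-modules of polydifferential operators in `n` arguments. -/
noncomputable def Dpoly (n : ℕ) : X.Modules := ⟨DPre f n, DPre_isSheaf f n⟩

end Sheaf


/-! ### The free graded Lie algebra on a module placed in degree one -/

section FreeLie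

set_option linter.unusedSectionVars false

/-- The semilinear extension of a map defined on a basis. -/
noncomputable def semiLift {α : Type*} {R S N : Type*} [CommRing R] [CommRing S] [AddCommGroup N]
    [Module S N] (ρ : R →+* S) (F : α → N) : (α →₀ R) →ₛₗ[ρ] N where
  toFun x := x.sum fun a r => ρ r • F a
  map_add' x y := Finsupp.sum_add_index' (by simp) (by intros; rw [map_add, add_smul])
  map_smul' c x := by
    rw [Finsupp.sum_smul_index' (by simp), Finsupp.smul_sum]
    simp only [smul_eq_mul, map_mul, mul_smul]

@[simp] lemma semiLift_single {α : Type*} {R S N : Type*} [CommRing R] [CommRing S]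
    [AddCommGroup N] [Module S N] (ρ : R →+* S) (F : α → N) (a : α) (r : R) :
    semiLift ρ F (Finsupp.single a r) = ρ r • F a := by
  exact Finsupp.sum_single_index (h := fun a r => ρ r • F a) (by simp)

variable (R : Type*) (M : Type*) [CommRing R] [AddCommGroup M] [Module R M]

/-- The relations of the free graded Lie algebra on an `R`-module `M` placed in degree `1`. Bracket
words in elements of `M` are elements of the free magma on `M`, a word with `n` letters has degree
`n`, and the product `u * v` of words stands for the bracket `[u, v]`. The relations are linearity
in the letters, graded antisymmetry, the graded Jacobi identity, and all their brackets with words.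
-/
inductive LieRel : ℕ → (FreeMagma M →₀ R) → Prop
  | add (x y : M) : LieRel 1 (Finsupp.single (.of (x + y)) 1 -
      Finsupp.single (.of x) 1 - Finsupp.single (.of y) 1)
  | smul (c : R) (x : M) : LieRel 1 (Finsupp.single (.of (c • x)) 1 - Finsupp.single (.of x) c)
  | antisymm (u v : FreeMagma M) : LieRel (u.length + v.length) (Finsupp.single (u * v) 1 +
      Finsupp.single (v * u) ((-1) ^ (u.length * v.length)))
  | jacobi (u v w : FreeMagma M) : LieRel (u.length + v.length + w.length)
      (Finsupp.single (u * (v * w)) 1 - Finsupp.single ((u * v) * w) 1 -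
        Finsupp.single (v * (u * w)) ((-1) ^ (u.length * v.length)))
  | bracket_left (u : FreeMagma M) (n : ℕ) (x : FreeMagma M →₀ R) : LieRel n x →
      LieRel (u.length + n) (x.mapDomain (u * ·))
  | bracket_right (u : FreeMagma M) (n : ℕ) (x : FreeMagma M →₀ R) : LieRel n x →
      LieRel (n + u.length) (x.mapDomain (· * u))

/-- The span of the relations. -/
noncomputable def lieIdeal : Submodule R (FreeMagma M →₀ R) := Submodule.span R {x | ∃ n, LieRel R M n x}

/-- The free graded Lie algebra over `R` on the module `M` placed in degree `1`. -/
abbrev FreeGLie : Type _ := (FreeMagma M →₀ R) ⧸ lieIdeal R M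

/-- The class of a bracket word. -/
noncomputable def FreeGLie.word (u : FreeMagma M) : FreeGLie R M :=
  (lieIdeal R M).mkQ (Finsupp.single u 1)

/-- The part of degree `n` of the free graded Lie algebra. -/
noncomputable def FreeGLie.deg (n : ℕ) : Submodule R (FreeGLie R M) :=
  Submodule.span R {x | ∃ u : FreeMagma M, u.length = n ∧ x = FreeGLie.word R M u}

variable {R M}

/-- Semilinear maps out of the free graded Lie algebra, given on bracket words. -/
lemma lieIdeal_le_ker {S N : Type*} [CommRing S] [AddCommGroup N] [Module S N] (ρ : R →+* S)
    (F : FreeMagma M → N) (h_add : ∀ x y, F (.of (x + y)) = F (.of x) + F (.of y))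
    (h_smul : ∀ (c : R) x, F (.of (c • x)) = ρ c • F (.of x))
    (h_anti : ∀ u v, F (u * v) = - ((-1 : S) ^ (u.length * v.length) • F (v * u)))
    (h_jac : ∀ u v w, F (u * (v * w)) = F ((u * v) * w) +
      (-1 : S) ^ (u.length * v.length) • F (v * (u * w)))
    (h_left : ∀ (u : FreeMagma M) (n : ℕ), ∃ T : N →ₗ[S] N,
      ∀ v : FreeMagma M, v.length = n → F (u * v) = T (F v))
    (h_right : ∀ (u : FreeMagma M) (n : ℕ), ∃ T : N →ₗ[S] N,
      ∀ v : FreeMagma M, v.length = n → F (v * u) = T (F v)) :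
    lieIdeal R M ≤ LinearMap.ker (semiLift ρ F) := by
  have key : ∀ n x, LieRel R M n x →
      x ∈ Finsupp.supported R R {u : FreeMagma M | u.length = n} ∧ semiLift ρ F x = 0 := by
    have hT : ∀ (g : FreeMagma M → FreeMagma M) (n : ℕ) (T : N →ₗ[S] N)
        (_ : ∀ v : FreeMagma M, v.length = n → F (g v) = T (F v)) (x : FreeMagma M →₀ R)
        (_ : x ∈ Finsupp.supported R R {u : FreeMagma M | u.length = n}),
        semiLift ρ F (x.mapDomain g) = T (semiLift ρ F x) := by
      intro g n T hT x hx
      rw [← Finsupp.sum_single x, Finsupp.mapDomain_sum]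
      simp only [Finsupp.sum, map_sum, Finsupp.mapDomain_single, semiLift_single, map_smul]
      refine Finset.sum_congr rfl fun u hu => ?_
      rw [hT u ((Finsupp.mem_supported _ _).1 hx hu)]
    have hS : ∀ (g : FreeMagma M → FreeMagma M) (n m : ℕ)
        (_ : ∀ v : FreeMagma M, v.length = n → (g v).length = m) (x : FreeMagma M →₀ R)
        (_ : x ∈ Finsupp.supported R R {u : FreeMagma M | u.length = n}),
        x.mapDomain g ∈ Finsupp.supported R R {u : FreeMagma M | u.length = m} := by
      intro g n m hg x hx
      rw [Finsupp.mem_supported]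
      intro u hu
      classical
      obtain ⟨v, hv, rfl⟩ := Finset.mem_image.1 (Finsupp.mapDomain_support hu)
      exact hg v ((Finsupp.mem_supported _ _).1 hx hv)
    intro n x hx
    induction hx with
    | add x y =>
      refine ⟨Submodule.sub_mem _ (Submodule.sub_mem _ ?_ ?_) ?_, ?_⟩
      · exact Finsupp.single_mem_supported R _ rfl
      · exact Finsupp.single_mem_supported R _ rfl
      · exact Finsupp.single_mem_supported R _ rfl
      · simp only [map_sub, semiLift_single, h_add, map_one, one_smul]; abel
    | smul c x =>
      refine ⟨Submodule.sub_mem _ ?_ ?_, ?_⟩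
      · exact Finsupp.single_mem_supported R _ rfl
      · exact Finsupp.single_mem_supported R _ rfl
      · simp only [map_sub, semiLift_single, h_smul, map_one, one_smul, sub_self]
    | antisymm u v =>
      refine ⟨Submodule.add_mem _ ?_ ?_, ?_⟩
      · exact Finsupp.single_mem_supported R _ rfl
      · exact Finsupp.single_mem_supported R _ (add_comm _ _)
      · simp only [map_add, semiLift_single, h_anti u v, map_one, one_smul, map_pow, map_neg]
        abel
    | jacobi u v w =>
      refine ⟨Submodule.sub_mem _ (Submodule.sub_mem _ ?_ ?_) ?_, ?_⟩
      · exact Finsupp.single_mem_supported R _ (add_assoc _ _ _).symm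
      · exact Finsupp.single_mem_supported R _ rfl
      · exact Finsupp.single_mem_supported R _ (by
          change v.length + (u.length + w.length) = _; omega)
      · simp only [map_sub, semiLift_single, h_jac u v w, map_one, one_smul, map_pow, map_neg]
        abel
    | bracket_left u n x hx ih =>
      obtain ⟨T, h⟩ := h_left u n
      refine ⟨hS _ n _ (fun v hv => ?_) x ih.1, ?_⟩
      · change u.length + v.length = _; rw [hv]
      · rw [hT _ n T h x ih.1, ih.2, map_zero]
    | bracket_right u n x hx ih =>
      obtain ⟨T, h⟩ := h_right u n
      refine ⟨hS _ n _ (fun v hv => ?_) x ih.1, ?_⟩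
      · change v.length + u.length = _; rw [hv]
      · rw [hT _ n T h x ih.1, ih.2, map_zero]
  rw [lieIdeal, Submodule.span_le]
  rintro x ⟨n, hx⟩
  exact (key n x hx).2

lemma FreeGLie.word_add (x y : M) : FreeGLie.word R M (.of (x + y)) =
    FreeGLie.word R M (.of x) + FreeGLie.word R M (.of y) := by
  have := (Submodule.Quotient.mk_eq_zero (lieIdeal R M)).2
    (Submodule.subset_span ⟨1, LieRel.add x y⟩)
  rw [Submodule.Quotient.mk_sub, Submodule.Quotient.mk_sub, sub_sub, sub_eq_zero] at this
  exact this

lemma FreeGLie.mkQ_single (u : FreeMagma M) (c : R) :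
    (lieIdeal R M).mkQ (Finsupp.single u c) = c • FreeGLie.word R M u := by
  rw [FreeGLie.word, ← map_smul, Finsupp.smul_single, smul_eq_mul, mul_one]

lemma FreeGLie.word_smul (c : R) (x : M) : FreeGLie.word R M (.of (c • x)) =
    c • FreeGLie.word R M (.of x) := by
  have := (Submodule.Quotient.mk_eq_zero (lieIdeal R M)).2
    (Submodule.subset_span ⟨1, LieRel.smul c x⟩)
  rw [Submodule.Quotient.mk_sub, sub_eq_zero] at this
  exact this.trans (mkQ_single _ _)

lemma FreeGLie.word_antisymm (u v : FreeMagma M) : FreeGLie.word R M (u * v) =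
    - ((-1 : R) ^ (u.length * v.length) • FreeGLie.word R M (v * u)) := by
  have := (Submodule.Quotient.mk_eq_zero (lieIdeal R M)).2
    (Submodule.subset_span ⟨_, LieRel.antisymm u v⟩)
  rw [Submodule.Quotient.mk_add] at this
  rw [eq_neg_iff_add_eq_zero, ← mkQ_single]
  exact this

lemma FreeGLie.word_jacobi (u v w : FreeMagma M) : FreeGLie.word R M (u * (v * w)) =
    FreeGLie.word R M ((u * v) * w) +
      (-1 : R) ^ (u.length * v.length) • FreeGLie.word R M (v * (u * w)) := by
  have := (Submodule.Quotient.mk_eq_zero (lieIdeal R M)).2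
    (Submodule.subset_span ⟨_, LieRel.jacobi u v w⟩)
  rw [Submodule.Quotient.mk_sub, Submodule.Quotient.mk_sub, sub_sub, sub_eq_zero] at this
  rw [← mkQ_single]
  exact this

lemma FreeGLie.exists_left (u : FreeMagma M) : ∃ T : FreeGLie R M →ₗ[R] FreeGLie R M,
    ∀ v : FreeMagma M, FreeGLie.word R M (u * v) = T (FreeGLie.word R M v) := by
  refine ⟨(lieIdeal R M).mapQ _ (Finsupp.lmapDomain R R (u * ·)) ?_, fun v => ?_⟩
  · rw [lieIdeal, Submodule.span_le]
    rintro x ⟨n, hx⟩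
    exact Submodule.subset_span ⟨_, LieRel.bracket_left u n x hx⟩
  · simp only [FreeGLie.word, Submodule.mkQ_apply, Submodule.mapQ_apply,
      Finsupp.lmapDomain_apply, Finsupp.mapDomain_single]

lemma FreeGLie.exists_right (u : FreeMagma M) : ∃ T : FreeGLie R M →ₗ[R] FreeGLie R M,
    ∀ v : FreeMagma M, FreeGLie.word R M (v * u) = T (FreeGLie.word R M v) := by
  refine ⟨(lieIdeal R M).mapQ _ (Finsupp.lmapDomain R R (· * u)) ?_, fun v => ?_⟩
  · rw [lieIdeal, Submodule.span_le]
    rintro x ⟨n, hx⟩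
    exact Submodule.subset_span ⟨_, LieRel.bracket_right u n x hx⟩
  · simp only [FreeGLie.word, Submodule.mkQ_apply, Submodule.mapQ_apply,
      Finsupp.lmapDomain_apply, Finsupp.mapDomain_single]

lemma length_map {M' : Type*} (φ : M → M') (u : FreeMagma M) :
    (FreeMagma.map φ u).length = u.length := by
  induction u using FreeMagma.recOnMul with
  | ih1 x => rfl
  | ih2 u v hu hv => rw [map_mul]; change _ + _ = _ + _; rw [hu, hv]

/-- Functoriality of the free graded Lie algebra along semilinear maps. -/
noncomputable def FreeGLie.map {R' M' : Type*} [CommRing R'] [AddCommGroup M'] [Module R' M']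
    (ρ : R →+* R') (φ : M →ₛₗ[ρ] M') : FreeGLie R M →ₛₗ[ρ] FreeGLie R' M' :=
  (lieIdeal R M).liftQ (semiLift ρ fun u => FreeGLie.word R' M' (FreeMagma.map φ u)) <| by
    refine lieIdeal_le_ker ρ _ (fun x y => ?_) (fun c x => ?_) (fun u v => ?_) (fun u v w => ?_)
      (fun u n => ?_) (fun u n => ?_)
    · simp only [FreeMagma.map_of, map_add, word_add]
    · simp only [FreeMagma.map_of, map_smulₛₗ, word_smul]
    · rw [map_mul, map_mul, word_antisymm, length_map, length_map]
    · simp only [map_mul]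
      rw [word_jacobi, length_map, length_map]
    · obtain ⟨T, hT⟩ := exists_left (R := R') (FreeMagma.map φ u)
      exact ⟨T, fun v _ => by rw [map_mul, hT]⟩
    · obtain ⟨T, hT⟩ := exists_right (R := R') (FreeMagma.map φ u)
      exact ⟨T, fun v _ => by rw [map_mul, hT]⟩

@[simp] lemma FreeGLie.map_word {R' M' : Type*} [CommRing R'] [AddCommGroup M'] [Module R' M']
    (ρ : R →+* R') (φ : M →ₛₗ[ρ] M') (u : FreeMagma M) :
    FreeGLie.map ρ φ (FreeGLie.word R M u) = FreeGLie.word R' M' (FreeMagma.map φ u) := by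
  rw [FreeGLie.map, FreeGLie.word, Submodule.mkQ_apply]
  erw [Submodule.liftQ_apply]
  rw [semiLift_single, map_one, one_smul]

lemma FreeGLie.map_mem_deg {R' M' : Type*} [CommRing R'] [AddCommGroup M'] [Module R' M']
    (ρ : R →+* R') (φ : M →ₛₗ[ρ] M') (n : ℕ) {x : FreeGLie R M} (hx : x ∈ FreeGLie.deg R M n) :
    FreeGLie.map ρ φ x ∈ FreeGLie.deg R' M' n := by
  induction hx using Submodule.span_induction with
  | mem x h =>
    obtain ⟨u, hu, rfl⟩ := h
    rw [map_word]
    exact Submodule.subset_span ⟨_, (length_map φ u).trans hu, rfl⟩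
  | zero => rw [map_zero]; exact Submodule.zero_mem _
  | add x y _ _ hx hy => rw [map_add]; exact Submodule.add_mem _ hx hy
  | smul c x _ hx => rw [map_smulₛₗ]; exact Submodule.smul_mem _ _ hx

variable {B : Type*} [Ring B] [Module R B] [IsScalarTower R B B] [SMulCommClass R B B]

/-- The value of a bracket word in an associative algebra `B`, for letters sent to `B` by `φ`:
the graded commutator `[x, y] = x y - (-1)^(|x||y|) y x` of the values. -/
def evalWord (φ : M → B) : FreeMagma M → B
  | .of x => φ x
  | .mul u v => evalWord φ u * evalWord φ v -
      (-1) ^ (u.length * v.length) * (evalWord φ v * evalWord φ u)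

lemma evalWord_mul (φ : M → B) (u v : FreeMagma M) :
    evalWord φ (u * v) = evalWord φ u * evalWord φ v -
      (-1) ^ (u.length * v.length) * (evalWord φ v * evalWord φ u) := rfl

/-- The homomorphism of graded Lie algebras from the free graded Lie algebra on `M` to an
associative algebra extending a linear map. -/
noncomputable def FreeGLie.eval (φ : M →ₗ[R] B) : FreeGLie R M →ₗ[R] B :=
  (lieIdeal R M).liftQ (semiLift (RingHom.id R) (evalWord φ)) <| by
    have hs : ∀ (k : ℕ) (x : B), ((-1 : R) ^ k) • x = (-1 : B) ^ k * x := by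
      intro k x
      rcases neg_one_pow_eq_or R k with h | h <;> rcases Nat.even_or_odd k with h' | h' <;>
        simp [h'.neg_one_pow]
    refine lieIdeal_le_ker _ _ (fun x y => map_add φ x y) (fun c x => map_smul φ c x)
      (fun u v => ?_) (fun u v w => ?_) (fun u n => ?_) (fun u n => ?_)
    · rw [hs, evalWord_mul, evalWord_mul, mul_comm v.length]
      rcases neg_one_pow_eq_or B (u.length * v.length) with h | h <;> rw [h] <;> noncomm_ring
    · rw [hs]
      simp only [evalWord_mul]
      change _ - (-1) ^ (u.length * (v.length + w.length)) * _ = _ -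
        (-1) ^ ((u.length + v.length) * w.length) * _ + _ * (_ -
          (-1) ^ (v.length * (u.length + w.length)) * _)
      simp only [mul_add, add_mul, pow_add, mul_comm v.length u.length]
      rcases neg_one_pow_eq_or B (u.length * v.length) with h1 | h1 <;>
        rcases neg_one_pow_eq_or B (u.length * w.length) with h2 | h2 <;>
        rcases neg_one_pow_eq_or B (v.length * w.length) with h3 | h3 <;>
        rw [h1, h2, h3] <;> noncomm_ring
    · refine ⟨LinearMap.mulLeft R (evalWord φ u) -
        (-1 : R) ^ (u.length * n) • LinearMap.mulRight R (evalWord φ u), fun v hv => ?_⟩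
      rw [evalWord_mul, hv]
      simp only [LinearMap.sub_apply, LinearMap.smul_apply, LinearMap.mulLeft_apply,
        LinearMap.mulRight_apply, hs]
    · refine ⟨LinearMap.mulRight R (evalWord φ u) -
        (-1 : R) ^ (n * u.length) • LinearMap.mulLeft R (evalWord φ u), fun v hv => ?_⟩
      rw [evalWord_mul, hv]
      simp only [LinearMap.sub_apply, LinearMap.smul_apply, LinearMap.mulLeft_apply,
        LinearMap.mulRight_apply, hs]

@[simp] lemma FreeGLie.eval_word (φ : M →ₗ[R] B) (u : FreeMagma M) :
    FreeGLie.eval φ (FreeGLie.word R M u) = evalWord φ u := by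
  rw [FreeGLie.eval, FreeGLie.word, Submodule.mkQ_apply]
  erw [Submodule.liftQ_apply]
  rw [semiLift_single, map_one, one_smul]

end FreeLie


/-! ### Graded symmetric powers -/

section GradedSym

set_option linter.unusedSectionVars false

/-- The Koszul sign `s(σ)` with `z₁ ⋯ z_k = s(σ) z_{σ(1)} ⋯ z_{σ(k)}` for graded commuting elements
`zᵢ` of degrees `dᵢ`: each pair whose order is reversed contributes `(-1)^(product of degrees)`. -/
def koszulSign {k : ℕ} (d : Fin k → ℕ) (σ : Equiv.Perm (Fin k)) : ℤ :=
  ∏ i, ∏ j, if i < j ∧ σ j < σ i then (-1) ^ (d (σ i) * d (σ j)) else 1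

lemma prod_pairs_perm {k : ℕ} (τ : Equiv.Perm (Fin k)) (h : Fin k → Fin k → ℤ)
    (hs : ∀ i j, h i j = h j i) :
    (∏ i, ∏ j, if i < j then h (τ i) (τ j) else 1) = ∏ i, ∏ j, if i < j then h i j else 1 := by
  rw [← Finset.prod_product' (f := fun i j => if i < j then h (τ i) (τ j) else 1),
    ← Finset.prod_product' (f := fun i j => if i < j then h i j else 1), ← Finset.prod_filter,
    ← Finset.prod_filter]
  refine Finset.prod_bij' (fun p _ => if τ p.1 < τ p.2 then (τ p.1, τ p.2) else (τ p.2, τ p.1))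
    (fun p _ => if τ.symm p.1 < τ.symm p.2 then (τ.symm p.1, τ.symm p.2)
      else (τ.symm p.2, τ.symm p.1)) ?_ ?_ ?_ ?_ ?_
  · rintro ⟨i, j⟩ hij
    simp only [Finset.univ_product_univ, Finset.mem_filter, Finset.mem_univ, true_and] at hij ⊢
    have : τ i ≠ τ j := fun h => hij.ne (τ.injective h)
    split_ifs with h1
    · exact h1
    · exact lt_of_le_of_ne (not_lt.1 h1) this.symm
  · rintro ⟨i, j⟩ hij
    simp only [Finset.univ_product_univ, Finset.mem_filter, Finset.mem_univ, true_and] at hij ⊢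
    have : τ.symm i ≠ τ.symm j := fun h => hij.ne (τ.symm.injective h)
    split_ifs with h1
    · exact h1
    · exact lt_of_le_of_ne (not_lt.1 h1) this.symm
  · rintro ⟨i, j⟩ hij
    simp only [Finset.univ_product_univ, Finset.mem_filter, Finset.mem_univ, true_and] at hij
    by_cases h1 : τ i < τ j <;> simp [h1, hij, not_lt.2 hij.le]
  · rintro ⟨i, j⟩ hij
    simp only [Finset.univ_product_univ, Finset.mem_filter, Finset.mem_univ, true_and] at hij
    by_cases h1 : τ.symm i < τ.symm j <;> simp [h1, hij, not_lt.2 hij.le]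
  · rintro ⟨i, j⟩ hij
    by_cases h1 : τ i < τ j <;> simp [h1, hs]

lemma koszulSign_mul {k : ℕ} (d : Fin k → ℕ) (σ τ : Equiv.Perm (Fin k)) :
    koszulSign d (σ * τ) = koszulSign d σ * koszulSign (d ∘ σ) τ := by
  have h1 : koszulSign d σ = ∏ i, ∏ j, if i < j then
      (if (τ i < τ j ∧ σ (τ j) < σ (τ i)) ∨ (τ j < τ i ∧ σ (τ i) < σ (τ j)) then
        (-1) ^ (d (σ (τ i)) * d (σ (τ j))) else (1 : ℤ)) else 1 := by
    rw [prod_pairs_perm τ (fun i j => if (i < j ∧ σ j < σ i) ∨ (j < i ∧ σ i < σ j) then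
      (-1) ^ (d (σ i) * d (σ j)) else (1 : ℤ)) (fun i j => by
        rw [mul_comm (d (σ i))]; exact if_congr or_comm rfl rfl)]
    refine Finset.prod_congr rfl fun i _ => Finset.prod_congr rfl fun j _ => ?_
    by_cases hij : i < j
    · simp [hij, not_lt.2 hij.le]
    · simp [hij]
  rw [h1]
  simp only [koszulSign, ← Finset.prod_mul_distrib]
  refine Finset.prod_congr rfl fun i _ => Finset.prod_congr rfl fun j _ => ?_
  by_cases hij : i < j
  · have hτ : τ i ≠ τ j := fun h => hij.ne (τ.injective h)
    have hσ : σ (τ i) ≠ σ (τ j) := fun h => hτ (σ.injective h)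
    have hsq : ((-1 : ℤ) ^ (d (σ (τ i)) * d (σ (τ j)))) * (-1) ^ (d (σ (τ i)) * d (σ (τ j))) = 1 := by
      rw [← mul_pow]; simp
    rcases lt_or_gt_of_ne hτ with h2 | h2 <;> rcases lt_or_gt_of_ne hσ with h3 | h3 <;>
      simp [hij, h2, h3, not_lt.2 h2.le, not_lt.2 h3.le, hsq]
  · simp [hij]

/-- The sign `(-1)^(d₁ + ⋯ + d_{i-1})` in the graded Leibniz rule. -/
def leibnizSign {k : ℕ} (d : Fin k → ℕ) (i : Fin k) : ℤ :=
  ∏ j, if j < i then (-1) ^ d j else 1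

lemma leibniz_koszul {k : ℕ} (d : Fin k → ℕ) (σ : Equiv.Perm (Fin k)) (m : Fin k) :
    koszulSign d σ * leibnizSign (d ∘ σ) m =
      leibnizSign d (σ m) * koszulSign (Function.update d (σ m) (d (σ m) + 1)) σ := by
  have hL : leibnizSign d (σ m) = ∏ j, if σ j < σ m then (-1) ^ d (σ j) else (1 : ℤ) := by
    rw [leibnizSign, ← Equiv.prod_comp σ]
  have hK : koszulSign (Function.update d (σ m) (d (σ m) + 1)) σ = koszulSign d σ *
      ((∏ j, if m < j ∧ σ j < σ m then (-1) ^ d (σ j) else 1) *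
        ∏ i, if i < m ∧ σ m < σ i then (-1) ^ d (σ i) else 1) := by
    have e1 : (∏ j, if m < j ∧ σ j < σ m then (-1) ^ d (σ j) else (1 : ℤ)) =
        ∏ i, ∏ j, if i = m ∧ (i < j ∧ σ j < σ i) then (-1) ^ d (σ j) else 1 := by
      symm
      rw [Finset.prod_eq_single m]
      · simp
      · intro b _ hb; simp [hb]
      · simp
    have e2 : (∏ i, if i < m ∧ σ m < σ i then (-1) ^ d (σ i) else (1 : ℤ)) =
        ∏ i, ∏ j, if j = m ∧ (i < j ∧ σ j < σ i) then (-1) ^ d (σ i) else 1 := by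
      refine Finset.prod_congr rfl fun i _ => ?_
      symm
      rw [Finset.prod_eq_single m]
      · simp
      · intro b _ hb; simp [hb]
      · simp
    rw [e1, e2]
    simp only [koszulSign, ← Finset.prod_mul_distrib]
    refine Finset.prod_congr rfl fun i _ => Finset.prod_congr rfl fun j _ => ?_
    by_cases h : i < j ∧ σ j < σ i
    · by_cases hi : i = m
      · subst hi
        have hj : j ≠ i := h.1.ne'
        simp [h, hj, pow_add, add_mul]
      · by_cases hj : j = m
        · subst hj
          simp [h, hi, pow_add, mul_add]
        · simp [h, hi, hj]
    · simp [h]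
  rw [hK, hL, mul_left_comm]
  congr 1
  simp only [leibnizSign, ← Finset.prod_mul_distrib]
  refine Finset.prod_congr rfl fun j _ => ?_
  have hsq : ((-1 : ℤ) ^ d (σ j)) * (-1) ^ d (σ j) = 1 := by
    rw [← mul_pow]; simp
  rcases lt_trichotomy j m with h | h | h
  · have hσ : σ j ≠ σ m := fun h' => h.ne (σ.injective h')
    rcases lt_or_gt_of_ne hσ with h3 | h3 <;> simp [h, h3, not_lt.2 h.le, not_lt.2 h3.le]
  · subst h; simp
  · have hσ : σ j ≠ σ m := fun h' => h.ne' (σ.injective h')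
    rcases lt_or_gt_of_ne hσ with h3 | h3 <;> simp [h, h3, not_lt.2 h.le, not_lt.2 h3.le, hsq]

variable (R : Type*) (M : ℕ → Type*) [CommRing R] [∀ n, AddCommGroup (M n)] [∀ n, Module R (M n)]

/-- Words `z₁ ⋯ z_k` of homogeneous elements of a graded module, of any length `k`. -/
abbrev GWord := Σ k : ℕ, (Fin k → Σ n : ℕ, M n)

variable {M} in
/-- The total degree of a word. -/
def GWord.deg (w : GWord M) : ℕ := ∑ i, (w.2 i).1

/-- The relations of the graded symmetric powers: linearity in each factor, and
`z₁ ⋯ z_k = s(σ) z_{σ(1)} ⋯ z_{σ(k)}` for all permutations `σ`. -/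
inductive GSymRel : (GWord M →₀ R) → Prop
  | add {k : ℕ} (z : Fin k → Σ n : ℕ, M n) (i : Fin k) (n : ℕ) (x y : M n) :
    GSymRel (Finsupp.single ⟨k, Function.update z i ⟨n, x + y⟩⟩ 1 -
      Finsupp.single ⟨k, Function.update z i ⟨n, x⟩⟩ 1 -
      Finsupp.single ⟨k, Function.update z i ⟨n, y⟩⟩ 1)
  | smul {k : ℕ} (z : Fin k → Σ n : ℕ, M n) (i : Fin k) (n : ℕ) (c : R) (x : M n) :
    GSymRel (Finsupp.single ⟨k, Function.update z i ⟨n, c • x⟩⟩ 1 -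
      Finsupp.single ⟨k, Function.update z i ⟨n, x⟩⟩ c)
  | perm {k : ℕ} (z : Fin k → Σ n : ℕ, M n) (σ : Equiv.Perm (Fin k)) :
    GSymRel (Finsupp.single ⟨k, z⟩ 1 -
      Finsupp.single ⟨k, z ∘ σ⟩ ((koszulSign (fun i => (z i).1) σ : ℤ) : R))

/-- The direct sum of all symmetric powers `⨁ₖ Symᵏ(M)` of the graded module `M`. -/
abbrev GSym : Type _ := (GWord M →₀ R) ⧸ Submodule.span R {x | GSymRel R M x}

variable {M} in
/-- The class `z₁ ⋯ z_k` of a word. -/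
noncomputable def GSym.word (w : GWord M) : GSym R M :=
  (Submodule.span R {x | GSymRel R M x}).mkQ (Finsupp.single w 1)

/-- The part of (total) degree `n` of `⨁ₖ Symᵏ(M)`. -/
noncomputable def GSym.deg (n : ℕ) : Submodule R (GSym R M) :=
  Submodule.span R {x | ∃ w : GWord M, w.deg = n ∧ x = GSym.word R w}

variable {R M}

/-- Semilinear maps out of the symmetric powers, given on words. -/
noncomputable def GSym.lift {S N : Type*} [CommRing S] [AddCommGroup N] [Module S N] (ρ : R →+* S)
    (F : ∀ k : ℕ, (Fin k → Σ n : ℕ, M n) → N)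
    (h_add : ∀ (k : ℕ) (z : Fin k → Σ n : ℕ, M n) (i : Fin k) (n : ℕ) (x y : M n),
      F k (Function.update z i ⟨n, x + y⟩) =
        F k (Function.update z i ⟨n, x⟩) + F k (Function.update z i ⟨n, y⟩))
    (h_smul : ∀ (k : ℕ) (z : Fin k → Σ n : ℕ, M n) (i : Fin k) (n : ℕ) (c : R) (x : M n),
      F k (Function.update z i ⟨n, c • x⟩) = ρ c • F k (Function.update z i ⟨n, x⟩))
    (h_perm : ∀ (k : ℕ) (z : Fin k → Σ n : ℕ, M n) (σ : Equiv.Perm (Fin k)),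
      F k z = koszulSign (fun i => (z i).1) σ • F k (z ∘ σ)) : GSym R M →ₛₗ[ρ] N :=
  (Submodule.span R {x | GSymRel R M x}).liftQ (semiLift ρ fun w : GWord M => F w.1 w.2) <| by
    rw [Submodule.span_le]
    intro x hx
    change semiLift ρ _ x = 0
    cases hx with
    | add z i n x y =>
      simp only [map_sub, semiLift_single, h_add, map_one, one_smul]; abel
    | smul z i n c x => simp only [map_sub, semiLift_single, h_smul, map_one, one_smul, sub_self]
    | perm z σ =>
      simp only [map_sub, semiLift_single, map_one, one_smul, map_intCast]
      rw [h_perm _ z σ, Int.cast_smul_eq_zsmul, sub_self]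

@[simp] lemma GSym.lift_word {S N : Type*} [CommRing S] [AddCommGroup N] [Module S N] (ρ : R →+* S)
    (F : ∀ k : ℕ, (Fin k → Σ n : ℕ, M n) → N) (h1) (h2) (h3) (w : GWord M) :
    GSym.lift ρ F h1 h2 h3 (GSym.word R w) = F w.1 w.2 := by
  rw [GSym.lift, GSym.word, Submodule.mkQ_apply]
  erw [Submodule.liftQ_apply]
  rw [semiLift_single, map_one, one_smul]

lemma GSym.mkQ_single (w : GWord M) (c : R) :
    (Submodule.span R {x | GSymRel R M x}).mkQ (Finsupp.single w c) = c • GSym.word R w := by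
  rw [GSym.word, ← map_smul, Finsupp.smul_single, smul_eq_mul, mul_one]

lemma GSym.word_add {k : ℕ} (z : Fin k → Σ n : ℕ, M n) (i : Fin k) (n : ℕ) (x y : M n) :
    GSym.word R ⟨k, Function.update z i ⟨n, x + y⟩⟩ =
      GSym.word R ⟨k, Function.update z i ⟨n, x⟩⟩ + GSym.word R ⟨k, Function.update z i ⟨n, y⟩⟩ := by
  have := (Submodule.Quotient.mk_eq_zero (Submodule.span R {x | GSymRel R M x})).2
    (Submodule.subset_span (GSymRel.add z i n x y))
  rw [Submodule.Quotient.mk_sub, Submodule.Quotient.mk_sub, sub_sub, sub_eq_zero] at this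
  exact this

lemma GSym.word_smul {k : ℕ} (z : Fin k → Σ n : ℕ, M n) (i : Fin k) (n : ℕ) (c : R) (x : M n) :
    GSym.word R ⟨k, Function.update z i ⟨n, c • x⟩⟩ =
      c • GSym.word R ⟨k, Function.update z i ⟨n, x⟩⟩ := by
  have := (Submodule.Quotient.mk_eq_zero (Submodule.span R {x | GSymRel R M x})).2
    (Submodule.subset_span (GSymRel.smul z i n c x))
  rw [Submodule.Quotient.mk_sub, sub_eq_zero] at this
  exact this.trans (mkQ_single _ _)

lemma GSym.word_perm {k : ℕ} (z : Fin k → Σ n : ℕ, M n) (σ : Equiv.Perm (Fin k)) :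
    GSym.word R ⟨k, z⟩ = koszulSign (fun i => (z i).1) σ • GSym.word R ⟨k, z ∘ σ⟩ := by
  have := (Submodule.Quotient.mk_eq_zero (Submodule.span R {x | GSymRel R M x})).2
    (Submodule.subset_span (GSymRel.perm z σ))
  rw [Submodule.Quotient.mk_sub, sub_eq_zero] at this
  rw [← Int.cast_smul_eq_zsmul R]
  exact this.trans (mkQ_single _ _)

section Map

variable {R' : Type*} {M' : ℕ → Type*} [CommRing R'] [∀ n, AddCommGroup (M' n)]
  [∀ n, Module R' (M' n)]

lemma comp_update_sigma {k : ℕ} {M M' : ℕ → Type*} (φ : (Σ n, M n) → Σ n, M' n)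
    (z : Fin k → Σ n : ℕ, M n) (i : Fin k) (x : Σ n, M n) :
    (fun j => φ (Function.update z i x j)) = Function.update (fun j => φ (z j)) i (φ x) := by
  funext j
  by_cases hj : j = i
  · subst hj; simp
  · simp [hj]

/-- Functoriality of the symmetric powers along semilinear maps. -/
noncomputable def GSym.map (ρ : R →+* R') (φ : ∀ n, M n →ₛₗ[ρ] M' n) :
    GSym R M →ₛₗ[ρ] GSym R' M' :=
  GSym.lift ρ (fun k z => GSym.word R' ⟨k, fun i => ⟨(z i).1, φ _ (z i).2⟩⟩)
    (fun k z i n x y => by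
      have h := comp_update_sigma (fun x : Σ n, M n => (⟨x.1, φ _ x.2⟩ : Σ n, M' n)) z i
      simp only [h, map_add, word_add])
    (fun k z i n c x => by
      have h := comp_update_sigma (fun x : Σ n, M n => (⟨x.1, φ _ x.2⟩ : Σ n, M' n)) z i
      simp only [h, map_smulₛₗ, word_smul])
    (fun k z σ => word_perm (R := R') (fun i => (⟨(z i).1, φ _ (z i).2⟩ : Σ n, M' n)) σ)

@[simp] lemma GSym.map_word (ρ : R →+* R') (φ : ∀ n, M n →ₛₗ[ρ] M' n) (w : GWord M) :
    GSym.map ρ φ (GSym.word R w) =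
      GSym.word R' ⟨w.1, fun i => ⟨(w.2 i).1, φ _ (w.2 i).2⟩⟩ := GSym.lift_word _ _ _ _ _ _

lemma GSym.map_mem_deg (ρ : R →+* R') (φ : ∀ n, M n →ₛₗ[ρ] M' n) (n : ℕ) {x : GSym R M}
    (hx : x ∈ GSym.deg R M n) : GSym.map ρ φ x ∈ GSym.deg R' M' n := by
  induction hx using Submodule.span_induction with
  | mem x h =>
    obtain ⟨w, hw, rfl⟩ := h
    rw [map_word]
    exact Submodule.subset_span ⟨_, hw, rfl⟩
  | zero => rw [map_zero]; exact Submodule.zero_mem _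
  | add x y _ _ hx hy => rw [map_add]; exact Submodule.add_mem _ hx hy
  | smul c x _ hx => rw [map_smulₛₗ]; exact Submodule.smul_mem _ _ hx

end Map

lemma fst_update {k : ℕ} (z : Fin k → Σ n : ℕ, M n) (i : Fin k) (x : Σ n : ℕ, M n) :
    (fun j => (Function.update z i x j).1) = Function.update (fun j => (z j).1) i x.1 := by
  funext j
  by_cases hj : j = i
  · subst hj; simp
  · simp [hj]

/-- A map of degree one, on homogeneous elements. -/
def sigmaMap (δ : ∀ n, M n →ₗ[R] M (n + 1)) (x : Σ n : ℕ, M n) : Σ n : ℕ, M n :=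
  ⟨x.1 + 1, δ x.1 x.2⟩

/-- The graded derivation of `⨁ₖ Symᵏ(M)` extending maps `δ n : M n → M (n + 1)`:
`z₁ ⋯ z_k ↦ ∑ᵢ (-1)^(d₁ + ⋯ + d_{i-1}) z₁ ⋯ δ(zᵢ) ⋯ z_k`. -/
noncomputable def GSym.der (δ : ∀ n, M n →ₗ[R] M (n + 1)) : GSym R M →ₗ[R] GSym R M :=
  GSym.lift (RingHom.id R)
    (fun k z => ∑ i, leibnizSign (fun j => (z j).1) i •
      GSym.word R ⟨k, Function.update z i (sigmaMap δ (z i))⟩)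
    (fun k z i n x y => by
      simp only [fst_update]
      rw [← Finset.sum_add_distrib]
      refine Finset.sum_congr rfl fun l _ => ?_
      rw [← smul_add]
      congr 1
      by_cases hl : l = i
      · subst hl
        simp only [Function.update_self, Function.update_idem]
        simp only [sigmaMap, map_add, word_add]
      · simp only [Function.update_of_ne hl, Function.update_comm (Ne.symm hl), word_add])
    (fun k z i n c x => by
      simp only [fst_update, Finset.smul_sum, RingHom.id_apply]
      refine Finset.sum_congr rfl fun l _ => ?_
      rw [smul_comm c]
      congr 1
      by_cases hl : l = i
      · subst hl
        simp only [Function.update_self, Function.update_idem]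
        simp only [sigmaMap, map_smul, word_smul]
      · simp only [Function.update_of_ne hl, Function.update_comm (Ne.symm hl), word_smul])
    (fun k z σ => by
      rw [Finset.smul_sum, ← Equiv.sum_comp σ]
      refine Finset.sum_congr rfl fun m _ => ?_
      have h1 : Function.update (z ∘ σ) m (sigmaMap δ (z (σ m))) =
          Function.update z (σ m) (sigmaMap δ (z (σ m))) ∘ σ := by
        funext j
        by_cases hj : j = m
        · subst hj; simp
        · simp [hj]
      rw [word_perm _ σ, fst_update, smul_smul, smul_smul]
      change (leibnizSign (fun j => (z j).1) (σ m) * koszulSign (Function.update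
        (fun j => (z j).1) (σ m) ((z (σ m)).1 + 1)) σ) • _ = _
      rw [← leibniz_koszul (fun j => (z j).1) σ m]
      simp only [Function.comp_apply]
      rw [h1]
      rfl)

@[simp] lemma GSym.der_word (δ : ∀ n, M n →ₗ[R] M (n + 1)) (w : GWord M) :
    GSym.der δ (GSym.word R w) = ∑ i, leibnizSign (fun j => (w.2 j).1) i •
      GSym.word R ⟨w.1, Function.update w.2 i (sigmaMap δ (w.2 i))⟩ :=
  GSym.lift_word _ _ _ _ _ _

lemma GSym.der_mem_deg (δ : ∀ n, M n →ₗ[R] M (n + 1)) (n : ℕ) {x : GSym R M}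
    (hx : x ∈ GSym.deg R M n) : GSym.der δ x ∈ GSym.deg R M (n + 1) := by
  induction hx using Submodule.span_induction with
  | mem x h =>
    obtain ⟨w, hw, rfl⟩ := h
    rw [der_word]
    refine Submodule.sum_mem _ fun i _ => zsmul_mem ?_ _
    let w' : GWord M := ⟨w.1, Function.update w.2 i (sigmaMap δ (w.2 i))⟩
    suffices h : w'.deg = n + 1 from Submodule.subset_span ⟨w', h, rfl⟩
    rw [← hw]
    simp only [GWord.deg, w']
    rw [← Finset.add_sum_erase _ _ (Finset.mem_univ i),
      ← Finset.add_sum_erase _ (fun j => (w.2 j).1) (Finset.mem_univ i), Function.update_self,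
      sigmaMap, add_right_comm]
    congr 2
    refine Finset.sum_congr rfl fun j hj => ?_
    rw [Function.update_of_ne (Finset.ne_of_mem_erase hj)]
  | zero => rw [map_zero]; exact Submodule.zero_mem _
  | add x y _ _ hx hy => rw [map_add]; exact Submodule.add_mem _ hx hy
  | smul c x _ hx => rw [map_smul]; exact Submodule.smul_mem _ _ hx

section Symmetrization

variable {B : Type*} [Ring B] [Module R B] [IsScalarTower R B B] [SMulCommClass R B B]

lemma ofFn_prod_add {k : ℕ} (w : Fin k → B) (i : Fin k) (x y : B) :
    (List.ofFn (Function.update w i (x + y))).prod =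
      (List.ofFn (Function.update w i x)).prod + (List.ofFn (Function.update w i y)).prod := by
  have := (MultilinearMap.mkPiAlgebraFin ℤ k B).map_update_add w i x y
  simp only [MultilinearMap.mkPiAlgebraFin_apply] at this
  exact this

lemma ofFn_prod_smul {k : ℕ} (w : Fin k → B) (i : Fin k) (c : R) (x : B) :
    (List.ofFn (Function.update w i (c • x))).prod =
      c • (List.ofFn (Function.update w i x)).prod := by
  let _ : Algebra R B := Algebra.ofModule (fun r x y => smul_mul_assoc r x y)
    (fun r x y => mul_smul_comm r x y)
  have := (MultilinearMap.mkPiAlgebraFin R k B).map_update_smul w i c x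
  simp only [MultilinearMap.mkPiAlgebraFin_apply] at this
  exact this

/-- A family of maps, on homogeneous elements. -/
def sigmaEval (ψ : ∀ n, M n →ₗ[R] B) (x : Σ n : ℕ, M n) : B := ψ x.1 x.2

lemma sigmaEval_update (ψ : ∀ n, M n →ₗ[R] B) {k : ℕ} (z : Fin k → Σ n : ℕ, M n) (i : Fin k)
    (x : Σ n : ℕ, M n) (σ : Equiv.Perm (Fin k)) :
    (fun j => sigmaEval ψ (Function.update z i x (σ j))) =
      Function.update (fun j => sigmaEval ψ (z (σ j))) (σ.symm i) (sigmaEval ψ x) := by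
  funext j
  by_cases hj : j = σ.symm i
  · subst hj; simp
  · have : σ j ≠ i := fun h => hj (by rw [← h]; simp)
    simp [hj, this]

/-- The symmetrization map from `⨁ₖ Symᵏ(M)` to an associative algebra `B` along linear maps
`ψ n : M n → B`: `z₁ ⋯ z_k ↦ (1/k!) ∑_σ s(σ) ψ(z_{σ(1)}) ⋯ ψ(z_{σ(k)})`. Here `c k` stands for the
scalar `1/k!`. -/
noncomputable def GSym.symmetrize (c : ℕ → R) (ψ : ∀ n, M n →ₗ[R] B) : GSym R M →ₗ[R] B :=
  GSym.lift (RingHom.id R)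
    (fun k z => c k • ∑ σ : Equiv.Perm (Fin k), koszulSign (fun j => (z j).1) σ •
      (List.ofFn fun i => sigmaEval ψ (z (σ i))).prod)
    (fun k z i n x y => by
      simp only [fst_update, sigmaEval_update]
      simp only [sigmaEval, map_add, ofFn_prod_add, smul_add, Finset.sum_add_distrib])
    (fun k z i n r x => by
      simp only [fst_update, sigmaEval_update, RingHom.id_apply]
      rw [smul_comm r (c k)]
      congr 1
      rw [Finset.smul_sum]
      refine Finset.sum_congr rfl fun σ _ => ?_
      rw [smul_comm r]
      congr 1
      simp only [sigmaEval, map_smul, ofFn_prod_smul])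
    (fun k z σ => by
      rw [smul_comm _ (c k)]
      congr 1
      rw [Finset.smul_sum, ← Equiv.sum_comp (Equiv.mulLeft σ)]
      refine Finset.sum_congr rfl fun τ _ => ?_
      rw [smul_smul, Equiv.coe_mulLeft, koszulSign_mul]
      rfl)

@[simp] lemma GSym.symmetrize_word (c : ℕ → R) (ψ : ∀ n, M n →ₗ[R] B) (w : GWord M) :
    GSym.symmetrize c ψ (GSym.word R w) = c w.1 • ∑ σ : Equiv.Perm (Fin w.1),
      koszulSign (fun j => (w.2 j).1) σ • (List.ofFn fun i => sigmaEval ψ (w.2 (σ i))).prod :=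
  GSym.lift_word _ _ _ _ _ _

end Symmetrization

end GradedSym


section Sheaves

variable {X : Scheme.{u}}

/-- A morphism of presheaves of `𝒪_X`-modules, given by its components. -/
noncomputable def mkHom (P Q : X.PresheafOfModules)
    (φ : ∀ U : X.Opens, P.obj (op U) →+ Q.obj (op U))
    (h_res : ∀ {U V : X.Opens} (h : V ≤ U) (x : P.obj (op U)),
      φ V (P.map (homOfLE h).op x) = Q.map (homOfLE h).op (φ U x))
    (h_smul : ∀ (U : X.Opens) (c : Γ(X, U)) (x : P.obj (op U)),
      φ U (HSMul.hSMul (α := X.ringCatSheaf.obj.obj (op U)) c x) =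
        HSMul.hSMul (α := X.ringCatSheaf.obj.obj (op U)) c (φ U x)) : P ⟶ Q :=
  PresheafOfModules.homMk (M₁ := P) (M₂ := Q)
    { app := fun U => AddCommGrpCat.ofHom (φ U.unop)
      naturality := fun U V i => by ext x; exact h_res i.unop.le x }
    (fun U c x => h_smul U.unop c x)

/-- The associated sheaf of a presheaf of `𝒪_X`-modules. -/
noncomputable def sheafify (P : X.PresheafOfModules) : X.Modules :=
  (PresheafOfModules.sheafification (𝟙 X.ringCatSheaf.obj)).obj P

/-- The map of associated sheaves induced by a map of presheaves. -/
noncomputable def sheafifyMap {P Q : X.PresheafOfModules} (φ : P ⟶ Q) : sheafify P ⟶ sheafify Q :=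
  (PresheafOfModules.sheafification (𝟙 X.ringCatSheaf.obj)).map φ

/-- The map from the associated sheaf to a sheaf induced by a map of presheaves. -/
noncomputable def sheafifyLift {P : X.PresheafOfModules} {F : X.Modules} (φ : P ⟶ F.val) :
    sheafify P ⟶ F :=
  (PresheafOfModules.sheafificationHomEquiv (𝟙 X.ringCatSheaf.obj) (P := P) (F := F)).symm φ

end Sheaves

section Hochschild

variable {K : Type u} [Field K] {X : Scheme.{u}} (f : X ⟶ Spec (.of K))

/-- The Hochschild differential on the sheaves of polydifferential operators. -/
noncomputable def hochD (n : ℕ) : Dpoly f n ⟶ Dpoly f (n + 1) :=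
  ⟨mkHom (DPre f n) (DPre f (n + 1)) (fun U => (DSec.hoch (f := f) (n := n) (U := U)).toAddMonoidHom)
    (fun _ _ => rfl) (fun U c x => (DSec.hoch (f := f) (n := n) (U := U)).map_smul c x)⟩

lemma hochD_comp (n : ℕ) : hochD f n ≫ hochD f (n + 1) = 0 := by
  refine Scheme.Modules.hom_ext _ _ fun U => ?_
  ext x
  change DSec.hoch (DSec.hoch (f := f) (n := n) (U := U) x) = 0
  ext V hV a
  exact congrFun (hoch_hoch ((x : DSec f n U).on V hV)) a

/-- The complex of sheaves of polydifferential operators. -/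
noncomputable def DpolyComplex : CochainComplex X.Modules ℕ :=
  CochainComplex.of (Dpoly f) (hochD f) (hochD_comp f)

end Hochschild


section LieSheaf

lemma FreeGLie.induction {R M : Type*} [CommRing R] [AddCommGroup M] [Module R M]
    {p : FreeGLie R M → Prop} (x : FreeGLie R M) (h0 : p 0) (ha : ∀ x y, p x → p y → p (x + y))
    (hw : ∀ (c : R) u, p (c • FreeGLie.word R M u)) : p x := by
  obtain ⟨x, rfl⟩ := (lieIdeal R M).mkQ_surjective x
  induction x using Finsupp.induction_linear with
  | zero => rw [map_zero]; exact h0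
  | add x y hx hy => rw [map_add]; exact ha _ _ hx hy
  | single u c => rw [FreeGLie.mkQ_single]; exact hw c u

lemma FreeGLie.map_id {R M : Type*} [CommRing R] [AddCommGroup M] [Module R M] (ρ : R →+* R)
    (φ : M →ₛₗ[ρ] M) (hρ : ∀ a, ρ a = a) (hφ : ∀ a, φ a = a) (x : FreeGLie R M) :
    FreeGLie.map ρ φ x = x := by
  have hφ' : ∀ u : FreeMagma M, FreeMagma.map φ u = u := by
    intro u
    induction u using FreeMagma.recOnMul with
    | ih1 x => rw [FreeMagma.map_of, hφ]
    | ih2 u v hu hv => rw [map_mul, hu, hv]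
  induction x using FreeGLie.induction with
  | h0 => exact map_zero _
  | ha x y hx hy => rw [map_add, hx, hy]
  | hw c u => rw [map_smulₛₗ, map_word, hφ', hρ]

lemma FreeGLie.map_map {R M R' M' R'' M'' : Type*} [CommRing R] [AddCommGroup M] [Module R M]
    [CommRing R'] [AddCommGroup M'] [Module R' M'] [CommRing R''] [AddCommGroup M'']
    [Module R'' M''] (ρ : R →+* R') (φ : M →ₛₗ[ρ] M') (ρ' : R' →+* R'') (φ' : M' →ₛₗ[ρ'] M'')
    (ρ'' : R →+* R'') (φ'' : M →ₛₗ[ρ''] M'') (hρ : ∀ a, ρ' (ρ a) = ρ'' a)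
    (hφ : ∀ a, φ' (φ a) = φ'' a) (x : FreeGLie R M) :
    FreeGLie.map ρ' φ' (FreeGLie.map ρ φ x) = FreeGLie.map ρ'' φ'' x := by
  have hφ' : ∀ u : FreeMagma M, FreeMagma.map φ' (FreeMagma.map φ u) = FreeMagma.map φ'' u := by
    intro u
    induction u using FreeMagma.recOnMul with
    | ih1 x => simp only [FreeMagma.map_of, hφ]
    | ih2 u v hu hv => simp only [map_mul, hu, hv]
  induction x using FreeGLie.induction with
  | h0 => simp only [map_zero]
  | ha x y hx hy => simp only [map_add, hx, hy]
  | hw c u => simp only [map_smulₛₗ, map_word, hφ', hρ]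

lemma FreeGLie.eval_map {R M R' M' B B' : Type*} [CommRing R] [AddCommGroup M] [Module R M]
    [CommRing R'] [AddCommGroup M'] [Module R' M'] [Ring B] [Module R B] [IsScalarTower R B B]
    [SMulCommClass R B B] [Ring B'] [Module R' B'] [IsScalarTower R' B' B'] [SMulCommClass R' B' B']
    (ρ : R →+* R') (φ : M →ₛₗ[ρ] M') (ψ : M →ₗ[R] B) (ψ' : M' →ₗ[R'] B') (r : B →+* B')
    (hr : ∀ c x, r (c • x) = ρ c • r x) (h : ∀ x, r (ψ x) = ψ' (φ x)) (x : FreeGLie R M) :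
    FreeGLie.eval ψ' (FreeGLie.map ρ φ x) = r (FreeGLie.eval ψ x) := by
  have hφ : ∀ u : FreeMagma M, evalWord ψ' (FreeMagma.map φ u) = r (evalWord ψ u) := by
    intro u
    induction u using FreeMagma.recOnMul with
    | ih1 x => exact (h x).symm
    | ih2 u v hu hv =>
      simp only [map_mul, evalWord_mul, hu, hv, length_map, map_sub, map_pow, map_neg, map_one]
  induction x using FreeGLie.induction with
  | h0 => simp only [map_zero]
  | ha x y hx hy => simp only [map_add, hx, hy]
  | hw c u => simp only [map_smulₛₗ, map_word, eval_word, hφ, hr, RingHom.id_apply]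

variable {K : Type u} [Field K] {X : Scheme.{u}} (f : X ⟶ Spec (.of K))

/-- Restriction as a semilinear map. -/
def DSec.resₛₗ (n : ℕ) {U V : X.Opens} (h : V ≤ U) : DSec f n U →ₛₗ[rs h] DSec f n V :=
  { DSec.res h with map_smul' := DSec.res_smul h }

/-- The degree `n` part of the free graded Lie algebra over `𝒪(U)` on the differential operators
on `U`. -/
def LSec (n : ℕ) (U : X.Opens) : Type u := FreeGLie.deg Γ(X, U) (DSec f 1 U) n

noncomputable instance (n : ℕ) (U : X.Opens) : AddCommGroup (LSec f n U) :=
  (FreeGLie.deg Γ(X, U) (DSec f 1 U) n).addCommGroup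

noncomputable instance (n : ℕ) (U : X.Opens) : Module Γ(X, U) (LSec f n U) :=
  (FreeGLie.deg Γ(X, U) (DSec f 1 U) n).module

/-- Restriction in the free graded Lie algebras. -/
noncomputable def LSec.res (n : ℕ) {U V : X.Opens} (h : V ≤ U) : LSec f n U →+ LSec f n V where
  toFun x := ⟨FreeGLie.map (rs h) (DSec.resₛₗ f 1 h) x.1, FreeGLie.map_mem_deg _ _ n x.2⟩
  map_zero' := Subtype.ext (map_zero _)
  map_add' _ _ := Subtype.ext (map_add _ _ _)

/-- The presheaf of degree `n` parts of the free graded Lie algebras. -/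
noncomputable def LPre (n : ℕ) : X.PresheafOfModules :=
  mkPresheaf (LSec f n) (LSec.res f n)
    (fun _ x => Subtype.ext (FreeGLie.map_id (rs le_rfl) (DSec.resₛₗ f 1 le_rfl) rs_self (fun _ => rfl) x.1))
    (fun h h' x => Subtype.ext (FreeGLie.map_map (rs h) (DSec.resₛₗ f 1 h) (rs h') (DSec.resₛₗ f 1 h')
      (rs (h'.trans h)) (DSec.resₛₗ f 1 (h'.trans h)) (rs_rs h h') (fun _ => rfl) x.1))
    (fun h c x => Subtype.ext (map_smulₛₗ (FreeGLie.map (rs h) (DSec.resₛₗ f 1 h)) c x.1))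

/-- The degree `n` part of the sheaf of free graded Lie algebras over `𝒪_X` generated by the
differential operators, which are placed in degree `1`. -/
noncomputable def lieSheaf (n : ℕ) : X.Modules := sheafify (LPre f n)

/-- The map from the free graded Lie algebra on the differential operators to the graded algebra of
polydifferential operators, where the bracket is the graded commutator. -/
noncomputable def lieEval (n : ℕ) (U : X.Opens) : LSec f n U →ₗ[Γ(X, U)] DSec f n U :=
  (DirectSum.component Γ(X, U) ℕ (fun n => DSec f n U) n) ∘ₗ
    (FreeGLie.eval (DirectSum.lof Γ(X, U) ℕ (fun n => DSec f n U) 1)) ∘ₗ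
      (FreeGLie.deg Γ(X, U) (DSec f 1 U) n).subtype

lemma lieEval_res (n : ℕ) {U V : X.Opens} (h : V ≤ U) (x : LSec f n U) :
    lieEval f n V (LSec.res f n h x) = DSec.res h (lieEval f n U x) := by
  refine Eq.trans ?_ (DAlg.res_apply h _ n)
  exact congrArg (fun y : DAlg f V => y n) (FreeGLie.eval_map (rs h) (DSec.resₛₗ f 1 h)
    (DirectSum.lof Γ(X, U) ℕ (fun n => DSec f n U) 1)
    (DirectSum.lof Γ(X, V) ℕ (fun n => DSec f n V) 1) (DAlg.res h) (DAlg.res_smul h)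
    (fun x => DAlg.res_of h 1 x) x.1)

/-- The map from the sheaf of free graded Lie algebras to the polydifferential operators. -/
noncomputable def lieIncl (n : ℕ) : lieSheaf f n ⟶ Dpoly f n :=
  sheafifyLift (mkHom (LPre f n) (DPre f n) (fun U => (lieEval f n U).toAddMonoidHom)
    (fun h x => lieEval_res f n h x) (fun U c x => (lieEval f n U).map_smul c x))

end LieSheaf


section SymSheaf

section Algebra

variable {R : Type*} {M : ℕ → Type*} [CommRing R] [∀ n, AddCommGroup (M n)] [∀ n, Module R (M n)]
  {R' : Type*} {M' : ℕ → Type*} [CommRing R'] [∀ n, AddCommGroup (M' n)] [∀ n, Module R' (M' n)]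

lemma GSym.induction {p : GSym R M → Prop} (x : GSym R M) (h0 : p 0)
    (ha : ∀ x y, p x → p y → p (x + y)) (hw : ∀ (c : R) u, p (c • GSym.word R u)) : p x := by
  obtain ⟨x, rfl⟩ := (Submodule.span R {x | GSymRel R M x}).mkQ_surjective x
  induction x using Finsupp.induction_linear with
  | zero => rw [map_zero]; exact h0
  | add x y hx hy => rw [map_add]; exact ha _ _ hx hy
  | single u c => rw [GSym.mkQ_single]; exact hw c u

lemma GSym.map_id (ρ : R →+* R) (φ : ∀ n, M n →ₛₗ[ρ] M n) (hρ : ∀ a, ρ a = a)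
    (hφ : ∀ n a, φ n a = a) (x : GSym R M) : GSym.map ρ φ x = x := by
  induction x using GSym.induction with
  | h0 => exact map_zero _
  | ha x y hx hy => rw [map_add, hx, hy]
  | hw c u => rw [map_smulₛₗ, map_word, hρ]; simp only [hφ]

lemma GSym.map_map {R'' : Type*} {M'' : ℕ → Type*} [CommRing R''] [∀ n, AddCommGroup (M'' n)]
    [∀ n, Module R'' (M'' n)] (ρ : R →+* R') (φ : ∀ n, M n →ₛₗ[ρ] M' n) (ρ' : R' →+* R'')
    (φ' : ∀ n, M' n →ₛₗ[ρ'] M'' n) (ρ'' : R →+* R'') (φ'' : ∀ n, M n →ₛₗ[ρ''] M'' n)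
    (hρ : ∀ a, ρ' (ρ a) = ρ'' a) (hφ : ∀ n a, φ' n (φ n a) = φ'' n a) (x : GSym R M) :
    GSym.map ρ' φ' (GSym.map ρ φ x) = GSym.map ρ'' φ'' x := by
  induction x using GSym.induction with
  | h0 => simp only [map_zero]
  | ha x y hx hy => simp only [map_add, hx, hy]
  | hw c u => simp only [map_smulₛₗ, map_word, hφ, hρ]

lemma GSym.der_map (ρ : R →+* R') (φ : ∀ n, M n →ₛₗ[ρ] M' n) (δ : ∀ n, M n →ₗ[R] M (n + 1))
    (δ' : ∀ n, M' n →ₗ[R'] M' (n + 1)) (h : ∀ n x, δ' n (φ n x) = φ (n + 1) (δ n x))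
    (x : GSym R M) : GSym.der δ' (GSym.map ρ φ x) = GSym.map ρ φ (GSym.der δ x) := by
  induction x using GSym.induction with
  | h0 => simp only [map_zero]
  | ha x y hx hy => simp only [map_add, hx, hy]
  | hw c u =>
    simp only [map_smulₛₗ, map_word, der_word, RingHom.id_apply, map_sum, map_zsmul]
    congr 1
    refine Finset.sum_congr rfl fun i _ => ?_
    congr 2
    have h1 := comp_update_sigma (fun x : Σ n, M n => (⟨x.1, φ _ x.2⟩ : Σ n, M' n)) u.2 i
      (sigmaMap δ (u.2 i))
    rw [h1]
    simp only [sigmaMap, h]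
    rfl

lemma GSym.symmetrize_map {B B' : Type*} [Ring B] [Module R B] [IsScalarTower R B B]
    [SMulCommClass R B B] [Ring B'] [Module R' B'] [IsScalarTower R' B' B'] [SMulCommClass R' B' B']
    (ρ : R →+* R') (φ : ∀ n, M n →ₛₗ[ρ] M' n) (c : ℕ → R) (c' : ℕ → R') (hc : ∀ k, ρ (c k) = c' k)
    (ψ : ∀ n, M n →ₗ[R] B) (ψ' : ∀ n, M' n →ₗ[R'] B') (r : B →+* B')
    (hr : ∀ c x, r (c • x) = ρ c • r x) (h : ∀ n x, r (ψ n x) = ψ' n (φ n x)) (x : GSym R M) :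
    GSym.symmetrize c' ψ' (GSym.map ρ φ x) = r (GSym.symmetrize c ψ x) := by
  induction x using GSym.induction with
  | h0 => simp only [map_zero]
  | ha x y hx hy => simp only [map_add, hx, hy]
  | hw a u =>
    simp only [map_smulₛₗ, map_word, symmetrize_word, RingHom.id_apply, map_sum, map_zsmul, hr, hc,
      map_list_prod, List.map_ofFn]
    simp only [sigmaEval, Function.comp_def, h]

end Algebra

variable {X : Scheme.{u}}

/-- The degree `n` part of the direct sum of all symmetric powers of the graded `𝒪(U)`-module of
sections on `U` of a graded `𝒪_X`-module. -/
def SymSec (L : ℕ → X.Modules) (n : ℕ) (U : X.Opens) : Type u :=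
  GSym.deg Γ(X, U) (fun m => Γ(L m, U)) n

noncomputable instance (L : ℕ → X.Modules) (n : ℕ) (U : X.Opens) : AddCommGroup (SymSec L n U) :=
  (GSym.deg Γ(X, U) (fun m => Γ(L m, U)) n).addCommGroup

noncomputable instance (L : ℕ → X.Modules) (n : ℕ) (U : X.Opens) :
    Module Γ(X, U) (SymSec L n U) :=
  (GSym.deg Γ(X, U) (fun m => Γ(L m, U)) n).module

/-- Restriction of sections of a sheaf of modules as a semilinear map. -/
noncomputable def modRes (F : X.Modules) {U V : X.Opens} (h : V ≤ U) : Γ(F, U) →ₛₗ[rs h] Γ(F, V) :=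
  { (F.presheaf.map (homOfLE h).op).hom with
    map_smul' := fun c x => F.map_smul (homOfLE h) c x }

lemma modRes_self (F : X.Modules) {U : X.Opens} (x : Γ(F, U)) : modRes F le_rfl x = x :=
  ConcreteCategory.congr_hom (F.presheaf.map_id (op U)) x

lemma modRes_modRes (F : X.Modules) {U V W : X.Opens} (h : V ≤ U) (h' : W ≤ V) (x : Γ(F, U)) :
    modRes F h' (modRes F h x) = modRes F (h'.trans h) x :=
  (ConcreteCategory.congr_hom (F.presheaf.map_comp (homOfLE h).op (homOfLE h').op) x).symm

/-- A morphism of sheaves of modules on sections. -/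
noncomputable def modApp {F G : X.Modules} (φ : F ⟶ G) (U : X.Opens) :
    Γ(F, U) →ₗ[Γ(X, U)] Γ(G, U) :=
  { (φ.app U).hom with map_smul' := fun c x => φ.app_smul c x }

lemma modApp_modRes {F G : X.Modules} (φ : F ⟶ G) {U V : X.Opens} (h : V ≤ U) (x : Γ(F, U)) :
    modApp φ V (modRes F h x) = modRes G h (modApp φ U x) :=
  ConcreteCategory.congr_hom (φ.mapPresheaf.naturality (homOfLE h).op) x

/-- Restriction in the symmetric powers. -/
noncomputable def SymSec.res (L : ℕ → X.Modules) (n : ℕ) {U V : X.Opens} (h : V ≤ U) :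
    SymSec L n U →+ SymSec L n V where
  toFun x := ⟨GSym.map (rs h) (fun m => modRes (L m) h) x.1, GSym.map_mem_deg _ _ n x.2⟩
  map_zero' := Subtype.ext (map_zero _)
  map_add' _ _ := Subtype.ext (map_add _ _ _)

/-- The presheaf of degree `n` parts of the symmetric powers. -/
noncomputable def SymPre (L : ℕ → X.Modules) (n : ℕ) : X.PresheafOfModules :=
  mkPresheaf (SymSec L n) (SymSec.res L n)
    (fun _ x => Subtype.ext (GSym.map_id (rs le_rfl) (fun m => modRes (L m) le_rfl) rs_self
      (fun m => modRes_self (L m)) x.1))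
    (fun h h' x => Subtype.ext (GSym.map_map (rs h) (fun m => modRes (L m) h) (rs h')
      (fun m => modRes (L m) h') (rs (h'.trans h)) (fun m => modRes (L m) (h'.trans h)) (rs_rs h h')
      (fun m => modRes_modRes (L m) h h') x.1))
    (fun h c x => Subtype.ext (map_smulₛₗ (GSym.map (rs h) (fun m => modRes (L m) h)) c x.1))

/-- The degree `n` part of `⨁ₖ Symᵏ(L)` for a graded `𝒪_X`-module `L`. -/
noncomputable def symSheaf (L : ℕ → X.Modules) (n : ℕ) : X.Modules := sheafify (SymPre L n)

/-- The graded derivation on the symmetric powers, on sections. -/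
noncomputable def symSecD {L : ℕ → X.Modules} (δ : ∀ n, L n ⟶ L (n + 1)) (n : ℕ) (U : X.Opens) :
    SymSec L n U →ₗ[Γ(X, U)] SymSec L (n + 1) U :=
  (GSym.der (fun m => modApp (δ m) U)).restrict (fun _ hx => GSym.der_mem_deg _ n hx)

/-- The graded derivation of `⨁ₖ Symᵏ(L)` extending a map `δ` of degree one. -/
noncomputable def symD {L : ℕ → X.Modules} (δ : ∀ n, L n ⟶ L (n + 1)) (n : ℕ) :
    symSheaf L n ⟶ symSheaf L (n + 1) :=
  sheafifyMap (mkHom (SymPre L n) (SymPre L (n + 1)) (fun U => (symSecD δ n U).toAddMonoidHom)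
    (fun {U V} h x => Subtype.ext (GSym.der_map (rs h) (fun m => modRes (L m) h)
      (fun m => modApp (δ m) U) (fun m => modApp (δ m) V) (fun m x => modApp_modRes (δ m) h x) x.1))
    (fun U c x => (symSecD δ n U).map_smul c x))

variable {K : Type u} [Field K] (f : X ⟶ Spec (.of K))

/-- The symmetrization map on sections, with values in the graded algebra of polydifferential
operators, along maps `j m : L m ⟶ Dpoly f m`. -/
noncomputable def symAlg {L : ℕ → X.Modules} (j : ∀ n, L n ⟶ Dpoly f n) (U : X.Opens) :
    GSym Γ(X, U) (fun m => Γ(L m, U)) →ₗ[Γ(X, U)] DAlg f U :=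
  GSym.symmetrize (fun k => structMap f U (k.factorial : K)⁻¹)
    (fun m => (DirectSum.lof Γ(X, U) ℕ (fun n => DSec f n U) m) ∘ₗ modApp (j m) U)

/-- The degree `n` part of the symmetrization map on sections. -/
noncomputable def symSecMap {L : ℕ → X.Modules} (j : ∀ n, L n ⟶ Dpoly f n) (n : ℕ) (U : X.Opens) :
    SymSec L n U →ₗ[Γ(X, U)] DSec f n U :=
  (DirectSum.component Γ(X, U) ℕ (fun n => DSec f n U) n) ∘ₗ symAlg f j U ∘ₗ
    (GSym.deg Γ(X, U) (fun m => Γ(L m, U)) n).subtype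

lemma symAlg_res {L : ℕ → X.Modules} (j : ∀ n, L n ⟶ Dpoly f n) {U V : X.Opens}
    (h : V ≤ U) (x : GSym Γ(X, U) (fun m => Γ(L m, U))) :
    symAlg f j V (GSym.map (rs h) (fun m => modRes (L m) h) x) = DAlg.res h (symAlg f j U x) := by
  refine GSym.symmetrize_map (rs h) (fun m => modRes (L m) h) _ _ (fun k => rs_structMap f h _)
    _ _ (DAlg.res h) (DAlg.res_smul h) (fun m x => ?_) x
  refine (DAlg.res_of h m _).trans ?_
  exact congrArg (DirectSum.of (fun n => DSec f n V) m) (modApp_modRes (j m) h x).symm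

lemma symSecMap_res {L : ℕ → X.Modules} (j : ∀ n, L n ⟶ Dpoly f n) (n : ℕ) {U V : X.Opens}
    (h : V ≤ U) (x : SymSec L n U) :
    symSecMap f j n V (SymSec.res L n h x) = DSec.res h (symSecMap f j n U x) :=
  (congrArg (fun y : DAlg f V => y n) (symAlg_res f j h x.1)).trans (DAlg.res_apply h _ n)

/-- The symmetrization map `⨁ₖ Symᵏ(L) → Dpoly` in degree `n` along maps `j m : L m ⟶ Dpoly f m`:
`z₁ ⋯ z_k ↦ (1/k!) ∑_σ s(σ) j(z_{σ(1)}) ⊗ ⋯ ⊗ j(z_{σ(k)})`. -/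
noncomputable def symmetrization {L : ℕ → X.Modules} (j : ∀ n, L n ⟶ Dpoly f n) (n : ℕ) :
    symSheaf L n ⟶ Dpoly f n :=
  sheafifyLift (mkHom (SymPre L n) (DPre f n) (fun U => (symSecMap f j n U).toAddMonoidHom)
    (fun h x => symSecMap_res f j n h x) (fun U c x => (symSecMap f j n U).map_smul c x))

end SymSheaf

end PolyDiff

namespace PolyDiff

/-! ### Multiplication by one element in the graded symmetric powers -/

section Cons

set_option linter.unusedSectionVars false

lemma koszulSign_cons {k : ℕ} (d₀ : ℕ) (d : Fin k → ℕ) (σ : Equiv.Perm (Fin k)) :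
    koszulSign (Fin.cons d₀ d : Fin (k + 1) → ℕ) (Equiv.Perm.decomposeFin.symm (0, σ)) =
      koszulSign d σ := by
  simp [koszulSign, Fin.prod_univ_succ]

lemma koszulSign_swap_adjacent {k : ℕ} (d : Fin (k + 1) → ℕ) (i : Fin k) :
    koszulSign d (Equiv.swap i.castSucc i.succ) = (-1) ^ (d i.castSucc * d i.succ) := by
  have hs : ∀ j : Fin (k + 1), ((Equiv.swap i.castSucc i.succ j : Fin (k + 1)) : ℕ) =
      if (j : ℕ) = i then (i : ℕ) + 1 else if (j : ℕ) = i + 1 then (i : ℕ) else j := by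
    intro j
    rw [Equiv.swap_apply_def]
    simp only [Fin.ext_iff, Fin.val_castSucc, Fin.val_succ]
    split_ifs <;> simp
  rw [koszulSign, Finset.prod_eq_single i.castSucc, Finset.prod_eq_single i.succ]
  · simp [mul_comm]
  · intro j _ hj
    rw [if_neg]
    simp only [Fin.lt_def, hs, Fin.val_castSucc]
    have : (j : ℕ) ≠ i + 1 := fun h => hj (Fin.ext h)
    split_ifs <;> omega
  · simp
  · intro j _ hj
    refine Finset.prod_eq_one fun l _ => ?_
    rw [if_neg]
    simp only [Fin.lt_def, hs]
    have : (j : ℕ) ≠ i := fun h => hj (Fin.ext h)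
    split_ifs <;> omega
  · simp

variable {R : Type*} {M : ℕ → Type*} [CommRing R] [∀ n, AddCommGroup (M n)] [∀ n, Module R (M n)]

lemma fst_cons {k : ℕ} (x : Σ n, M n) (z : Fin k → Σ n, M n) :
    (fun j => ((Fin.cons x z : Fin (k + 1) → Σ n, M n) j).1) =
      (Fin.cons x.1 fun j => (z j).1 : Fin (k + 1) → ℕ) := by
  funext j
  refine Fin.cases ?_ (fun j => ?_) j <;> simp

/-- Left multiplication by a homogeneous element in the graded symmetric powers. -/
noncomputable def GSym.consAux (x : Σ n, M n) : GSym R M →ₗ[R] GSym R M :=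
  GSym.lift (RingHom.id R) (fun k z => GSym.word R ⟨k + 1, Fin.cons x z⟩)
    (fun k z i n a b => by simp only [Fin.cons_update, word_add])
    (fun k z i n c a => by simp only [Fin.cons_update, word_smul, RingHom.id_apply])
    (fun k z σ => by
      rw [word_perm _ (Equiv.Perm.decomposeFin.symm (0, σ)), fst_cons, koszulSign_cons]
      congr 3
      funext j
      refine Fin.cases ?_ (fun j => ?_) j <;> simp)

@[simp] lemma GSym.consAux_word (x : Σ n, M n) (w : GWord M) :
    GSym.consAux x (GSym.word R w) = GSym.word R ⟨w.1 + 1, Fin.cons x w.2⟩ :=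
  GSym.lift_word _ _ _ _ _ _

/-- Left multiplication in the graded symmetric powers, as a linear map. -/
noncomputable def GSym.cons (n : ℕ) : M n →ₗ[R] Module.End R (GSym R M) where
  toFun v := GSym.consAux ⟨n, v⟩
  map_add' v w := by
    refine LinearMap.ext fun s => ?_
    induction s using GSym.induction with
    | h0 => simp only [map_zero]
    | ha x y hx hy => simp only [map_add, hx, hy]
    | hw c u =>
      have := fun v => Fin.update_cons_zero (α := fun _ => Σ n, M n) (⟨n, 0⟩ : Σ n, M n) u.2 v
      simp only [map_smul, LinearMap.add_apply, consAux_word]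
      congr 1
      rw [← this, word_add, this, this]
  map_smul' c v := by
    refine LinearMap.ext fun s => ?_
    induction s using GSym.induction with
    | h0 => simp only [map_zero]
    | ha x y hx hy => simp only [map_add, hx, hy]
    | hw r u =>
      have := fun v => Fin.update_cons_zero (α := fun _ => Σ n, M n) (⟨n, 0⟩ : Σ n, M n) u.2 v
      simp only [map_smul, LinearMap.smul_apply, consAux_word, RingHom.id_apply]
      congr 1
      rw [← this, word_smul, this]

@[simp] lemma GSym.cons_word {n : ℕ} (v : M n) (w : GWord M) :
    GSym.cons n v (GSym.word R w) = GSym.word R ⟨w.1 + 1, Fin.cons ⟨n, v⟩ w.2⟩ :=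
  GSym.consAux_word _ _

lemma GSym.cons_cons {m n : ℕ} (v : M m) (w : M n) :
    GSym.cons (R := R) m v * GSym.cons n w =
      (-1 : ℤ) ^ (m * n) • (GSym.cons n w * GSym.cons m v) := by
  refine LinearMap.ext fun s => ?_
  induction s using GSym.induction with
  | h0 => simp only [map_zero]
  | ha x y hx hy => simp only [map_add, hx, hy]
  | hw c u =>
    simp only [map_smul, LinearMap.smul_apply, Module.End.mul_apply, cons_word]
    congr 1
    rw [word_perm _ (Equiv.swap (0 : Fin (u.1 + 1)).castSucc (0 : Fin (u.1 + 1)).succ),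
      koszulSign_swap_adjacent]
    congr 3
    funext j
    refine Fin.cases ?_ (fun j => ?_) j
    · simp
    · refine Fin.cases ?_ (fun j => ?_) j
      · simp
      · simp only [Function.comp_apply]
        rw [Equiv.swap_apply_of_ne_of_ne]
        · simp
        · simp [Fin.ext_iff]
        · simp [Fin.ext_iff]

lemma leibnizSign_cons_zero {k : ℕ} (d₀ : ℕ) (d : Fin k → ℕ) :
    leibnizSign (Fin.cons d₀ d : Fin (k + 1) → ℕ) 0 = 1 := by
  simp [leibnizSign]

lemma leibnizSign_cons_succ {k : ℕ} (d₀ : ℕ) (d : Fin k → ℕ) (i : Fin k) :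
    leibnizSign (Fin.cons d₀ d : Fin (k + 1) → ℕ) i.succ = (-1) ^ d₀ * leibnizSign d i := by
  simp [leibnizSign, Fin.prod_univ_succ]

lemma GSym.der_cons (δ : ∀ n, M n →ₗ[R] M (n + 1)) {n : ℕ} (v : M n) :
    GSym.der δ * GSym.cons n v =
      GSym.cons (n + 1) (δ n v) + (-1 : ℤ) ^ n • (GSym.cons n v * GSym.der δ) := by
  refine LinearMap.ext fun s => ?_
  induction s using GSym.induction with
  | h0 => simp only [map_zero]
  | ha x y hx hy => simp only [map_add, hx, hy]
  | hw c u =>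
    simp only [map_smul, LinearMap.smul_apply, LinearMap.add_apply, Module.End.mul_apply, cons_word,
      der_word, fst_cons, map_sum, map_zsmul]
    congr 1
    rw [Fin.sum_univ_succ]
    congr 1
    · simp only [leibnizSign_cons_zero, one_smul, Fin.cons_zero, Fin.update_cons_zero]
      rfl
    · rw [Finset.smul_sum]
      refine Finset.sum_congr rfl fun i _ => ?_
      rw [leibnizSign_cons_succ, smul_smul]
      simp only [Fin.cons_succ, Fin.cons_update]

end Cons

/-! ### The filtration by the length of words -/

section Length

variable {R : Type*} {M : ℕ → Type*} [CommRing R] [∀ n, AddCommGroup (M n)] [∀ n, Module R (M n)]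

variable (R M) in
/-- The submodule of the graded symmetric powers spanned by the words with fewer than `k` letters. -/
noncomputable def GSym.lenLT (k : ℕ) : Submodule R (GSym R M) :=
  Submodule.span R {x | ∃ w : GWord M, w.1 < k ∧ x = GSym.word R w}

lemma GSym.word_mem_lenLT {k : ℕ} (w : GWord M) (h : w.1 < k) : GSym.word R w ∈ GSym.lenLT R M k :=
  Submodule.subset_span ⟨w, h, rfl⟩

lemma GSym.lenLT_mono {k l : ℕ} (h : k ≤ l) : GSym.lenLT R M k ≤ GSym.lenLT R M l :=
  Submodule.span_mono fun _ ⟨w, hw, hx⟩ => ⟨w, hw.trans_le h, hx⟩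

lemma GSym.lenLT_zero : GSym.lenLT R M 0 = ⊥ := by
  rw [lenLT, Submodule.span_eq_bot]
  rintro x ⟨w, hw, _⟩
  exact absurd hw (Nat.not_lt_zero _)

lemma GSym.exists_mem_lenLT (s : GSym R M) : ∃ k, s ∈ GSym.lenLT R M k := by
  induction s using GSym.induction with
  | h0 => exact ⟨0, Submodule.zero_mem _⟩
  | ha x y hx hy =>
    obtain ⟨k, hk⟩ := hx
    obtain ⟨l, hl⟩ := hy
    exact ⟨max k l, Submodule.add_mem _ (lenLT_mono (le_max_left _ _) hk)
      (lenLT_mono (le_max_right _ _) hl)⟩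
  | hw c u => exact ⟨u.1 + 1, Submodule.smul_mem _ _ (word_mem_lenLT u (Nat.lt_succ_self _))⟩

lemma GSym.map_lenLT_le {N : Type*} [AddCommGroup N] [Module R N] (T : GSym R M →ₗ[R] N)
    (P : Submodule R N) (k : ℕ) (h : ∀ w : GWord M, w.1 < k → T (GSym.word R w) ∈ P)
    {s : GSym R M} (hs : s ∈ GSym.lenLT R M k) : T s ∈ P := by
  have : GSym.lenLT R M k ≤ P.comap T := Submodule.span_le.2 (by
    rintro x ⟨w, hw, rfl⟩; exact h w hw)
  exact this hs

lemma GSym.der_mem_lenLT (δ : ∀ n, M n →ₗ[R] M (n + 1)) {k : ℕ} {s : GSym R M}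
    (hs : s ∈ GSym.lenLT R M k) : GSym.der δ s ∈ GSym.lenLT R M k := by
  refine map_lenLT_le _ _ k (fun w hw => ?_) hs
  rw [der_word]
  exact Submodule.sum_mem _ fun i _ => zsmul_mem
    (word_mem_lenLT ⟨w.1, Function.update w.2 i (sigmaMap δ (w.2 i))⟩ hw) _

lemma GSym.cons_mem_lenLT {n : ℕ} (v : M n) {k : ℕ} {s : GSym R M}
    (hs : s ∈ GSym.lenLT R M k) : GSym.cons n v s ∈ GSym.lenLT R M (k + 1) := by
  refine map_lenLT_le _ _ k (fun w hw => ?_) hs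
  rw [cons_word]
  exact word_mem_lenLT _ (Nat.succ_lt_succ hw)

/-- A unipotent endomorphism with respect to the length filtration is injective. -/
lemma GSym.injective_of_unipotent (T : GSym R M →ₗ[R] GSym R M)
    (h : ∀ w : GWord M, T (GSym.word R w) - GSym.word R w ∈ GSym.lenLT R M w.1) :
    Function.Injective T := by
  rw [injective_iff_map_eq_zero]
  intro s hs
  obtain ⟨k, hk⟩ := exists_mem_lenLT s
  induction k with
  | zero => simpa [lenLT_zero] using hk
  | succ k ih =>
    refine ih ?_
    have : (T - LinearMap.id : GSym R M →ₗ[R] GSym R M) s ∈ lenLT R M k :=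
      map_lenLT_le (T - LinearMap.id) _ (k + 1)
        (fun w hw => lenLT_mono (Nat.lt_succ_iff.1 hw) (h w)) hk
    rw [LinearMap.sub_apply, hs, zero_sub] at this
    simpa using this

/-- The operator on the graded symmetric powers multiplying each word with the product of weights
of the degrees of its letters. -/
noncomputable def GSym.weight (c : ℕ → R) : GSym R M →ₗ[R] GSym R M :=
  GSym.lift (RingHom.id R) (fun k z => (∏ i, c (z i).1) • GSym.word R ⟨k, z⟩)
    (fun k z i n x y => by
      have h : ∀ x : M n, (∏ j, c (Function.update z i ⟨n, x⟩ j).1) =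
        ∏ j, c (Function.update (fun j => (z j).1) i n j) := fun x =>
        Finset.prod_congr rfl fun j _ => by rw [← congrFun (fst_update z i ⟨n, x⟩) j]
      rw [h, h, h, word_add, smul_add])
    (fun k z i n r x => by
      have h : ∀ x : M n, (∏ j, c (Function.update z i ⟨n, x⟩ j).1) =
        ∏ j, c (Function.update (fun j => (z j).1) i n j) := fun x =>
        Finset.prod_congr rfl fun j _ => by rw [← congrFun (fst_update z i ⟨n, x⟩) j]
      rw [h, h, word_smul, smul_comm]; rfl)
    (fun k z σ => by
      rw [word_perm z σ, smul_comm, ← Equiv.prod_comp σ]; rfl)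

@[simp] lemma GSym.weight_word (c : ℕ → R) (w : GWord M) :
    GSym.weight c (GSym.word R w) = (∏ i, c (w.2 i).1) • GSym.word R w :=
  GSym.lift_word _ _ _ _ _ _

lemma GSym.word_eq_zero {k : ℕ} (z : Fin k → Σ n, M n) (i : Fin k) (h : (z i).2 = 0) :
    GSym.word R ⟨k, z⟩ = 0 := by
  have h1 := word_smul (R := R) z i (z i).1 (0 : R) 0
  rw [zero_smul, zero_smul] at h1
  have h2 : Function.update z i ⟨(z i).1, 0⟩ = z := by
    rw [← h]; exact Function.update_eq_self i z
  rwa [h2] at h1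

variable (R M) in
/-- A homogeneous element as an element of the direct sum. -/
noncomputable def sigmaLof (x : Σ n, M n) : DirectSum ℕ M := DirectSum.lof R ℕ M x.1 x.2

/-- The linear part of an element of the graded symmetric powers. -/
noncomputable def GSym.linearPart : GSym R M →ₗ[R] DirectSum ℕ M :=
  GSym.lift (RingHom.id R)
    (fun k z => if h : k = 1 then
      sigmaLof R M (z ⟨0, by omega⟩) else 0)
    (fun k z i n x y => by
      by_cases h : k = 1
      · subst h
        obtain rfl := Subsingleton.elim i 0
        simp only [dif_pos, Fin.zero_eta, Function.update_self]
        simp only [sigmaLof, map_add]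
      · simp [h])
    (fun k z i n c x => by
      by_cases h : k = 1
      · subst h
        obtain rfl := Subsingleton.elim i 0
        simp only [dif_pos, Fin.zero_eta, Function.update_self, RingHom.id_apply]
        simp only [sigmaLof, map_smul]
      · simp [h])
    (fun k z σ => by
      by_cases h : k = 1
      · subst h
        obtain rfl := Subsingleton.elim σ 1
        simp only [dif_pos, koszulSign]
        simp
      · simp [h])

lemma GSym.linearPart_word_one (z : Fin 1 → Σ n, M n) :
    GSym.linearPart (GSym.word R ⟨1, z⟩) = DirectSum.lof R ℕ M (z 0).1 (z 0).2 := by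
  rw [linearPart, lift_word]; simp [sigmaLof]

lemma GSym.linearPart_word_zero (z : Fin 0 → Σ n, M n) :
    GSym.linearPart (GSym.word R ⟨0, z⟩) = 0 := by
  rw [linearPart, lift_word]; simp

end Length

end PolyDiff

namespace PolyDiff

/-! ### The Poincaré–Birkhoff–Witt theorem for free graded Lie algebras in characteristic zero -/

section PBW

variable {R M : Type*} [CommRing R] [AddCommGroup M] [Module R M]

/-- The bracket with a bracket word. -/
noncomputable def FreeGLie.ad (u : FreeMagma M) : FreeGLie R M →ₗ[R] FreeGLie R M :=
  (FreeGLie.exists_left u).choose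

@[simp] lemma FreeGLie.ad_word (u v : FreeMagma M) :
    FreeGLie.ad u (FreeGLie.word R M v) = FreeGLie.word R M (u * v) :=
  ((FreeGLie.exists_left u).choose_spec v).symm

lemma FreeGLie.word_mem_deg (u : FreeMagma M) : FreeGLie.word R M u ∈ FreeGLie.deg R M u.length :=
  Submodule.subset_span ⟨u, rfl, rfl⟩

lemma FreeGLie.word_of_mem_deg (x : M) : FreeGLie.word R M (.of x) ∈ FreeGLie.deg R M 1 :=
  Submodule.subset_span ⟨.of x, rfl, rfl⟩

lemma FreeGLie.ad_mem_deg (u : FreeMagma M) {m n : ℕ} (h : u.length + m = n) {x : FreeGLie R M}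
    (hx : x ∈ FreeGLie.deg R M m) : FreeGLie.ad u x ∈ FreeGLie.deg R M n := by
  have : FreeGLie.deg R M m ≤ (FreeGLie.deg R M n).comap (FreeGLie.ad u) := Submodule.span_le.2 (by
    rintro x ⟨v, hv, rfl⟩
    rw [SetLike.mem_coe, Submodule.mem_comap, ad_word]
    exact Submodule.subset_span ⟨u * v, by rw [← h, ← hv]; rfl, rfl⟩)
  exact this hx

lemma FreeGLie.deg_zero : FreeGLie.deg R M 0 = ⊥ := by
  rw [deg, Submodule.span_eq_bot]
  rintro x ⟨u, hu, _⟩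
  exact absurd hu (FreeMagma.length_pos (x := u)).ne'

/-- The bracket with a bracket word, on homogeneous elements. -/
noncomputable def FreeGLie.adDeg (u : FreeMagma M) (m n : ℕ) (h : u.length + m = n) :
    FreeGLie.deg R M m →ₗ[R] FreeGLie.deg R M n :=
  (FreeGLie.ad u).restrict fun _ hx => FreeGLie.ad_mem_deg u h hx

lemma FreeGLie.ad_add (x y : M) (z : FreeGLie R M) : FreeGLie.ad (.of (x + y)) z =
    FreeGLie.ad (.of x) z + FreeGLie.ad (.of y) z := by
  induction z using FreeGLie.induction with
  | h0 => simp only [map_zero, add_zero]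
  | ha a b ha hb => simp only [map_add, ha, hb]; abel
  | hw c u =>
    obtain ⟨T, hT⟩ := exists_right (R := R) u
    simp only [map_smul, ad_word, hT, word_add, map_add, smul_add]

lemma FreeGLie.ad_smul (c : R) (y : M) (z : FreeGLie R M) : FreeGLie.ad (.of (c • y)) z =
    c • FreeGLie.ad (.of y) z := by
  induction z using FreeGLie.induction with
  | h0 => simp only [map_zero, smul_zero]
  | ha a b ha hb => simp only [map_add, ha, hb, smul_add]
  | hw r u =>
    obtain ⟨T, hT⟩ := exists_right (R := R) u
    simp only [map_smul, ad_word, hT, word_smul, smul_comm r c]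

lemma FreeGLie.ad_mul (u v : FreeMagma M) (z : FreeGLie R M) : FreeGLie.ad (u * v) z =
    FreeGLie.ad u (FreeGLie.ad v z) -
      (-1 : R) ^ (u.length * v.length) • FreeGLie.ad v (FreeGLie.ad u z) := by
  induction z using FreeGLie.induction with
  | h0 => simp only [map_zero, smul_zero, sub_zero]
  | ha a b ha hb => simp only [map_add, ha, hb, smul_add]; abel
  | hw r w =>
    simp only [map_smul, ad_word, word_jacobi u v w]
    rw [smul_comm _ r, ← smul_sub, add_sub_cancel_right]

/-- A graded module identified with the free graded Lie algebra. -/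
abbrev LieGrading (R M : Type*) [CommRing R] [AddCommGroup M] [Module R M] (L : ℕ → Type*)
    [∀ n, AddCommGroup (L n)] [∀ n, Module R (L n)] :=
  ∀ n, L n ≃ₗ[R] FreeGLie.deg R M n

variable {L : ℕ → Type*} [∀ n, AddCommGroup (L n)] [∀ n, Module R (L n)] (e : LieGrading R M L)

/-- Left multiplication by a homogeneous element of the free Lie algebra in its symmetric powers. -/
noncomputable def consLie (n : ℕ) (x : FreeGLie R M) (hx : x ∈ FreeGLie.deg R M n) :
    Module.End R (GSym R L) := GSym.cons n ((e n).symm ⟨x, hx⟩)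

lemma consLie_congr {m n : ℕ} {x y : FreeGLie R M} (hx : x ∈ FreeGLie.deg R M m)
    (hy : y ∈ FreeGLie.deg R M n) (h : m = n) (hxy : x = y) :
    consLie e m x hx = consLie e n y hy := by
  subst h hxy; rfl

lemma consLie_add {n : ℕ} {x y : FreeGLie R M} (hx : x ∈ FreeGLie.deg R M n)
    (hy : y ∈ FreeGLie.deg R M n) (h : x + y ∈ FreeGLie.deg R M n) :
    consLie e n (x + y) h = consLie e n x hx + consLie e n y hy := by
  rw [consLie, consLie, consLie, ← map_add, ← map_add]; rfl

lemma consLie_sub {n : ℕ} {x y : FreeGLie R M} (hx : x ∈ FreeGLie.deg R M n)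
    (hy : y ∈ FreeGLie.deg R M n) (h : x - y ∈ FreeGLie.deg R M n) :
    consLie e n (x - y) h = consLie e n x hx - consLie e n y hy := by
  rw [consLie, consLie, consLie, ← map_sub, ← map_sub]; rfl

lemma consLie_neg {n : ℕ} {x : FreeGLie R M} (hx : x ∈ FreeGLie.deg R M n)
    (h : -x ∈ FreeGLie.deg R M n) : consLie e n (-x) h = -consLie e n x hx := by
  rw [consLie, consLie, ← map_neg, ← map_neg]; rfl

lemma consLie_smul {n : ℕ} (c : R) {x : FreeGLie R M} (hx : x ∈ FreeGLie.deg R M n)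
    (h : c • x ∈ FreeGLie.deg R M n) : consLie e n (c • x) h = c • consLie e n x hx := by
  rw [consLie, consLie, ← map_smul, ← map_smul]; rfl

lemma neg_one_pow_smul {T : Type*} [AddCommGroup T] [Module R T] (k : ℕ) (x : T) :
    (-1 : R) ^ k • x = (-1 : ℤ) ^ k • x := by
  rcases Nat.even_or_odd k with h | h
  · rw [h.neg_one_pow, h.neg_one_pow, one_smul, one_smul]
  · rw [h.neg_one_pow, h.neg_one_pow, neg_smul, neg_smul, one_smul, one_smul]

lemma consLie_sign {n : ℕ} (k : ℕ) {x : FreeGLie R M} (hx : x ∈ FreeGLie.deg R M n)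
    (h : (-1 : R) ^ k • x ∈ FreeGLie.deg R M n) :
    consLie e n ((-1 : R) ^ k • x) h = (-1 : ℤ) ^ k • consLie e n x hx := by
  rw [consLie, consLie, ← map_zsmul, ← map_zsmul]
  congr 2
  exact Subtype.ext (neg_one_pow_smul k x)

/-- The adjoint action of a generator on the symmetric powers, as a graded derivation. -/
noncomputable def derAd (x : M) : Module.End R (GSym R L) :=
  GSym.der fun n => (e (n + 1)).symm.toLinearMap ∘ₗ
    FreeGLie.adDeg (.of x) n (n + 1) (add_comm _ _) ∘ₗ (e n).toLinearMap

lemma derAd_cons (x : M) {m n : ℕ} (h : 1 + m = n) {y : FreeGLie R M}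
    (hy : y ∈ FreeGLie.deg R M m) :
    derAd e x * consLie e m y hy = consLie e n (FreeGLie.ad (.of x) y)
      (FreeGLie.ad_mem_deg (.of x) h hy) + (-1 : ℤ) ^ m • (consLie e m y hy * derAd e x) := by
  obtain rfl : n = m + 1 := by omega
  rw [derAd, consLie, GSym.der_cons]
  simp only [LinearMap.comp_apply, LinearEquiv.coe_coe, LinearEquiv.apply_symm_apply]
  rfl

lemma FreeGLie.adDeg_add (x y : M) (n : ℕ) :
    FreeGLie.adDeg (R := R) (.of (x + y)) n (n + 1) (add_comm _ _) =
      FreeGLie.adDeg (.of x) n (n + 1) (add_comm _ _) +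
        FreeGLie.adDeg (.of y) n (n + 1) (add_comm _ _) :=
  LinearMap.ext fun z => Subtype.ext (FreeGLie.ad_add x y z.1)

lemma FreeGLie.adDeg_smul (c : R) (x : M) (n : ℕ) :
    FreeGLie.adDeg (R := R) (.of (c • x)) n (n + 1) (add_comm _ _) =
      c • FreeGLie.adDeg (.of x) n (n + 1) (add_comm _ _) :=
  LinearMap.ext fun z => Subtype.ext (FreeGLie.ad_smul c x z.1)

lemma GSym.der_add {N : ℕ → Type*} [∀ n, AddCommGroup (N n)] [∀ n, Module R (N n)]
    (δ ε : ∀ n, N n →ₗ[R] N (n + 1)) :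
    GSym.der (fun n => δ n + ε n) = GSym.der δ + GSym.der ε := by
  refine LinearMap.ext fun s => ?_
  induction s using GSym.induction with
  | h0 => simp only [map_zero]
  | ha x y hx hy => simp only [map_add, hx, hy]
  | hw c u =>
    simp only [map_smul, LinearMap.add_apply, der_word, ← Finset.sum_add_distrib]
    congr 1
    refine Finset.sum_congr rfl fun i _ => ?_
    rw [← smul_add]
    congr 1
    exact word_add u.2 i _ _ _

lemma GSym.der_smul {N : ℕ → Type*} [∀ n, AddCommGroup (N n)] [∀ n, Module R (N n)] (c : R)
    (δ : ∀ n, N n →ₗ[R] N (n + 1)) : GSym.der (fun n => c • δ n) = c • GSym.der δ := by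
  refine LinearMap.ext fun s => ?_
  induction s using GSym.induction with
  | h0 => simp only [map_zero]
  | ha x y hx hy => simp only [map_add, hx, hy]
  | hw r u =>
    simp only [map_smul, LinearMap.smul_apply, der_word, Finset.smul_sum]
    refine Finset.sum_congr rfl fun i _ => ?_
    rw [smul_comm c (leibnizSign _ _)]
    congr 2
    exact word_smul u.2 i _ _ _

/-- The action of the generators on the symmetric powers of the free Lie algebra: the sum of the
adjoint action and of left multiplication. -/
noncomputable def lieAct : M →ₗ[R] Module.End R (GSym R L) where
  toFun x := derAd e x + consLie e 1 (FreeGLie.word R M (.of x)) (FreeGLie.word_of_mem_deg _)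
  map_add' x y := by
    rw [consLie_congr e _ (Submodule.add_mem _ (FreeGLie.word_of_mem_deg _) (FreeGLie.word_of_mem_deg _))
        rfl (FreeGLie.word_add x y), consLie_add e (FreeGLie.word_of_mem_deg _)
        (FreeGLie.word_of_mem_deg _)]
    simp only [derAd, FreeGLie.adDeg_add, LinearMap.comp_add, LinearMap.add_comp]
    rw [GSym.der_add]
    abel
  map_smul' c x := by
    rw [consLie_congr e _ (Submodule.smul_mem _ c (FreeGLie.word_of_mem_deg _))
        rfl (FreeGLie.word_smul c x), consLie_smul e _ (FreeGLie.word_of_mem_deg _)]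
    simp only [derAd, FreeGLie.adDeg_smul, LinearMap.comp_smul, LinearMap.smul_comp]
    rw [GSym.der_smul, RingHom.id_apply, smul_add]

lemma neg_one_pow_mul {T : Type*} [Ring T] (k : ℕ) (x : T) :
    (-1 : T) ^ k * x = (-1 : ℤ) ^ k • x := by
  rcases Nat.even_or_odd k with h | h
  · rw [h.neg_one_pow, h.neg_one_pow, one_mul, one_smul]
  · rw [h.neg_one_pow, h.neg_one_pow, neg_mul, neg_smul, one_mul, one_smul]

lemma commutator_leibniz {E : Type*} [Ring E] {U V X X₁ X₂ Y₁ Y₂ : E} {a b c : ℤ}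
    (ha : a = 1 ∨ a = -1) (h₁ : V * X = X₁ + c • (X * V)) (h₂ : U * X = X₂ + b • (X * U))
    (h₃ : U * X₁ = Y₁ + (a * b) • (X₁ * U)) (h₄ : V * X₂ = Y₂ + (a * c) • (X₂ * V)) :
    (U * V - a • (V * U)) * X = Y₁ - a • Y₂ + (b * c) • (X * (U * V - a • (V * U))) := by
  have e₁ : U * V * X = Y₁ + (a * b) • (X₁ * U) + c • ((X₂ + b • (X * U)) * V) := by
    rw [mul_assoc, h₁, mul_add, h₃, mul_smul_comm, ← mul_assoc, h₂]
  have e₂ : V * U * X = Y₂ + (a * c) • (X₂ * V) + b • ((X₁ + c • (X * V)) * U) := by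
    rw [mul_assoc, h₂, mul_add, h₄, mul_smul_comm, ← mul_assoc, h₁]
  rw [sub_mul, smul_mul_assoc, e₁, e₂]
  simp only [add_mul, smul_mul_assoc, mul_sub, mul_smul_comm, mul_assoc, smul_add, smul_sub,
    smul_smul]
  rcases ha with rfl | rfl <;> simp only [one_mul, mul_one, one_smul, neg_mul, neg_smul, mul_neg,
    neg_neg, mul_comm c b] <;> abel

lemma commutator_semidirect {E : Type*} [Ring E] {U V X Y Z : E} {m n : ℕ} {a : ℤ}
    (ha : a = 1 ∨ a = -1) (h₁ : U * Y = Z + a • (Y * U)) (h₂ : V * X = -(a • Z) + a • (X * V))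
    (h₃ : X * Y = a • (Y * X)) : (U + m • X) * (V + n • Y) - a • ((V + n • Y) * (U + m • X)) =
      U * V - a • (V * U) + (m + n) • Z := by
  simp only [add_mul, mul_add, smul_mul_assoc, mul_smul_comm, h₁, h₂, h₃, smul_add, smul_neg,
    add_smul]
  rcases ha with rfl | rfl <;> simp only [one_smul, neg_smul, smul_neg, neg_neg,
    smul_comm m n] <;> abel

/-- The action of a bracket word through the derivations `derAd` satisfies the Leibniz rule. -/
lemma evalWord_derAd_cons (u : FreeMagma M) : ∀ {m n : ℕ} (h : u.length + m = n) {y : FreeGLie R M}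
    (hy : y ∈ FreeGLie.deg R M m),
    evalWord (derAd e) u * consLie e m y hy = consLie e n (FreeGLie.ad u y)
      (FreeGLie.ad_mem_deg u h hy) +
        (-1 : ℤ) ^ (u.length * m) • (consLie e m y hy * evalWord (derAd e) u) := by
  induction u using FreeMagma.recOnMul with
  | ih1 x =>
    intro m n h y hy
    have : (FreeMagma.of x).length * m = m := one_mul m
    rw [this]
    exact derAd_cons e x h hy
  | ih2 u v hu hv =>
    intro m n h y hy
    have h' : u.length + (v.length + m) = n := by rw [← h, ← add_assoc]; rfl
    have h'' : v.length + (u.length + m) = n := by omega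
    have huv : (u * v).length = u.length + v.length := rfl
    have e1 : consLie e n (FreeGLie.ad (u * v) y) (FreeGLie.ad_mem_deg _ h hy) =
        consLie e n (FreeGLie.ad u (FreeGLie.ad v y))
          (FreeGLie.ad_mem_deg u h' (FreeGLie.ad_mem_deg v rfl hy)) -
        (-1 : ℤ) ^ (u.length * v.length) • consLie e n (FreeGLie.ad v (FreeGLie.ad u y))
          (FreeGLie.ad_mem_deg v h'' (FreeGLie.ad_mem_deg u rfl hy)) := by
      rw [← consLie_sign e _ _ (Submodule.smul_mem _ _ (FreeGLie.ad_mem_deg v h''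
        (FreeGLie.ad_mem_deg u rfl hy))), ← consLie_sub e _ _ (Submodule.sub_mem _
        (FreeGLie.ad_mem_deg u h' (FreeGLie.ad_mem_deg v rfl hy)) (Submodule.smul_mem _ _
        (FreeGLie.ad_mem_deg v h'' (FreeGLie.ad_mem_deg u rfl hy))))]
      exact consLie_congr e _ _ rfl (FreeGLie.ad_mul u v y)
    have a1 := hv rfl hy
    have a2 := hu rfl hy
    have b1 := hu h' (FreeGLie.ad_mem_deg v rfl hy)
    have b2 := hv h'' (FreeGLie.ad_mem_deg u rfl hy)
    rw [mul_add, pow_add] at b1 b2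
    rw [mul_comm v.length u.length] at b2
    rw [e1, evalWord_mul, neg_one_pow_mul, huv, add_mul, pow_add]
    exact commutator_leibniz (neg_one_pow_eq_or ℤ (u.length * v.length)) a1 a2 b1 b2

/-- The action of a bracket word through `lieAct`. -/
lemma evalWord_lieAct (u : FreeMagma M) :
    evalWord (lieAct e) u = evalWord (derAd e) u +
      u.length • consLie e u.length (FreeGLie.word R M u) (FreeGLie.word_mem_deg u) := by
  induction u using FreeMagma.recOnMul with
  | ih1 x => exact congrArg (derAd e x + ·) (one_smul ℕ _).symm
  | ih2 u v hu hv =>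
    have huv : u.length + v.length = (u * v).length := rfl
    have hvu : v.length + u.length = (u * v).length := add_comm _ _
    have a := evalWord_derAd_cons e u huv (FreeGLie.word_mem_deg v)
    have b := evalWord_derAd_cons e v hvu (FreeGLie.word_mem_deg u)
    have h1 : FreeGLie.ad v (FreeGLie.word R M u) =
        -((-1 : R) ^ (u.length * v.length) • FreeGLie.word R M (u * v)) := by
      rw [FreeGLie.ad_word, FreeGLie.word_antisymm, mul_comm]
    have c := GSym.cons_cons (R := R) ((e u.length).symm ⟨_, FreeGLie.word_mem_deg u⟩)
      ((e v.length).symm ⟨_, FreeGLie.word_mem_deg v⟩)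
    change consLie e _ _ _ * consLie e _ _ _ = _ • (consLie e _ _ _ * consLie e _ _ _) at c
    rw [consLie_congr e (FreeGLie.ad_mem_deg u huv (FreeGLie.word_mem_deg v))
      (FreeGLie.word_mem_deg (u * v)) rfl (FreeGLie.ad_word u v)] at a
    rw [consLie_congr e (FreeGLie.ad_mem_deg v hvu (FreeGLie.word_mem_deg u))
      (Submodule.neg_mem _ (Submodule.smul_mem _ _ (FreeGLie.word_mem_deg (u * v)))) rfl h1,
      consLie_neg e (Submodule.smul_mem _ _ (FreeGLie.word_mem_deg (u * v))),
      consLie_sign e _ (FreeGLie.word_mem_deg (u * v)),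
      mul_comm v.length] at b
    rw [evalWord_mul, evalWord_mul, hu, hv, neg_one_pow_mul, neg_one_pow_mul]
    exact commutator_semidirect (neg_one_pow_eq_or ℤ (u.length * v.length)) a b c

end PBW

end PolyDiff

namespace PolyDiff

section Injectivity

set_option linter.unusedSectionVars false

variable {R M : Type*} [CommRing R] [AddCommGroup M] [Module R M]
  {L : ℕ → Type*} [∀ n, AddCommGroup (L n)] [∀ n, Module R (L n)] (e : LieGrading R M L)
  {B : Type*} [Ring B] [Module R B] [IsScalarTower R B B] [SMulCommClass R B B]
  (φ : M →ₗ[R] B)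

/-- The map from the pieces of the free graded Lie algebra to an associative algebra. -/
noncomputable def lieToAlg (n : ℕ) : L n →ₗ[R] B :=
  FreeGLie.eval φ ∘ₗ (FreeGLie.deg R M n).subtype ∘ₗ (e n).toLinearMap

include e in
lemma eq_zero_of_lieGrading (x : L 0) : x = 0 := by
  have : e 0 x = 0 := Subtype.ext ((Submodule.mem_bot R).1 (FreeGLie.deg_zero.le (e 0 x).2))
  simpa using this

variable {φ} {J : B →ₗ[R] GSym R L} (hJ : ∀ x b, J (φ x * b) = lieAct e x (J b))

include hJ in
lemma map_evalWord_mul (u : FreeMagma M) (b : B) :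
    J (evalWord φ u * b) = evalWord (lieAct e) u (J b) := by
  induction u using FreeMagma.recOnMul generalizing b with
  | ih1 x => exact hJ x b
  | ih2 u v hu hv =>
    rw [evalWord_mul, evalWord_mul, neg_one_pow_mul, neg_one_pow_mul, sub_mul, smul_mul_assoc,
      mul_assoc, mul_assoc, map_sub, map_zsmul, hu, hv, hv, hu]
    rfl

lemma evalWord_derAd_mem (u : FreeMagma M) {k : ℕ} {s : GSym R L} (hs : s ∈ GSym.lenLT R L k) :
    evalWord (derAd e) u s ∈ GSym.lenLT R L k := by
  induction u using FreeMagma.recOnMul generalizing s with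
  | ih1 x => exact GSym.der_mem_lenLT _ hs
  | ih2 u v hu hv =>
    rw [evalWord_mul, neg_one_pow_mul]
    exact Submodule.sub_mem _ (hu (hv hs)) (zsmul_mem (hv (hu hs)) _)

include hJ in
lemma map_eval_mul {n : ℕ} {x : FreeGLie R M} (hx : x ∈ FreeGLie.deg R M n) {b : B} {k : ℕ}
    (hb : J b ∈ GSym.lenLT R L k) :
    J (FreeGLie.eval φ x * b) - (n : R) • consLie e n x hx (J b) ∈ GSym.lenLT R L k := by
  induction hx using Submodule.span_induction with
  | mem x h =>
    obtain ⟨u, rfl, rfl⟩ := h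
    rw [FreeGLie.eval_word, map_evalWord_mul e hJ, evalWord_lieAct]
    have := evalWord_derAd_mem e u hb
    rw [LinearMap.add_apply, LinearMap.smul_apply, Nat.cast_smul_eq_nsmul, add_sub_cancel_right]
    exact this
  | zero =>
    have : consLie e n 0 (Submodule.zero_mem _) = 0 := by
      rw [consLie, ← map_zero (GSym.cons n), ← map_zero (e n).symm]; rfl
    rw [this, map_zero, zero_mul, map_zero, LinearMap.zero_apply, smul_zero, sub_zero]
    exact Submodule.zero_mem _
  | add x y hx hy ihx ihy =>
    change J _ - (n : R) • consLie e n (x + y) (Submodule.add_mem (FreeGLie.deg R M n) hx hy) (J b) ∈ _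
    rw [consLie_add e hx hy, map_add, add_mul, map_add, LinearMap.add_apply, smul_add,
      add_sub_add_comm]
    exact Submodule.add_mem _ ihx ihy
  | smul c x hx ih =>
    have := Submodule.smul_mem _ c ih
    rw [smul_sub, ← map_smul, ← smul_mul_assoc, ← map_smul, smul_comm c] at this
    change J _ - (n : R) • consLie e n (c • x) (Submodule.smul_mem (FreeGLie.deg R M n) c hx) (J b) ∈ _
    rw [consLie_smul e c hx]
    exact this

include hJ in
lemma map_lieToAlg_mul {n : ℕ} (x : L n) {b : B} {k : ℕ} (hb : J b ∈ GSym.lenLT R L k) :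
    J (lieToAlg e φ n x * b) - (n : R) • GSym.cons n x (J b) ∈ GSym.lenLT R L k := by
  have := map_eval_mul e hJ (e n x).2 hb
  have h : consLie e n (e n x).1 (e n x).2 = GSym.cons n x := by
    rw [consLie, Subtype.coe_eta, LinearEquiv.symm_apply_apply]
  rwa [h] at this

variable {z₀ : Fin 0 → Σ n, L n} (hJ₁ : J 1 = GSym.word R ⟨0, z₀⟩)

include hJ hJ₁ in
lemma map_prod_sub_mem {k : ℕ} (z : Fin k → Σ n, L n) :
    J (List.ofFn fun i => sigmaEval (lieToAlg e φ) (z i)).prod -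
      (∏ i, ((z i).1 : R)) • GSym.word R ⟨k, z⟩ ∈ GSym.lenLT R L k := by
  induction k with
  | zero =>
    rw [List.ofFn_zero, List.prod_nil, hJ₁, Subsingleton.elim z z₀, Fin.prod_univ_zero, one_smul,
      sub_self]
    exact Submodule.zero_mem _
  | succ k ih =>
    have h := ih (Fin.tail z)
    set b := (List.ofFn fun i => sigmaEval (lieToAlg e φ) (Fin.tail z i)).prod
    set c := ∏ i, ((Fin.tail z i).1 : R)
    have hb : J b ∈ GSym.lenLT R L (k + 1) := by
      have := Submodule.add_mem _ (GSym.lenLT_mono k.le_succ h)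
        (Submodule.smul_mem _ c (GSym.word_mem_lenLT (R := R) ⟨k, Fin.tail z⟩ k.lt_succ_self))
      rwa [sub_add_cancel] at this
    have h1 := map_lieToAlg_mul e hJ (z 0).2 hb
    have h2 := Submodule.smul_mem _ ((z 0).1 : R) (GSym.cons_mem_lenLT (z 0).2 h)
    have h3 := Submodule.add_mem _ h1 h2
    rw [map_sub, map_smul, GSym.cons_word, smul_sub, sub_add_sub_cancel, smul_smul] at h3
    have h4 : (Fin.cons ⟨(z 0).1, (z 0).2⟩ (Fin.tail z) : Fin (k + 1) → Σ n, L n) = z :=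
      Fin.cons_self_tail z
    rw [List.ofFn_succ, List.prod_cons, Fin.prod_univ_succ]
    rw [h4] at h3
    exact h3

variable {c : ℕ → R} (hc : ∀ k, c k * (k.factorial : R) = 1)

include hJ hJ₁ hc in
lemma map_symmetrize_sub_mem (w : GWord L) :
    J (GSym.symmetrize c (lieToAlg e φ) (GSym.word R w)) -
      (∏ i, ((w.2 i).1 : R)) • GSym.word R w ∈ GSym.lenLT R L w.1 := by
  have h1 : (∏ i, ((w.2 i).1 : R)) • GSym.word R w = c w.1 • ∑ σ : Equiv.Perm (Fin w.1),
      koszulSign (fun j => (w.2 j).1) σ • (∏ i, ((w.2 (σ i)).1 : R)) •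
        GSym.word R ⟨w.1, w.2 ∘ σ⟩ := by
    have h2 : ∀ σ : Equiv.Perm (Fin w.1), koszulSign (fun j => (w.2 j).1) σ •
        (∏ i, ((w.2 (σ i)).1 : R)) • GSym.word R ⟨w.1, w.2 ∘ σ⟩ =
          (∏ i, ((w.2 i).1 : R)) • GSym.word R w := by
      intro σ
      rw [smul_comm, ← GSym.word_perm, Equiv.prod_comp σ fun i => ((w.2 i).1 : R)]
    rw [Finset.sum_congr rfl fun σ _ => h2 σ, Finset.sum_const, Finset.card_univ,
      Fintype.card_perm, Fintype.card_fin, ← Nat.cast_smul_eq_nsmul R, smul_smul, hc, one_smul]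
  rw [h1, GSym.symmetrize_word, map_smul, map_sum, ← smul_sub, ← Finset.sum_sub_distrib]
  refine Submodule.smul_mem _ _ (Submodule.sum_mem _ fun σ _ => ?_)
  rw [map_zsmul, ← smul_sub]
  exact zsmul_mem (map_prod_sub_mem e hJ hJ₁ (w.2 ∘ σ)) _

variable {ν : ℕ → R} (hν : ∀ n, n ≠ 0 → ν n * (n : R) = 1)

include hJ hJ₁ hc hν in
/-- Symmetrization is injective on the graded symmetric powers of the free graded Lie algebra. -/
theorem symmetrize_injective :
    Function.Injective (GSym.symmetrize c (lieToAlg e φ)) := by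
  have key : Function.Injective
      (GSym.weight (M := L) ν ∘ₗ J ∘ₗ GSym.symmetrize c (lieToAlg e φ)) := by
    refine GSym.injective_of_unipotent _ fun w => ?_
    have h := map_symmetrize_sub_mem e hJ hJ₁ hc w
    have h1 : GSym.weight ν ((∏ i, ((w.2 i).1 : R)) • GSym.word R w) = GSym.word R w := by
      rw [map_smul, GSym.weight_word, smul_smul, ← Finset.prod_mul_distrib]
      by_cases hw : ∃ i, (w.2 i).1 = 0
      · obtain ⟨i, hi⟩ := hw
        have h0 : ∀ x : Σ n, L n, x.1 = 0 → x.2 = 0 := by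
          rintro ⟨n, x⟩ hn
          obtain rfl : n = 0 := hn
          exact eq_zero_of_lieGrading e x
        have := GSym.word_eq_zero (R := R) w.2 i (h0 _ hi)
        change _ • GSym.word R ⟨w.1, w.2⟩ = GSym.word R ⟨w.1, w.2⟩
        rw [this, smul_zero]
      · rw [Finset.prod_eq_one, one_smul]
        intro i _
        rw [mul_comm, hν _ fun h => hw ⟨i, h⟩]
    rw [LinearMap.comp_apply, LinearMap.comp_apply]
    nth_rewrite 2 [← h1]
    rw [← map_sub]
    refine GSym.map_lenLT_le _ _ _ (fun v hv => ?_) h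
    rw [GSym.weight_word]
    exact Submodule.smul_mem _ _ (GSym.word_mem_lenLT v hv)
  rw [← LinearMap.comp_assoc] at key
  exact Function.Injective.of_comp (f := ⇑(GSym.weight (M := L) ν ∘ₗ J)) key

include hJ hJ₁ hν in
/-- The free graded Lie algebra embeds into the associative algebra. -/
theorem lieToAlg_injective (n : ℕ) : Function.Injective (lieToAlg e φ n) := by
  rw [injective_iff_map_eq_zero]
  intro x hx
  by_cases hn : n = 0
  · subst hn
    exact eq_zero_of_lieGrading e x
  · have h := map_lieToAlg_mul e hJ x (b := 1) (k := 1)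
      (by rw [hJ₁]; exact GSym.word_mem_lenLT _ Nat.zero_lt_one)
    rw [hx, zero_mul, map_zero, zero_sub, hJ₁, GSym.cons_word, Submodule.neg_mem_iff] at h
    have h1 := GSym.map_lenLT_le GSym.linearPart ⊥ 1 (fun w hw => by
      obtain ⟨k, z⟩ := w
      obtain rfl : k = 0 := by simpa using hw
      exact GSym.linearPart_word_zero z) h
    rw [Submodule.mem_bot, map_smul, GSym.linearPart_word_one, Fin.cons_zero, ← map_smul,
      DirectSum.lof_eq_of] at h1
    have h2 := DirectSum.of_injective (β := L) n (h1.trans (map_zero _).symm)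
    rw [← one_smul R x, ← hν n hn, mul_smul, h2, smul_zero]

end Injectivity

end PolyDiff

namespace PolyDiff

section Surjectivity

/-- Replace the `i`-th and the `(i+1)`-st entry of a tuple by one entry. -/
def contract {α : Type*} {k : ℕ} (i : Fin k) (c : α) (w : Fin (k + 1) → α) : Fin k → α := fun j =>
  if j < i then w j.castSucc else if j = i then c else w j.succ

lemma comp_contract {α β : Type*} (g : α → β) {k : ℕ} (i : Fin k) (c : α) (w : Fin (k + 1) → α) :
    (fun j => g (contract i c w j)) = contract i (g c) fun j => g (w j) := by
  funext j
  simp only [contract]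
  split_ifs <;> rfl

@[to_additive]
lemma exists_ofFn_prod_eq {B : Type*} [Monoid B] {k : ℕ} (w : Fin (k + 1) → B) (i : Fin k) :
    ∃ P Q : B, (∀ a b, (List.ofFn (Function.update (Function.update w i.castSucc a) i.succ b)).prod =
      P * (a * b) * Q) ∧ ∀ c, (List.ofFn (contract i c w)).prod = P * c * Q := by
  induction k with
  | zero => exact i.elim0
  | succ k ih =>
    refine Fin.cases ?_ (fun i => ?_) i
    · refine ⟨1, (List.ofFn fun j : Fin k => w j.succ.succ).prod, fun a b => ?_, fun c => ?_⟩
      · rw [List.ofFn_succ, List.ofFn_succ, List.prod_cons, List.prod_cons, one_mul, mul_assoc]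
        have h : (fun j : Fin k => Function.update (Function.update w (0 : Fin (k + 1)).castSucc a)
            (0 : Fin (k + 1)).succ b j.succ.succ) = fun j => w j.succ.succ := by
          funext j
          rw [Function.update_of_ne, Function.update_of_ne] <;> simp [Fin.ext_iff]
        rw [h]
        simp [Function.update_of_ne]
      · rw [List.ofFn_succ, List.prod_cons, one_mul]
        rfl
    · obtain ⟨P, Q, h1, h2⟩ := ih (fun j => w j.succ) i
      refine ⟨w 0 * P, Q, fun a b => ?_, fun c => ?_⟩
      · have h3 : (fun j : Fin (k + 1) => Function.update (Function.update w i.succ.castSucc a)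
            i.succ.succ b j.succ) = Function.update (Function.update (fun j => w j.succ)
            i.castSucc a) i.succ b := by
          funext j
          rw [Fin.castSucc_succ]
          simp only [Function.update_apply, Fin.succ_inj]
        rw [List.ofFn_succ, List.prod_cons, h3, h1, Function.update_of_ne (Fin.succ_ne_zero _).symm,
          Function.update_of_ne (by rw [Fin.castSucc_succ]; exact (Fin.succ_ne_zero _).symm)]
        simp only [mul_assoc]
      · have h3 : (fun j : Fin k => contract i.succ c w j.succ) =
            contract i c fun j => w j.succ := by
          funext j
          simp only [contract, Fin.succ_lt_succ_iff, Fin.succ_inj, Fin.castSucc_succ]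
        have h4 : contract i.succ c w 0 = w 0 := by simp [contract]
        rw [List.ofFn_succ, List.prod_cons, h3, h2, h4]
        simp only [mul_assoc]

lemma update_adjacent {α : Type*} {k : ℕ} (w : Fin (k + 1) → α) (i : Fin k) :
    Function.update (Function.update w i.castSucc (w i.castSucc)) i.succ (w i.succ) = w := by
  simp

lemma update_adjacent_swap {α : Type*} {k : ℕ} (w : Fin (k + 1) → α) (i : Fin k) :
    Function.update (Function.update w i.castSucc (w i.succ)) i.succ (w i.castSucc) =
      fun j => w (Equiv.swap i.castSucc i.succ j) := by
  funext j
  have := (Fin.castSucc_lt_succ (i := i)).ne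
  simp only [Function.update_apply, Equiv.swap_apply_def]
  split_ifs with h1 h2 <;> simp_all

@[to_additive]
lemma ofFn_prod_contract {B : Type*} [Monoid B] {k : ℕ} (w : Fin (k + 1) → B) (i : Fin k) :
    (List.ofFn (contract i (w i.castSucc * w i.succ) w)).prod = (List.ofFn w).prod := by
  obtain ⟨P, Q, h1, h2⟩ := exists_ofFn_prod_eq w i
  rw [h2, ← h1, update_adjacent]

lemma ofFn_prod_sub_swap {B : Type*} [Ring B] {k : ℕ} (w : Fin (k + 1) → B) (i : Fin k) (ε : ℤ) :
    (List.ofFn w).prod - ε • (List.ofFn fun j => w (Equiv.swap i.castSucc i.succ j)).prod =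
      (List.ofFn (contract i (w i.castSucc * w i.succ - ε • (w i.succ * w i.castSucc)) w)).prod := by
  obtain ⟨P, Q, h1, h2⟩ := exists_ofFn_prod_eq w i
  have h3 := h1 (w i.castSucc) (w i.succ)
  rw [update_adjacent] at h3
  rw [h2, ← update_adjacent_swap, h1, h3, mul_sub, sub_mul, mul_smul_comm, smul_mul_assoc]

variable {R M : Type*} [CommRing R] [AddCommGroup M] [Module R M]
  {L : ℕ → Type*} [∀ n, AddCommGroup (L n)] [∀ n, Module R (L n)] (e : LieGrading R M L)
  {B : Type*} [Ring B] [Module R B] [IsScalarTower R B B] [SMulCommClass R B B]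
  (φ : M →ₗ[R] B)

lemma eval_mem_range {n : ℕ} {x : FreeGLie R M} (hx : x ∈ FreeGLie.deg R M n) :
    FreeGLie.eval φ x ∈ LinearMap.range (lieToAlg e φ n) :=
  ⟨(e n).symm ⟨x, hx⟩, by simp [lieToAlg]⟩

lemma evalWord_mem_range (u : FreeMagma M) :
    evalWord φ u ∈ LinearMap.range (lieToAlg e φ u.length) := by
  rw [← FreeGLie.eval_word]
  exact eval_mem_range e φ (FreeGLie.word_mem_deg u)

variable {e φ} in
lemma range_lieToAlg_induction {n : ℕ} {p : B → Prop} (h0 : p 0) (ha : ∀ x y, p x → p y → p (x + y))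
    (hs : ∀ (c : R) x, p x → p (c • x)) (hw : ∀ u : FreeMagma M, u.length = n → p (evalWord φ u))
    {b : B} (hb : b ∈ LinearMap.range (lieToAlg e φ n)) : p b := by
  obtain ⟨x, rfl⟩ := hb
  change p (FreeGLie.eval φ (e n x).1)
  obtain ⟨y, hy⟩ := e n x
  induction hy using Submodule.span_induction with
  | mem x h =>
    obtain ⟨u, hu, rfl⟩ := h
    rw [FreeGLie.eval_word]
    exact hw u hu
  | zero => rw [map_zero]; exact h0
  | add x y _ _ hx hy => rw [map_add]; exact ha _ _ hx hy
  | smul c x _ hx => rw [map_smul]; exact hs _ _ hx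

/-- The image of the free graded Lie algebra is closed under graded commutators. -/
lemma bracket_mem_range {m n : ℕ} {a b : B} (ha : a ∈ LinearMap.range (lieToAlg e φ m))
    (hb : b ∈ LinearMap.range (lieToAlg e φ n)) :
    a * b - (-1 : ℤ) ^ (m * n) • (b * a) ∈ LinearMap.range (lieToAlg e φ (m + n)) := by
  refine range_lieToAlg_induction (p := fun a => a * b - (-1 : ℤ) ^ (m * n) • (b * a) ∈
    LinearMap.range (lieToAlg e φ (m + n))) ?_ (fun x y hx hy => ?_) (fun c x hx => ?_)
    (fun u hu => ?_) ha
  · rw [zero_mul, mul_zero, smul_zero, sub_zero]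
    exact Submodule.zero_mem _
  · have := Submodule.add_mem _ hx hy
    simp only [add_mul, mul_add, smul_add]
    convert this using 1
    abel
  · have := Submodule.smul_mem _ c hx
    simp only [smul_mul_assoc, mul_smul_comm]
    rwa [smul_sub, smul_comm c] at this
  refine range_lieToAlg_induction (p := fun b => evalWord φ u * b -
    (-1 : ℤ) ^ (m * n) • (b * evalWord φ u) ∈ LinearMap.range (lieToAlg e φ (m + n))) ?_
    (fun x y hx hy => ?_) (fun c x hx => ?_) (fun v hv => ?_) hb
  · rw [zero_mul, mul_zero, smul_zero, sub_zero]
    exact Submodule.zero_mem _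
  · have := Submodule.add_mem _ hx hy
    simp only [add_mul, mul_add, smul_add]
    convert this using 1
    abel
  · have := Submodule.smul_mem _ c hx
    simp only [smul_mul_assoc, mul_smul_comm]
    rwa [smul_sub, smul_comm c] at this
  subst hu hv
  rw [← neg_one_pow_mul, ← evalWord_mul]
  exact evalWord_mem_range e φ (u * v)

/-- The span of the products of fewer than `k` elements of the free graded Lie algebra of total
degree `n`. -/
noncomputable def prodLT (n k : ℕ) : Submodule R B :=
  Submodule.span R {b | ∃ w : GWord L, w.1 < k ∧ w.deg = n ∧
    b = (List.ofFn fun i => sigmaEval (lieToAlg e φ) (w.2 i)).prod}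

lemma prod_sub_swap_mem {k n : ℕ} (z : Fin (k + 1) → Σ n, L n) (hz : ∑ j, (z j).1 = n)
    (i : Fin k) : (List.ofFn fun j => sigmaEval (lieToAlg e φ) (z j)).prod -
      koszulSign (fun j => (z j).1) (Equiv.swap i.castSucc i.succ) • (List.ofFn fun j =>
        sigmaEval (lieToAlg e φ) (z (Equiv.swap i.castSucc i.succ j))).prod ∈
      prodLT e φ n (k + 1) := by
  rw [koszulSign_swap_adjacent, ofFn_prod_sub_swap (fun j => sigmaEval (lieToAlg e φ) (z j)) i]
  obtain ⟨y, hy⟩ := bracket_mem_range e φ (a := sigmaEval (lieToAlg e φ) (z i.castSucc))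
    (b := sigmaEval (lieToAlg e φ) (z i.succ)) ⟨_, rfl⟩ ⟨_, rfl⟩
  let z' := contract i ⟨(z i.castSucc).1 + (z i.succ).1, y⟩ z
  refine Submodule.subset_span ⟨⟨k, z'⟩, Nat.lt_succ_self k, ?_, ?_⟩
  · have h := comp_contract (fun x : Σ n, L n => x.1) i
      ⟨(z i.castSucc).1 + (z i.succ).1, y⟩ z
    rw [GWord.deg, ← List.sum_ofFn]
    exact (congrArg (fun g => (List.ofFn g).sum) h).trans ((ofFn_sum_contract _ i).trans
      (List.sum_ofFn.trans hz))
  · have h := comp_contract (sigmaEval (lieToAlg e φ)) i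
      ⟨(z i.castSucc).1 + (z i.succ).1, y⟩ z
    refine congrArg (fun g => (List.ofFn g).prod) (Eq.trans ?_ h.symm)
    rw [← hy]
    rfl

lemma prod_sub_perm_mem {k n : ℕ} (σ : Equiv.Perm (Fin k)) (z : Fin k → Σ n, L n)
    (hz : ∑ j, (z j).1 = n) : (List.ofFn fun j => sigmaEval (lieToAlg e φ) (z j)).prod -
      koszulSign (fun j => (z j).1) σ • (List.ofFn fun j =>
        sigmaEval (lieToAlg e φ) (z (σ j))).prod ∈ prodLT e φ n k := by
  have h1 : ∀ z : Fin k → Σ n, L n, (List.ofFn fun j => sigmaEval (lieToAlg e φ) (z j)).prod -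
      koszulSign (fun j => (z j).1) 1 • (List.ofFn fun j =>
        sigmaEval (lieToAlg e φ) (z ((1 : Equiv.Perm (Fin k)) j))).prod ∈ prodLT e φ n k := by
    intro z
    have : koszulSign (fun j => (z j).1) 1 = 1 := by
      simp only [koszulSign, Equiv.Perm.coe_one, id_eq]
      exact Finset.prod_eq_one fun i _ => Finset.prod_eq_one fun j _ =>
        if_neg fun h => lt_asymm h.1 h.2
    rw [this, one_smul]
    simp
  rcases k with _ | k
  · obtain rfl := Subsingleton.elim σ 1
    exact h1 z
  have hσ : σ ∈ Submonoid.closure (Set.range fun i : Fin k => Equiv.swap i.castSucc i.succ) := by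
    rw [Equiv.Perm.mclosure_swap_castSucc_succ]
    trivial
  induction hσ using Submonoid.closure_induction generalizing z with
  | mem σ h =>
    obtain ⟨i, rfl⟩ := h
    exact prod_sub_swap_mem e φ z hz i
  | one => exact h1 z
  | mul σ τ _ _ hσ hτ =>
    have h2 := hσ z hz
    have h3 := hτ (z ∘ σ) ((Equiv.sum_comp σ fun j => (z j).1).trans hz)
    have h4 := Submodule.add_mem _ h2 (zsmul_mem h3 (koszulSign (fun j => (z j).1) σ))
    rw [smul_sub, smul_smul] at h4
    rw [koszulSign_mul]
    convert h4 using 1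
    exact (sub_add_sub_cancel _ _ _).symm

variable {c : ℕ → R} (hc : ∀ k, c k * (k.factorial : R) = 1)

include hc in
/-- Products of elements of the free graded Lie algebra are in the image of symmetrization. -/
theorem prod_mem_map_symmetrize {n : ℕ} (w : GWord L) (hw : w.deg = n) :
    (List.ofFn fun i => sigmaEval (lieToAlg e φ) (w.2 i)).prod ∈
      (GSym.deg R L n).map (GSym.symmetrize c (lieToAlg e φ)) := by
  obtain ⟨k, z⟩ := w
  induction k using Nat.strong_induction_on with
  | _ k ih =>
    have h1 : prodLT e φ n k ≤ (GSym.deg R L n).map (GSym.symmetrize c (lieToAlg e φ)) := by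
      refine Submodule.span_le.2 ?_
      rintro b ⟨⟨j, z'⟩, hj, hd, rfl⟩
      exact ih j hj z' hd
    have h2 : GSym.symmetrize c (lieToAlg e φ) (GSym.word R ⟨k, z⟩) ∈
        (GSym.deg R L n).map (GSym.symmetrize c (lieToAlg e φ)) :=
      ⟨_, Submodule.subset_span ⟨⟨k, z⟩, hw, rfl⟩, rfl⟩
    have h3 := Submodule.smul_mem _ (c k) (Submodule.sum_mem _ fun σ (_ : σ ∈ Finset.univ) =>
      h1 (prod_sub_perm_mem e φ σ z hw))
    have h4 := Submodule.add_mem _ h2 h3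
    rw [GSym.symmetrize_word, ← smul_add, ← Finset.sum_add_distrib] at h4
    simp only [add_sub_cancel] at h4
    rw [Finset.sum_const, Finset.card_univ, Fintype.card_perm, Fintype.card_fin,
      ← Nat.cast_smul_eq_nsmul R, smul_smul, hc, one_smul] at h4
    exact h4

include hc in
theorem prod_generators_mem_map_symmetrize {n : ℕ} (x : Fin n → M) :
    (List.ofFn fun i => φ (x i)).prod ∈
      (GSym.deg R L n).map (GSym.symmetrize c (lieToAlg e φ)) := by
  have h := prod_mem_map_symmetrize e φ hc (n := n) ⟨n, fun i => ⟨1, (e 1).symm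
    ⟨FreeGLie.word R M (.of (x i)), FreeGLie.word_of_mem_deg (x i)⟩⟩⟩ (by simp [GWord.deg])
  have h1 : ∀ y : M, lieToAlg e φ 1 ((e 1).symm
      ⟨FreeGLie.word R M (.of y), FreeGLie.word_of_mem_deg y⟩) = φ y := by
    intro y
    rw [lieToAlg, LinearMap.comp_apply, LinearMap.comp_apply, LinearEquiv.coe_coe,
      LinearEquiv.apply_symm_apply]
    exact FreeGLie.eval_word φ _
  simpa only [sigmaEval, h1] using h

end Surjectivity

section Differential

set_option linter.unusedSectionVars false

variable {R : Type*} {M : ℕ → Type*} [CommRing R] [∀ n, AddCommGroup (M n)] [∀ n, Module R (M n)]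
  {B : Type*} [Ring B] [Module R B] [IsScalarTower R B B] [SMulCommClass R B B]
  {ψ : ∀ n, M n →ₗ[R] B} {δ : ∀ n, M n →ₗ[R] M (n + 1)} {d : B →ₗ[R] B} (hd₁ : d 1 = 0)
  (hd : ∀ n x b, d (ψ n x * b) = ψ (n + 1) (δ n x) * b + (-1 : ℤ) ^ n • (ψ n x * d b))

include hd₁ hd in
lemma der_prod {k : ℕ} (z : Fin k → Σ n, M n) :
    d (List.ofFn fun i => sigmaEval ψ (z i)).prod = ∑ i, leibnizSign (fun j => (z j).1) i •
      (List.ofFn fun j => sigmaEval ψ (Function.update z i (sigmaMap δ (z i)) j)).prod := by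
  induction k with
  | zero => simpa using hd₁
  | succ k ih =>
    rw [List.ofFn_succ, List.prod_cons, Fin.sum_univ_succ]
    have h0 := hd (z 0).1 (z 0).2 (List.ofFn fun i : Fin k => sigmaEval ψ (z i.succ)).prod
    have h1 : (fun j => (z j).1) = (Fin.cons (z 0).1 fun j => (z j.succ).1 : Fin (k + 1) → ℕ) :=
      (Fin.cons_self_tail _).symm
    rw [h1]
    simp only [leibnizSign_cons_zero, leibnizSign_cons_succ]
    refine h0.trans ?_
    congr 1
    · rw [one_smul, List.ofFn_succ, List.prod_cons, Function.update_self]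
      simp only [Function.update_of_ne (Fin.succ_ne_zero _)]
      rfl
    · rw [ih fun j => z j.succ, Finset.mul_sum, Finset.smul_sum]
      refine Finset.sum_congr rfl fun i _ => ?_
      rw [List.ofFn_succ, List.prod_cons, Function.update_of_ne (Fin.succ_ne_zero i).symm,
        mul_smul_comm, smul_smul]
      congr 4
      funext j
      simp only [Function.update_apply, Fin.succ_inj]

include hd₁ hd in
/-- Symmetrization along maps into a differential graded algebra commutes with differentials. -/
theorem symmetrize_der (c : ℕ → R) (s : GSym R M) :
    GSym.symmetrize c ψ (GSym.der δ s) = d (GSym.symmetrize c ψ s) := by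
  induction s using GSym.induction with
  | h0 => simp only [map_zero]
  | ha x y hx hy => simp only [map_add, hx, hy]
  | hw r u =>
    simp only [map_smul, GSym.der_word, map_sum, map_zsmul, GSym.symmetrize_word]
    congr 1
    simp only [smul_comm _ (c u.1), ← Finset.smul_sum]
    congr 1
    simp only [Finset.smul_sum]
    refine (Finset.sum_comm (s := (Finset.univ : Finset (Fin u.1)))
      (t := (Finset.univ : Finset (Equiv.Perm (Fin u.1))))).trans ?_
    refine Finset.sum_congr rfl fun σ _ => ?_
    rw [der_prod hd₁ hd (fun i => u.2 (σ i)), Finset.smul_sum, ← Equiv.sum_comp σ]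
    refine Finset.sum_congr rfl fun m _ => ?_
    rw [smul_smul, smul_smul, fst_update]
    have h := leibniz_koszul (fun j => (u.2 j).1) σ m
    have h1 : (fun j => sigmaEval ψ (Function.update (fun i => u.2 (σ i)) m
        (sigmaMap δ (u.2 (σ m))) j)) = fun i => sigmaEval ψ (Function.update u.2 (σ m)
        (sigmaMap δ (u.2 (σ m))) (σ i)) := by
      funext j
      simp only [Function.update_apply, EmbeddingLike.apply_eq_iff_eq]
    rw [h1]
    congr 1
    exact h.symm

end Differential

section LieDifferential

variable {R M : Type*} [CommRing R] [AddCommGroup M] [Module R M]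
  {L : ℕ → Type*} [∀ n, AddCommGroup (L n)] [∀ n, Module R (L n)] (e : LieGrading R M L)
  {B : Type*} [Ring B] [Module R B] [IsScalarTower R B B] [SMulCommClass R B B]
  {φ : M →ₗ[R] B} {d : B →ₗ[R] B}
  (hd : ∀ n x b, d (lieToAlg e φ n x * b) =
    d (lieToAlg e φ n x) * b + (-1 : ℤ) ^ n • (lieToAlg e φ n x * d b))
  (hφ : ∀ x, d (φ x) ∈ LinearMap.range (lieToAlg e φ 2))

include hd hφ in
/-- A differential mapping the generators to the free graded Lie algebra preserves it. -/
theorem der_mem_range {n : ℕ} {b : B} (hb : b ∈ LinearMap.range (lieToAlg e φ n)) :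
    d b ∈ LinearMap.range (lieToAlg e φ (n + 1)) := by
  have hd' : ∀ {n : ℕ} {a : B} (_ : a ∈ LinearMap.range (lieToAlg e φ n)) (b : B),
      d (a * b) = d a * b + (-1 : ℤ) ^ n • (a * d b) := by
    rintro n _ ⟨x, rfl⟩ b
    exact hd n x b
  refine range_lieToAlg_induction (p := fun b => d b ∈ LinearMap.range (lieToAlg e φ (n + 1))) ?_
    (fun x y hx hy => ?_) (fun c x hx => ?_) (fun u hu => ?_) hb
  · rw [map_zero]; exact Submodule.zero_mem _
  · rw [map_add]; exact Submodule.add_mem _ hx hy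
  · rw [map_smul]; exact Submodule.smul_mem _ _ hx
  subst hu
  clear hb
  induction u using FreeMagma.recOnMul with
  | ih1 x => exact hφ x
  | ih2 u v hu hv =>
    have hu' := evalWord_mem_range e φ u
    have hv' := evalWord_mem_range e φ v
    have h1 := bracket_mem_range e φ hu hv'
    have h2 := bracket_mem_range e φ hu' hv
    have e1 : u.length + 1 + v.length = (u * v).length + 1 := by
      change _ = u.length + v.length + 1; omega
    have e2 : u.length + (v.length + 1) = (u * v).length + 1 := (add_assoc _ _ _).symm
    rw [e1] at h1
    rw [e2] at h2
    have h3 := Submodule.add_mem _ h1 (zsmul_mem h2 ((-1 : ℤ) ^ u.length))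
    convert h3 using 1
    rw [evalWord_mul, neg_one_pow_mul, map_sub, map_zsmul, hd' hu', hd' hv', add_mul, one_mul,
      mul_add, mul_one, pow_add, pow_add]
    generalize evalWord φ u = U
    generalize evalWord φ v = V
    rcases neg_one_pow_eq_or ℤ (u.length * v.length) with h1 | h1 <;>
      rcases neg_one_pow_eq_or ℤ u.length with h2 | h2 <;>
      rcases neg_one_pow_eq_or ℤ v.length with h3 | h3 <;>
      rw [h1, h2, h3] <;> simp <;> abel

end LieDifferential

end PolyDiff

namespace PolyDiff

section Taylor

set_option linter.unusedSectionVars false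

variable {A : Type*} [CommRing A]

/-- Multiplication operators on a commutative ring. -/
abbrev mulEnd : A →+* AddMonoid.End A := Module.toAddMonoidEnd A A

lemma endMul_apply (g h : AddMonoid.End A) (a : A) : (g * h) a = g (h a) := rfl

lemma endAdd_apply (g h : AddMonoid.End A) (a : A) : (g + h) a = g a + h a := rfl

lemma endSub_apply (g h : AddMonoid.End A) (a : A) : (g - h) a = g a - h a := rfl

lemma endSum_apply {α : Type*} (s : Finset α) (g : α → AddMonoid.End A) (a : A) :
    (∑ i ∈ s, g i) a = ∑ i ∈ s, g i a := map_sum (AddMonoidHom.eval a) g s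

lemma mulEnd_apply (a b : A) : mulEnd a b = a * b := rfl

/-- The commutator of an additive operator with a multiplication operator. -/
def adEnd (b : A) : AddMonoid.End A →+ AddMonoid.End A where
  toFun g := g * mulEnd b - mulEnd b * g
  map_zero' := by simp
  map_add' g h := by noncomm_ring

lemma adEnd_def (b : A) (g : AddMonoid.End A) : adEnd b g = g * mulEnd b - mulEnd b * g := rfl

lemma adEnd_apply (b : A) (g : AddMonoid.End A) (a : A) : adEnd b g a = g (b * a) - b * g a := rfl

lemma mulEnd_comm (a b : A) :
    (mulEnd a : AddMonoid.End A) * mulEnd b = mulEnd b * mulEnd a := by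
  rw [← map_mul, mul_comm, map_mul]

lemma adEnd_comm (a b : A) (g : AddMonoid.End A) : adEnd a (adEnd b g) = adEnd b (adEnd a g) := by
  have h := mulEnd_comm a b
  have h1 : g * mulEnd a * mulEnd b = g * mulEnd b * mulEnd a := by rw [mul_assoc, h, mul_assoc]
  have h2 : mulEnd a * (mulEnd b * g) = mulEnd b * (mulEnd a * g) := by
    rw [← mul_assoc, h, mul_assoc]
  simp only [adEnd_def, sub_mul, mul_sub, mul_assoc] at *
  rw [h1, h2]
  abel

lemma adEnd_mulEnd (a b : A) : adEnd b (mulEnd a) = 0 := by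
  rw [adEnd_def, mulEnd_comm, sub_self]

lemma adEnd_mulEnd_mul (a b : A) (g : AddMonoid.End A) :
    adEnd b (mulEnd a * g) = mulEnd a * adEnd b g := by
  ext x; simp only [adEnd_apply, endMul_apply, mulEnd_apply]; ring

lemma adEnd_mul_mulEnd (a b : A) (g : AddMonoid.End A) :
    adEnd b (g * mulEnd a) = adEnd b g * mulEnd a := by
  ext x
  simp only [adEnd_apply, endMul_apply, mulEnd_apply]
  rw [mul_left_comm]

lemma adEnd_mul (a b : A) (g : AddMonoid.End A) :
    adEnd (a * b) g = adEnd a g * mulEnd b + mulEnd a * adEnd b g := by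
  ext x
  simp only [adEnd_apply, endAdd_apply, endMul_apply, mulEnd_apply]
  rw [mul_assoc]
  ring

/-- Differential operators of order `< N`. -/
def IsDiff : ℕ → AddMonoid.End A → Prop
  | 0, g => g = 0
  | N + 1, g => ∀ b, IsDiff N (adEnd b g)

lemma IsDiff.zero (N : ℕ) : IsDiff N (0 : AddMonoid.End A) := by
  induction N with
  | zero => rfl
  | succ N ih => intro b; rwa [map_zero]

lemma IsDiff.succ {N : ℕ} {g : AddMonoid.End A} (hg : IsDiff N g) : IsDiff (N + 1) g := by
  induction N generalizing g with
  | zero => obtain rfl : g = 0 := hg; exact IsDiff.zero 1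
  | succ N ih => exact fun b => ih (hg b)

lemma IsDiff.mono {N M : ℕ} (h : N ≤ M) {g : AddMonoid.End A} (hg : IsDiff N g) : IsDiff M g := by
  induction h with
  | refl => exact hg
  | step _ ih => exact ih.succ

lemma IsDiff.add {N : ℕ} {g h : AddMonoid.End A} (hg : IsDiff N g) (hh : IsDiff N h) :
    IsDiff N (g + h) := by
  induction N generalizing g h with
  | zero =>
    obtain rfl : g = 0 := hg
    obtain rfl : h = 0 := hh
    exact add_zero _
  | succ N ih => intro b; rw [map_add]; exact ih (hg b) (hh b)

lemma IsDiff.mulEnd_mul {N : ℕ} {g : AddMonoid.End A} (a : A) (hg : IsDiff N g) :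
    IsDiff N (mulEnd a * g) := by
  induction N generalizing g with
  | zero => obtain rfl : g = 0 := hg; exact mul_zero _
  | succ N ih => intro b; rw [adEnd_mulEnd_mul]; exact ih (hg b)

lemma IsDiff.mul_mulEnd {N : ℕ} {g : AddMonoid.End A} (a : A) (hg : IsDiff N g) :
    IsDiff N (g * mulEnd a) := by
  induction N generalizing g with
  | zero => obtain rfl : g = 0 := hg; exact zero_mul _
  | succ N ih => intro b; rw [adEnd_mul_mulEnd]; exact ih (hg b)

lemma IsDiff.sum {N : ℕ} {α : Type*} (s : Finset α) (g : α → AddMonoid.End A)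
    (hg : ∀ i ∈ s, IsDiff N (g i)) : IsDiff N (∑ i ∈ s, g i) :=
  Finset.sum_induction _ (IsDiff N) (fun _ _ => IsDiff.add) (IsDiff.zero N) hg

lemma adEnd_mul_derivation {D : AddMonoid.End A} (hD : ∀ a b, D (a * b) = a * D b + b * D a) (b : A)
    (g : AddMonoid.End A) : adEnd b (g * D) = adEnd b g * D + g * mulEnd (D b) := by
  ext x
  simp only [adEnd_apply, endAdd_apply, endMul_apply, mulEnd_apply, hD,
    map_add, mul_comm x]
  ring

lemma IsDiff.mul_derivation {D : AddMonoid.End A} (hD : ∀ a b, D (a * b) = a * D b + b * D a)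
    {N : ℕ} {g : AddMonoid.End A} (hg : IsDiff N g) : IsDiff (N + 1) (g * D) := by
  induction N generalizing g with
  | zero => obtain rfl : g = 0 := hg; rw [zero_mul]; exact IsDiff.zero 1
  | succ N ih =>
    intro b
    rw [adEnd_mul_derivation hD]
    exact (ih (hg b)).add (hg.mul_mulEnd _)

variable {K : Type*} [Field K] (κ : K →+* A) {ι : Type*} (x : ι → A)

/-- The elements `x i` are rigid: a derivation is determined by its values on them. -/
def IsRigid : Prop :=
  ∀ δ : A →+ A, (∀ c, δ (κ c) = 0) → (∀ a b, δ (a * b) = a * δ b + b * δ a) →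
    (∀ i, δ (x i) = 0) → δ = 0

variable {κ x} (hx : IsRigid κ x)

include hx in
/-- A differential operator commuting with rigid elements is linear. -/
lemma IsRigid.adEnd_eq_zero {N : ℕ} {g : AddMonoid.End A} (hg : IsDiff N g)
    (hκ : ∀ c, adEnd (κ c) g = 0) (hgx : ∀ i, adEnd (x i) g = 0) (b : A) : adEnd b g = 0 := by
  induction N generalizing g b with
  | zero => obtain rfl : g = 0 := hg; exact map_zero _
  | succ N ih =>
    have h1 : ∀ b a, adEnd b g a = a * adEnd b g 1 := by
      intro b a
      have := ih (hg b) (fun c => by rw [adEnd_comm, hκ, map_zero])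
        (fun i => by rw [adEnd_comm, hgx, map_zero]) a
      have := DFunLike.congr_fun this 1
      rw [adEnd_apply, mul_one] at this
      exact sub_eq_zero.1 this
    let δ : A →+ A :=
      { toFun := fun b => adEnd b g 1
        map_zero' := by simp [adEnd_apply]
        map_add' := fun a b => by simp only [adEnd_apply, mul_one, map_add, add_mul]; ring }
    have hδ : δ = 0 := by
      refine hx δ (fun c => DFunLike.congr_fun (hκ c) 1) (fun a b => ?_)
        (fun i => DFunLike.congr_fun (hgx i) 1)
      change adEnd (a * b) g 1 = a * adEnd b g 1 + b * adEnd a g 1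
      rw [adEnd_mul, endAdd_apply, endMul_apply, endMul_apply,
        mulEnd_apply, mul_one, h1 a b, mulEnd_apply]
      ring
    ext a
    rw [h1, show adEnd b g 1 = 0 from DFunLike.congr_fun hδ b, mul_zero]
    rfl

include hx in
/-- A differential operator vanishing on the monomials in rigid elements is zero. -/
lemma IsRigid.eq_zero {N : ℕ} {g : AddMonoid.End A} (hg : IsDiff N g)
    (hκ : ∀ c, adEnd (κ c) g = 0) (hgx : ∀ a ∈ Submonoid.closure (Set.range x), g a = 0) :
    g = 0 := by
  induction N generalizing g with
  | zero => exact hg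
  | succ N ih =>
    have h1 : ∀ i, adEnd (x i) g = 0 := by
      intro i
      refine ih (hg (x i)) (fun c => by rw [adEnd_comm, hκ, map_zero]) fun a ha => ?_
      rw [adEnd_apply, hgx a ha, hgx _ (mul_mem (Submonoid.subset_closure ⟨i, rfl⟩) ha), mul_zero,
        sub_zero]
    ext a
    have := DFunLike.congr_fun (hx.adEnd_eq_zero hg hκ h1 a) 1
    rw [adEnd_apply, hgx 1 (one_mem _), mul_one, mul_zero, sub_zero] at this
    exact this

/-- Iterated commutators with the elements `x i`, for a word of indices. -/
def adWord (x : ι → A) : List ι → AddMonoid.End A → AddMonoid.End A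
  | [], g => g
  | i :: w, g => adWord x w (adEnd (x i) g)

/-- Iterated compositions of the operators `D i`, for a word of indices. -/
def compWord (D : ι → AddMonoid.End A) : List ι → AddMonoid.End A
  | [] => 1
  | i :: w => compWord D w * D i

lemma IsDiff.adWord {x : ι → A} {N : ℕ} (w : List ι) {g : AddMonoid.End A}
    (hg : IsDiff (N + w.length) g) : IsDiff N (adWord x w g) := by
  induction w generalizing g with
  | nil => exact hg
  | cons i w ih => exact ih (hg (x i))

variable [Fintype ι]

/-- The homogeneous part of degree `k` of the Taylor expansion, up to a factor `k!`. -/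
def taylorPart (x : ι → A) (D : ι → AddMonoid.End A) : ℕ → AddMonoid.End A → AddMonoid.End A
  | 0, g => mulEnd (g 1)
  | k + 1, g => ∑ i, taylorPart x D k (adEnd (x i) g) * D i

section

variable [DecidableEq ι]

variable {D : ι → AddMonoid.End A} (hD : ∀ i a b, D i (a * b) = a * D i b + b * D i a)
  (hDx : ∀ i j, D i (x j) = if i = j then 1 else 0) (hDκ : ∀ i c, D i (κ c) = 0)

include hD hDx in
lemma adEnd_taylorPart (k : ℕ) (g : AddMonoid.End A) (j : ι) :
    adEnd (x j) (taylorPart x D (k + 1) g) =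
      (k + 1 : ℕ) • taylorPart x D k (adEnd (x j) g) := by
  have h0 : ∀ h : ι → AddMonoid.End A, ∑ i, h i * mulEnd (D i (x j)) = h j := by
    intro h
    rw [Finset.sum_eq_single j]
    · rw [hDx, if_pos rfl, map_one, mul_one]
    · intro i _ hij
      rw [hDx, if_neg hij, map_zero, mul_zero]
    · simp
  induction k generalizing g with
  | zero =>
    simp only [taylorPart, map_sum, adEnd_mul_derivation (hD _), adEnd_mulEnd, zero_mul, zero_add,
      one_smul]
    exact h0 fun i => mulEnd (adEnd (x i) g 1)
  | succ k ih =>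
    rw [taylorPart, map_sum]
    simp only [adEnd_mul_derivation (hD _), ih, Finset.sum_add_distrib, h0]
    rw [add_smul (k + 1) 1, one_smul]
    congr 1
    rw [taylorPart]
    refine Eq.trans ?_ Finset.smul_sum.symm
    exact Finset.sum_congr rfl fun i _ => by rw [adEnd_comm]; exact smul_mul_assoc _ _ _

include hD in
lemma isDiff_taylorPart (k : ℕ) (g : AddMonoid.End A) : IsDiff (k + 1) (taylorPart x D k g) := by
  induction k generalizing g with
  | zero => intro b; exact adEnd_mulEnd _ _
  | succ k ih => exact IsDiff.sum _ _ fun i _ => (ih _).mul_derivation (hD i)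

include hD hDκ in
lemma adEnd_const_taylorPart (k : ℕ) (g : AddMonoid.End A) (c : K) :
    adEnd (κ c) (taylorPart x D k g) = 0 := by
  induction k generalizing g with
  | zero => exact adEnd_mulEnd _ _
  | succ k ih =>
    rw [taylorPart, map_sum]
    refine Finset.sum_eq_zero fun i _ => ?_
    rw [adEnd_mul_derivation (hD i), ih, hDκ, map_zero, mul_zero, zero_mul, add_zero]

variable {r : ℕ → A} (hr : ∀ k, r k * (k.factorial : A) = 1)

include hr in
lemma inv_factorial_succ (k : ℕ) : r (k + 1) * ((k + 1 : ℕ) : A) = r k := by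
  have h := hr (k + 1)
  rw [Nat.factorial_succ, Nat.cast_mul] at h
  calc r (k + 1) * ((k + 1 : ℕ) : A) = r (k + 1) * ((k + 1 : ℕ) : A) * (r k * (k.factorial : A)) := by
        rw [hr, mul_one]
    _ = r k * (r (k + 1) * (((k + 1 : ℕ) : A) * (k.factorial : A))) := by ring
    _ = r k := by rw [h, mul_one]

include hx hD hDx hDκ hr in
/-- The Taylor expansion of a differential operator in local coordinates. -/
theorem taylor {N : ℕ} {g : AddMonoid.End A} (hg : IsDiff N g) (hκ : ∀ c, adEnd (κ c) g = 0) :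
    g = ∑ k ∈ Finset.range N, mulEnd (r k) * taylorPart x D k g := by
  induction N generalizing g with
  | zero => rw [Finset.range_zero, Finset.sum_empty]; exact hg
  | succ N ih =>
    set S := ∑ k ∈ Finset.range (N + 1), mulEnd (r k) * taylorPart x D k g with hS
    have hSd : IsDiff (N + 1) S := IsDiff.sum _ _ fun k hk =>
      ((isDiff_taylorPart hD k g).mulEnd_mul _).mono (Finset.mem_range.1 hk)
    have hSκ : ∀ c, adEnd (κ c) S = 0 := by
      intro c
      rw [hS, map_sum]
      refine Finset.sum_eq_zero fun k _ => ?_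
      rw [adEnd_mulEnd_mul, adEnd_const_taylorPart hD hDκ, mul_zero]
    have hSx : ∀ j, adEnd (x j) S = adEnd (x j) g := by
      intro j
      rw [hS, Finset.sum_range_succ', map_add, map_sum, adEnd_mulEnd_mul, taylorPart, adEnd_mulEnd,
        mul_zero, add_zero]
      conv_rhs => rw [ih (hg (x j)) fun c => by rw [adEnd_comm, hκ, map_zero]]
      refine Finset.sum_congr rfl fun k _ => ?_
      rw [adEnd_mulEnd_mul, adEnd_taylorPart hD hDx, ← inv_factorial_succ hr k, map_mul, mul_assoc,
        map_natCast, nsmul_eq_mul]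
    have hS1 : S 1 = g 1 := by
      have h1 : ∀ i, D i 1 = 0 := fun i => by
        have := hDκ i 1
        rwa [map_one] at this
      have h2 : r 0 = 1 := by simpa using hr 0
      rw [hS, Finset.sum_range_succ', endAdd_apply, h2]
      rw [endMul_apply, mulEnd_apply, one_mul, taylorPart, mulEnd_apply, mul_one,
        endSum_apply, Finset.sum_eq_zero, zero_add]
      intro k _
      rw [endMul_apply, mulEnd_apply, taylorPart, endSum_apply,
        Finset.sum_eq_zero, mul_zero]
      intro i _
      rw [endMul_apply, h1, map_zero]
    have hneg : IsDiff (N + 1) (g - S) := by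
      have h := hg.add (hSd.mulEnd_mul (-1))
      convert h using 1
      ext a
      change g a - S a = g a + -1 * S a
      ring
    ext a
    have := DFunLike.congr_fun (hx.adEnd_eq_zero hneg (fun c => by rw [map_sub, hκ, hSκ, sub_zero])
      (fun j => by rw [map_sub, hSx, sub_self]) a) 1
    rw [adEnd_apply, mul_one, endSub_apply, endSub_apply, hS1, sub_self, mul_zero,
      sub_zero] at this
    exact sub_eq_zero.1 this

end

/-- The words of length `k` in a finite alphabet. -/
def words (ι : Type*) [Fintype ι] : ℕ → Finset (List ι)
  | 0 => {[]}
  | k + 1 => (Finset.univ ×ˢ words ι k).map ⟨fun p : ι × List ι => p.1 :: p.2, fun p q h => by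
      simpa [Prod.ext_iff] using h⟩

lemma mem_words {k : ℕ} {w : List ι} : w ∈ words ι k ↔ w.length = k := by
  induction k generalizing w with
  | zero => simp [words]
  | succ k ih =>
    cases w with
    | nil => simp [words]
    | cons i w =>
      rw [words, Finset.mem_map, List.length_cons, Nat.succ_inj, ← ih]
      refine ⟨?_, fun h => ⟨(i, w), Finset.mem_product.2 ⟨Finset.mem_univ i, h⟩, rfl⟩⟩
      rintro ⟨⟨j, v⟩, h, h'⟩
      obtain ⟨rfl, rfl⟩ := List.cons_eq_cons.1 h'
      exact (Finset.mem_product.1 h).2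

lemma taylorPart_eq_sum (D : ι → AddMonoid.End A) (k : ℕ) (g : AddMonoid.End A) :
    taylorPart x D k g = ∑ w ∈ words ι k, mulEnd (adWord x w g 1) * compWord D w := by
  induction k generalizing g with
  | zero => simp [words, taylorPart, adWord, compWord]
  | succ k ih =>
    rw [taylorPart, words, Finset.sum_map, Finset.sum_product]
    refine Finset.sum_congr rfl fun i _ => ?_
    rw [ih, Finset.sum_mul]
    exact Finset.sum_congr rfl fun w _ => mul_assoc _ _ _

lemma disjoint_words {k l : ℕ} (h : k ≠ l) : Disjoint (words ι k) (words ι l) :=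
  Finset.disjoint_left.2 fun _ h1 h2 => h ((mem_words.1 h1).symm.trans (mem_words.1 h2))

lemma pairwiseDisjoint_words (N : ℕ) :
    ((Finset.range N : Finset ℕ) : Set ℕ).PairwiseDisjoint (words ι) :=
  fun _ _ _ _ h => disjoint_words h

/-- The words of length less than `N` in a finite alphabet. -/
def wordsLT (ι : Type*) [Fintype ι] (N : ℕ) : Finset (List ι) :=
  (Finset.range N).disjiUnion (words ι) (pairwiseDisjoint_words N)

lemma mem_wordsLT {N : ℕ} {w : List ι} : w ∈ wordsLT ι N ↔ w.length < N := by
  simp [wordsLT, mem_words]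

lemma taylor_words [DecidableEq ι] (hx : IsRigid κ x) {D : ι → AddMonoid.End A}
    (hD : ∀ i a b, D i (a * b) = a * D i b + b * D i a)
    (hDx : ∀ i j, D i (x j) = if i = j then 1 else 0) (hDκ : ∀ i c, D i (κ c) = 0) {r : ℕ → A}
    (hr : ∀ k, r k * (k.factorial : A) = 1) {N : ℕ} {g : AddMonoid.End A} (hg : IsDiff N g)
    (hκ : ∀ c, adEnd (κ c) g = 0) (a : A) :
    g a = ∑ w ∈ wordsLT ι N, r w.length * compWord D w a * adWord x w g 1 := by
  rw [taylor hx hD hDx hDκ hr hg hκ, endSum_apply]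
  conv_rhs => rw [← taylor hx hD hDx hDκ hr hg hκ]
  rw [wordsLT, Finset.sum_disjiUnion]
  refine Finset.sum_congr rfl fun k _ => ?_
  rw [taylorPart_eq_sum, endMul_apply, mulEnd_apply, endSum_apply, Finset.mul_sum]
  refine Finset.sum_congr rfl fun w hw => ?_
  rw [mem_words.1 hw, endMul_apply, mulEnd_apply]
  ring

end Taylor

end PolyDiff

namespace PolyDiff

section Slices

variable {K : Type*} {A : Type*} [Field K] [CommRing A] {κ : K →+* A}

/-- A polydifferential operator as a function of one of its arguments. -/
def IsPolyDiff.slice {n : ℕ} {F : Coch n A} (hF : IsPolyDiff κ F) (i : Fin n) (t : Fin n → A) :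
    AddMonoid.End A :=
  AddMonoidHom.mk' (fun a => F (Function.update t i a)) fun a b => hF.map_add i t a b

lemma IsPolyDiff.slice_apply {n : ℕ} {F : Coch n A} (hF : IsPolyDiff κ F) (i : Fin n)
    (t : Fin n → A) (a : A) : hF.slice i t a = F (Function.update t i a) := rfl

lemma isDiff_of_isDO {n : ℕ} {i : Fin n} {t : Fin n → A} {N : ℕ} {F : Coch n A}
    (hF : IsDO i N F) {g : AddMonoid.End A} (hg : ∀ a, g a = F (Function.update t i a)) :
    IsDiff N g := by
  induction N generalizing F g with
  | zero =>
    obtain rfl : F = 0 := hF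
    ext a
    exact hg a
  | succ N ih =>
    intro b
    refine ih (hF b) fun a => ?_
    rw [adEnd_apply, hg, hg, comm, Function.update_idem, Function.update_self]

lemma isDO_of_isDiff {N : ℕ} {F : Coch 1 A} {g : AddMonoid.End A} (hg : IsDiff N g)
    (hF : ∀ a, F a = g (a 0)) : IsDO 0 N F := by
  induction N generalizing F g with
  | zero =>
    obtain rfl : g = 0 := hg
    exact funext fun a => hF a
  | succ N ih =>
    intro b
    refine ih (hg b) fun a => ?_
    rw [adEnd_apply, comm, hF, hF, Function.update_self]

lemma IsPolyDiff.adEnd_const_slice {n : ℕ} {F : Coch n A} (hF : IsPolyDiff κ F) (i : Fin n)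
    (t : Fin n → A) (c : K) : adEnd (κ c) (hF.slice i t) = 0 := by
  ext a
  change F (Function.update t i (κ c * a)) - κ c * F (Function.update t i a) = 0
  rw [hF.map_smul, sub_self]

lemma isPolyDiff_unary {g : AddMonoid.End A} {N : ℕ} (hg : IsDiff N g)
    (hκ : ∀ c, adEnd (κ c) g = 0) : IsPolyDiff κ (fun a : Fin 1 → A => g (a 0)) where
  map_add i a x y := by
    rw [Subsingleton.elim i 0, Function.update_self, Function.update_self, Function.update_self,
      map_add]
  map_smul i a c x := by
    rw [Subsingleton.elim i 0, Function.update_self, Function.update_self]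
    exact sub_eq_zero.1 (DFunLike.congr_fun (hκ c) x)
  diff i := ⟨N, by rw [Subsingleton.elim i 0]; exact isDO_of_isDiff hg fun _ => rfl⟩

/-- A polydifferential operator vanishing on the monomials in rigid elements is zero. -/
lemma IsRigid.polyDiff_eq_zero {ι : Type*} {x : ι → A} (hx : IsRigid κ x) {n : ℕ} {F : Coch n A}
    (hF : IsPolyDiff κ F) (h : ∀ t, (∀ i, t i ∈ Submonoid.closure (Set.range x)) → F t = 0) :
    F = 0 := by
  have key : ∀ (s : Finset (Fin n)) (t : Fin n → A),
      (∀ i ∉ s, t i ∈ Submonoid.closure (Set.range x)) → F t = 0 := by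
    intro s
    induction s using Finset.induction_on with
    | empty => exact fun t ht => h t fun i => ht i (Finset.notMem_empty i)
    | insert i s _ ih =>
      intro t ht
      obtain ⟨N, hN⟩ := hF.diff i
      have h1 : hF.slice i t = 0 := by
        refine hx.eq_zero (isDiff_of_isDO hN fun a => rfl) (hF.adEnd_const_slice i t) fun a ha => ?_
        refine ih _ fun j hj => ?_
        by_cases hji : j = i
        · subst hji; rwa [Function.update_self]
        · rw [Function.update_of_ne hji]
          exact ht j (by simp [hj, hji])
      have h2 := DFunLike.congr_fun h1 (t i)
      rwa [hF.slice_apply, Function.update_eq_self] at h2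
  exact funext fun t => key Finset.univ t fun i hi => absurd (Finset.mem_univ i) hi

lemma IsPolyDiff.comm_zero {n : ℕ} {F : Coch (n + 1) A} (hF : IsPolyDiff κ F) (b : A) :
    IsPolyDiff κ (comm 0 b F) := by
  have h1 : IsPolyDiff κ (fun a => F (Function.update a 0 (b * a 0))) := by
    have h0 : ∀ (i : Fin (n + 1)) (a : Fin (n + 1) → A), ∃ c : A, ∀ y,
        Function.update (Function.update a i y) 0 (b * Function.update a i y 0) =
          Function.update (Function.update a 0 (b * a 0)) i (c * y) := by
      intro i a
      by_cases hi : i = 0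
      · subst hi
        exact ⟨b, fun y => by simp⟩
      · refine ⟨1, fun y => ?_⟩
        rw [Function.update_of_ne (Ne.symm hi), Function.update_comm (Ne.symm hi), one_mul]
    refine ⟨fun i a y z => ?_, fun i a c y => ?_, fun i => ?_⟩
    · obtain ⟨c, hc⟩ := h0 i a
      simp only [hc, mul_add, hF.map_add]
    · obtain ⟨d, hd⟩ := h0 i a
      simp only [hd, ← hF.map_smul]
      congr 2; ring
    · obtain ⟨N, hN⟩ := hF.diff i
      refine ⟨N, hN.transfer (fun F a => F (Function.update a 0 (b * a 0))) rfl fun d F => ?_⟩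
      funext a
      obtain ⟨c, hc⟩ := h0 i a
      have h2 : Function.update a 0 (b * a 0) i = c * a i := by
        have := congrFun (hc (a i)) i
        simpa using this
      simp only [comm, hc, h2]
      congr 3; ring
  convert h1.add (hF.smul (-b)) using 1
  funext a
  simp only [comm, Pi.add_apply]
  ring

lemma IsPolyDiff.cons_one {n : ℕ} {F : Coch (n + 1) A} (hF : IsPolyDiff κ F) :
    IsPolyDiff κ (fun a : Fin n → A => F (Fin.cons 1 a)) where
  map_add i a x y := by simp only [Fin.cons_update, hF.map_add]
  map_smul i a c x := by simp only [Fin.cons_update, hF.map_smul]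
  diff i := by
    obtain ⟨N, hN⟩ := hF.diff i.succ
    refine ⟨N, hN.transfer (fun F a => F (Fin.cons 1 a)) rfl fun b F => ?_⟩
    funext a
    simp only [comm, Fin.cons_update, Fin.cons_succ]

lemma IsPolyDiff.reindex {m n : ℕ} (h : m = n) {F : Coch m A} (hF : IsPolyDiff κ F) :
    IsPolyDiff κ (fun a : Fin n → A => F fun i => a (Fin.cast h i)) := by
  subst h
  exact hF

lemma IsPolyDiff.mul_first {n : ℕ} {P : Coch 1 A} {G : Coch n A} (hP : IsPolyDiff κ P)
    (hG : IsPolyDiff κ G) :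
    IsPolyDiff κ (fun a : Fin (n + 1) → A => P (fun _ => a 0) * G (fun i => a i.succ)) := by
  convert (hP.cmul hG).reindex (add_comm 1 n) using 1
  funext a
  refine congrArg₂ (fun x y => P x * G y) ?_ ?_
  · funext i
    rw [Subsingleton.elim i 0]
    rfl
  · funext i
    congr 1
    ext
    simp

lemma IsPolyDiff.comp_derivation {F D : Coch 1 A} (hF : IsPolyDiff κ F) (hD : IsPolyDiff κ D)
    (h : ∀ a b, D (fun _ => a * b) = a * D (fun _ => b) + b * D fun _ => a) :
    IsPolyDiff κ (fun a => F fun _ => D a) := by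
  obtain ⟨N, hN⟩ := hF.diff 0
  have e1 : ∀ (a : A), Function.update (0 : Fin 1 → A) 0 a = fun _ => a := fun a => by
    funext i; rw [Subsingleton.elim i 0, Function.update_self]
  have h1 : ∀ a b, hD.slice 0 0 (a * b) = a * hD.slice 0 0 b + b * hD.slice 0 0 a := by
    intro a b
    simp only [IsPolyDiff.slice_apply, e1]
    exact h a b
  have h2 := isPolyDiff_unary (κ := κ)
    ((isDiff_of_isDO hN fun a => (rfl : hF.slice 0 0 a = _)).mul_derivation h1) fun c => by
      have h3 : hD.slice 0 0 (κ c) = 0 := by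
        have h4 := DFunLike.congr_fun (hD.adEnd_const_slice 0 0 c) 1
        have h5 := h1 1 1
        rw [mul_one, one_mul] at h5
        rw [adEnd_apply, left_eq_add.1 h5, mul_zero, sub_zero, mul_one] at h4
        exact h4
      rw [adEnd_mul_derivation h1, hF.adEnd_const_slice, h3, map_zero, zero_mul, mul_zero, add_zero]
  convert h2 using 1
  funext a
  simp only [endMul_apply, IsPolyDiff.slice_apply, e1]
  congr 2
  funext i
  congr 1
  funext j
  rw [Subsingleton.elim j 0]

end Slices

section Operations

variable {K : Type u} [Field K] {X : Scheme.{u}}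

lemma rs_ext {U : X.Opens} {a b : Γ(X, U)}
    (h : ∀ (V : X.Opens) (hV : V ≤ U), IsAffineOpen V → rs hV a = rs hV b) : a = b := by
  refine X.sheaf.eq_of_locally_eq' (fun V : {V : X.Opens // V ≤ U ∧ IsAffineOpen V} => V.1) U
    (fun V => homOfLE V.2.1) ?_ a b fun V => h V.1 V.2.1 V.2.2
  intro x hx
  obtain ⟨V, hV, hxV, hVU⟩ := TopologicalSpace.Opens.isBasis_iff_nbhd.1 X.isBasis_affineOpens hx
  exact TopologicalSpace.Opens.mem_iSup.2 ⟨⟨V, hVU, hV⟩, hxV⟩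

variable {f : X ⟶ Spec (.of K)}

/-- Two polydifferential operators agreeing on affine open sets are equal. -/
lemma DSec.ext_affine {n : ℕ} {U : X.Opens} {F G : DSec f n U}
    (h : ∀ (V : X.Opens) (hV : V ≤ U), IsAffineOpen V → F.on V hV = G.on V hV) : F = G := by
  ext V hV a
  refine rs_ext fun W hW hWa => ?_
  rw [F.rs_on, G.rs_on, h W _ hWa]

/-- The commutator of a polydifferential operator with a function, in the first argument. -/
def DSec.adFirst {n : ℕ} {U : X.Opens} (b : Γ(X, U)) :
    DSec f (n + 1) U →ₗ[Γ(X, U)] DSec f (n + 1) U where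
  toFun F := DSec.mk (fun V hV => comm 0 (rs hV b) (F.on V hV))
    (fun V W hV h a => by
      simp only [comm, map_sub, map_mul, F.rs_on, rs_rs]
      congr 2
      funext i
      refine Fin.cases ?_ (fun i => ?_) i
      · simp [rs_rs]
      · rw [Function.update_of_ne (Fin.succ_ne_zero _), Function.update_of_ne (Fin.succ_ne_zero _)])
    (fun V hV h => (F.isPolyDiff hV h).comm_zero _)
  map_add' F G := by
    ext V hV a
    exact congrFun (comm_add 0 (rs hV b) (F.on V hV) (G.on V hV)) a
  map_smul' c F := by
    ext V hV a
    simp only [DSec.on_mk, comm, DSec.on_smul, RingHom.id_apply]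
    ring

lemma DSec.on_adFirst {n : ℕ} {U V : X.Opens} (b : Γ(X, U)) (F : DSec f (n + 1) U) (hV : V ≤ U) :
    (DSec.adFirst b F).on V hV = comm 0 (rs hV b) (F.on V hV) := rfl

/-- A polydifferential operator evaluated at `1` in the first argument. -/
def DSec.evalOne {n : ℕ} {U : X.Opens} : DSec f (n + 1) U →ₗ[Γ(X, U)] DSec f n U where
  toFun F := DSec.mk (fun V hV a => F.on V hV (Fin.cons 1 a))
    (fun V W hV h a => by
      rw [F.rs_on]
      congr 1
      funext i
      refine Fin.cases ?_ (fun i => ?_) i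
      · simp
      · simp)
    (fun V hV h => (F.isPolyDiff hV h).cons_one)
  map_add' _ _ := rfl
  map_smul' _ _ := rfl

/-- The product with an operator of one argument. -/
def DSec.mulFirst {n : ℕ} {U : X.Opens} (P : DSec f 1 U) (G : DSec f n U) : DSec f (n + 1) U :=
  DSec.mk (fun V hV a => P.on V hV (fun _ => a 0) * G.on V hV (fun i => a i.succ))
    (fun V W hV h a => by simp only [map_mul, P.rs_on, G.rs_on])
    (fun V hV h => (P.isPolyDiff hV h).mul_first (G.isPolyDiff hV h))

lemma DSec.on_mulFirst {n : ℕ} {U V : X.Opens} (P : DSec f 1 U) (G : DSec f n U) (hV : V ≤ U)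
    (a : Fin (n + 1) → Γ(X, V)) : (DSec.mulFirst P G).on V hV a =
      P.on V hV (fun _ => a 0) * G.on V hV (fun i => a i.succ) := rfl

lemma DAlg.of_mul_of_one {n : ℕ} {U : X.Opens} (P : DSec f 1 U) (G : DSec f n U) :
    DirectSum.of (fun n => DSec f n U) 1 P * DirectSum.of (fun n => DSec f n U) n G =
      DirectSum.of (fun n => DSec f n U) (n + 1) (DSec.mulFirst P G) := by
  rw [DirectSum.of_mul_of]
  refine DirectSum.of_eq_of_gradedMonoid_eq ?_
  refine DSec.sigma_ext (add_comm 1 n) _ _ fun V hV a => ?_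
  refine congrArg₂ (fun x y => P.on V hV x * G.on V hV y) ?_ ?_
  · funext i
    rw [Subsingleton.elim i 0]
    rfl
  · funext i
    simp [add_comm]

/-- The composition with a derivation. -/
def DSec.compDer {U : X.Opens} (F D : DSec f 1 U)
    (h : ∀ (V : X.Opens) (hV : V ≤ U) (a b : Γ(X, V)), D.on V hV (fun _ => a * b) =
      a * D.on V hV (fun _ => b) + b * D.on V hV fun _ => a) : DSec f 1 U :=
  DSec.mk (fun V hV a => F.on V hV fun _ => D.on V hV a)
    (fun V W hV h a => by simp only [F.rs_on, D.rs_on])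
    (fun V hV hVa => (F.isPolyDiff hV hVa).comp_derivation (D.isPolyDiff hV hVa) (h V hV))

end Operations

end PolyDiff

namespace PolyDiff

lemma isPolyDiff_id {K : Type*} {A : Type*} [Field K] [CommRing A] (κ : K →+* A) :
    IsPolyDiff κ (fun a : Fin 1 → A => a 0) := by
  convert isPolyDiff_unary (κ := κ) (N := 1) (g := mulEnd 1) (fun b => adEnd_mulEnd _ _)
    (fun c => adEnd_mulEnd _ _) using 1
  funext a
  exact (one_mul _).symm

section Coordinates

set_option linter.unusedSectionVars false

variable {K : Type u} [Field K] {X : Scheme.{u}} (f : X ⟶ Spec (.of K))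

/-- Coordinates on an affine open subset: functions `x i` and derivations `D i` with
`D i (x j) = δᵢⱼ` such that derivations on smaller affine open sets are determined by their values
on the functions `x i`. -/
structure Coordinates (U : X.Opens) where
  /-- The number of coordinates. -/
  dim : ℕ
  /-- The coordinate functions. -/
  x : Fin dim → Γ(X, U)
  /-- The partial derivatives. -/
  D : Fin dim → DSec f 1 U
  isAffine : IsAffineOpen U
  D_mul : ∀ (i : Fin dim) (V : X.Opens) (hV : V ≤ U) (a b : Γ(X, V)), (D i).on V hV (fun _ => a * b) =
    a * (D i).on V hV (fun _ => b) + b * (D i).on V hV fun _ => a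
  D_x : ∀ i j, (D i).on U le_rfl (fun _ => x j) = if i = j then 1 else 0
  rigid : ∀ (V : X.Opens) (hV : V ≤ U), IsAffineOpen V → IsRigid (structMap f V) fun i => rs hV (x i)

variable {f} {U : X.Opens} (S : Coordinates f U)

/-- The restriction of coordinates to a smaller affine open subset. -/
def Coordinates.restrict {V : X.Opens} (hV : V ≤ U) (h : IsAffineOpen V) : Coordinates f V where
  dim := S.dim
  x i := rs hV (S.x i)
  D i := DSec.res hV (S.D i)
  isAffine := h
  D_mul i W hW a b := S.D_mul i W _ a b
  D_x i j := by
    rw [DSec.on_res, ← (S.D i).rs_on le_rfl hV, S.D_x]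
    split_ifs <;> simp
  rigid W hW hWa := by
    simp only [rs_rs]
    exact S.rigid W _ hWa

include S in
/-- A polydifferential operator on a coordinate open set is determined by its action on functions
defined on the whole open set. -/
lemma Coordinates.ext {n : ℕ} {F G : DSec f n U} (h : F.on U le_rfl = G.on U le_rfl) : F = G := by
  refine DSec.ext_affine fun V hV hVa => ?_
  have h0 : (F - G).on V hV = 0 := by
    refine (S.rigid V hV hVa).polyDiff_eq_zero ((F - G).isPolyDiff hV hVa) fun t ht => ?_
    have h1 : ∀ i, ∃ a : Γ(X, U), rs hV a = t i := by
      intro i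
      have := ht i
      rw [Set.range_comp' (rs hV) S.x] at this
      obtain ⟨a, _, ha⟩ := (MonoidHom.map_mclosure (rs hV : Γ(X, U) →* Γ(X, V)) _).ge this
      exact ⟨a, ha⟩
    choose a ha using h1
    obtain rfl : (fun i => rs hV (a i)) = t := funext ha
    rw [← (F - G).rs_on le_rfl hV]
    have h2 : (F - G).on U le_rfl a = F.on U le_rfl a - G.on U le_rfl a := rfl
    rw [h2, h, sub_self, map_zero]
  exact sub_eq_zero.1 h0

/-- The partial derivative as an operator on functions. -/
noncomputable def Coordinates.endD (i : Fin S.dim) : AddMonoid.End Γ(X, U) :=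
  ((S.D i).isPolyDiff le_rfl S.isAffine).slice 0 0

lemma Coordinates.endD_apply (i : Fin S.dim) (a : Γ(X, U)) :
    S.endD i a = (S.D i).on U le_rfl fun _ => a := by
  refine congrArg ((S.D i).on U le_rfl) (funext fun j => ?_)
  rw [Subsingleton.elim j 0, Function.update_self]

/-- Iterated partial derivatives. -/
noncomputable def Coordinates.deriv : List (Fin S.dim) → DSec f 1 U
  | [] => DSec.mk (fun _ _ a => a 0) (fun _ _ _ _ _ => rfl) fun _ _ _ => isPolyDiff_id _
  | i :: w => (Coordinates.deriv w).compDer (S.D i) (S.D_mul i)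

lemma Coordinates.deriv_apply (w : List (Fin S.dim)) (a : Γ(X, U)) :
    (S.deriv w).on U le_rfl (fun _ => a) = compWord S.endD w a := by
  induction w generalizing a with
  | nil => rfl
  | cons i w ih =>
    rw [compWord, endMul_apply, ← ih, S.endD_apply]
    rfl

/-- The iterated commutators with the coordinates in the first argument, evaluated at `1`. -/
def Coordinates.coeff (n : ℕ) : List (Fin S.dim) → DSec f (n + 1) U →ₗ[Γ(X, U)] DSec f n U
  | [] => DSec.evalOne
  | i :: w => Coordinates.coeff n w ∘ₗ DSec.adFirst (S.x i)

lemma Coordinates.coeff_apply {n : ℕ} (w : List (Fin S.dim)) (F : DSec f (n + 1) U)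
    (a : Fin n → Γ(X, U)) : (S.coeff n w F).on U le_rfl a =
      adWord S.x w ((F.isPolyDiff le_rfl S.isAffine).slice 0 (Fin.cons 1 a)) 1 := by
  induction w generalizing F with
  | nil =>
    change F.on U le_rfl (Fin.cons 1 a) = F.on U le_rfl (Function.update (Fin.cons 1 a) 0 1)
    congr 1
    exact (Function.update_eq_self 0 _).symm
  | cons i w ih =>
    refine (ih _).trans ?_
    rw [adWord]
    congr 2
    ext b
    rw [adEnd_apply, IsPolyDiff.slice_apply, IsPolyDiff.slice_apply, IsPolyDiff.slice_apply,
      DSec.on_adFirst, comm, Function.update_idem, Function.update_self, rs_self]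

lemma Coordinates.coeff_eq_zero {n : ℕ} {F : DSec f (n + 1) U} {N : ℕ}
    (hN : IsDO 0 N (F.on U le_rfl)) {w : List (Fin S.dim)} (hw : N ≤ w.length) :
    S.coeff n w F = 0 := by
  refine S.ext (funext fun a => ?_)
  rw [S.coeff_apply]
  have h1 : IsDiff N ((F.isPolyDiff le_rfl S.isAffine).slice 0 (Fin.cons 1 a)) :=
    isDiff_of_isDO hN fun _ => rfl
  have h2 : IsDiff 0 _ := IsDiff.adWord (x := S.x) w (h1.mono (by omega))
  exact DFunLike.congr_fun h2 1

/-- All coefficients of a polydifferential operator with respect to its first argument. -/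
noncomputable def Coordinates.coeffs (n : ℕ) :
    DSec f (n + 1) U →ₗ[Γ(X, U)] List (Fin S.dim) →₀ DSec f n U where
  toFun F := Finsupp.ofSupportFinite (fun w => S.coeff n w F) <| by
    obtain ⟨N, hN⟩ := (F.isPolyDiff le_rfl S.isAffine).diff 0
    refine (wordsLT (Fin S.dim) N).finite_toSet.subset fun w hw => ?_
    rw [Finset.mem_coe, mem_wordsLT]
    by_contra h
    exact hw (S.coeff_eq_zero hN (not_lt.1 h))
  map_add' F G := by ext1 w; exact map_add (S.coeff n w) F G
  map_smul' c F := by ext1 w; exact map_smul (S.coeff n w) c F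

lemma Coordinates.coeffs_apply {n : ℕ} (F : DSec f (n + 1) U) (w : List (Fin S.dim)) :
    S.coeffs n F w = S.coeff n w F := rfl

variable [CharZero K]

lemma structMap_mul_natCast (U : X.Opens) {n : ℕ} (hn : n ≠ 0) :
    structMap f U ((n : K)⁻¹) * (n : Γ(X, U)) = 1 := by
  rw [← map_natCast (structMap f U), ← map_mul, inv_mul_cancel₀ (Nat.cast_ne_zero.2 hn), map_one]

/-- The divided iterated partial derivatives. -/
noncomputable def Coordinates.divDeriv (w : List (Fin S.dim)) : DSec f 1 U :=
  structMap f U (w.length.factorial : K)⁻¹ • S.deriv w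

/-- The Taylor expansion of a polydifferential operator in its first argument. -/
theorem Coordinates.eq_sum {n : ℕ} (F : DSec f (n + 1) U) :
    F = (S.coeffs n F).sum fun w G => DSec.mulFirst (S.divDeriv w) G := by
  obtain ⟨N, hN⟩ := (F.isPolyDiff le_rfl S.isAffine).diff 0
  have h0 : ∀ w : List (Fin S.dim), DSec.mulFirst (S.divDeriv w) (0 : DSec f n U) = 0 := fun w => by
    ext V hV a
    exact mul_zero _
  have h1 : (S.coeffs n F).support ⊆ wordsLT (Fin S.dim) N := by
    intro w hw
    rw [mem_wordsLT]
    by_contra h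
    exact (Finsupp.mem_support_iff.1 hw) (S.coeff_eq_zero hN (not_lt.1 h))
  rw [Finsupp.sum_of_support_subset _ h1 _ fun w _ => h0 w]
  refine S.ext (funext fun a => ?_)
  have h2 : ∀ s : Finset (List (Fin S.dim)), (∑ w ∈ s, DSec.mulFirst (S.divDeriv w)
      (S.coeffs n F w)).on U le_rfl a = ∑ w ∈ s, (DSec.mulFirst (S.divDeriv w)
        (S.coeffs n F w)).on U le_rfl a := by
    intro s
    induction s using Finset.induction_on with
    | empty => rfl
    | insert w s hw ih =>
      rw [Finset.sum_insert hw, Finset.sum_insert hw, ← ih]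
      rfl
  rw [h2]
  have h3 : F.on U le_rfl a =
      (F.isPolyDiff le_rfl S.isAffine).slice 0 (Fin.cons 1 (Fin.tail a)) (a 0) := by
    rw [IsPolyDiff.slice_apply, Fin.update_cons_zero, Fin.cons_self_tail]
  have hx : IsRigid (structMap f U) S.x := by
    have := S.rigid U le_rfl S.isAffine
    simpa only [rs_self] using this
  have h4 : ∀ i (c : K), S.endD i (structMap f U c) = 0 := by
    intro i c
    have h5 : ∀ a b, S.endD i (a * b) = a * S.endD i b + b * S.endD i a := by
      intro a b
      simp only [S.endD_apply, S.D_mul]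
    have h6 := DFunLike.congr_fun
      (((S.D i).isPolyDiff le_rfl S.isAffine).adEnd_const_slice 0 0 c) 1
    have h7 := h5 1 1
    rw [mul_one, one_mul] at h7
    change S.endD i (structMap f U c * 1) - structMap f U c * S.endD i 1 = 0 at h6
    rwa [left_eq_add.1 h7, mul_zero, sub_zero, mul_one] at h6
  refine h3.trans ((taylor_words (D := S.endD) hx (fun i a b => by simp only [S.endD_apply, S.D_mul])
    (fun i j => by rw [S.endD_apply, S.D_x]) h4
    (fun k => structMap_mul_natCast (f := f) U k.factorial_ne_zero)
    (isDiff_of_isDO hN fun _ => rfl) (fun c => IsPolyDiff.adEnd_const_slice _ _ _ c) (a 0)).trans ?_)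
  refine Finset.sum_congr rfl fun w _ => ?_
  rw [DSec.on_mulFirst, Coordinates.divDeriv, DSec.on_smul, rs_self, S.deriv_apply, S.coeffs_apply,
    S.coeff_apply]
  rfl

lemma DSec.on_zero_arg {U : X.Opens} (F : DSec f 0 U) :
    F = DSec.const (F.on U le_rfl Fin.elim0) := by
  ext V hV a
  rw [DSec.on_const, F.rs_on]
  congr 1
  exact Subsingleton.elim _ _

lemma Coordinates.coeffs_mulFirst {n : ℕ} (P : DSec f 1 U) (G : DSec f n U) :
    S.coeffs n (DSec.mulFirst P G) = (S.coeffs 0 P).mapRange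
      (fun c : DSec f 0 U => c.on U le_rfl Fin.elim0 • G) (by
        ext V hV a
        rw [DSec.on_smul, DSec.on_zero, DSec.on_zero, Pi.zero_apply, map_zero, zero_mul]
        rfl) := by
  ext1 w
  rw [Finsupp.mapRange_apply, S.coeffs_apply, S.coeffs_apply]
  refine S.ext (funext fun a => ?_)
  rw [DSec.on_smul, rs_self, S.coeff_apply, S.coeff_apply]
  have h : ∀ (w : List (Fin S.dim)) (g h : AddMonoid.End Γ(X, U)) (b : Γ(X, U)),
      (∀ y, g y = h y * b) → ∀ y, adWord S.x w g y = adWord S.x w h y * b := by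
    intro w
    induction w with
    | nil => exact fun _ _ _ h => h
    | cons i w ih =>
      intro g h b hgh y
      refine ih _ _ b (fun y => ?_) y
      rw [adEnd_apply, adEnd_apply, hgh, hgh]
      ring
  refine h w _ _ _ (fun y => ?_) 1
  rw [IsPolyDiff.slice_apply, IsPolyDiff.slice_apply, DSec.on_mulFirst, Fin.update_cons_zero]
  congr 2
  funext i
  rw [Subsingleton.elim i 0, Function.update_self, Fin.cons_zero]

variable {N : Type*} [AddCommGroup N] [Module Γ(X, U) N]
  (act : DSec f 1 U →ₗ[Γ(X, U)] Module.End Γ(X, U) N) (s : N)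

/-- The value at an operator in `n` arguments of the action of the algebra of polydifferential
operators extending an action of the differential operators. -/
noncomputable def Coordinates.actionPart : ∀ n : ℕ, DSec f n U →ₗ[Γ(X, U)] N
  | 0 => { toFun := fun F => F.on U le_rfl Fin.elim0 • s
           map_add' := fun F G => add_smul _ _ _
           map_smul' := fun c F => by
            rw [DSec.on_smul, rs_self, RingHom.id_apply, mul_smul] }
  | n + 1 => Finsupp.lsum Γ(X, U) (fun w => act (S.divDeriv w) ∘ₗ Coordinates.actionPart n) ∘ₗ
      S.coeffs n

lemma Coordinates.actionPart_mulFirst {n : ℕ} (P : DSec f 1 U) (G : DSec f n U) :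
    S.actionPart act s (n + 1) (DSec.mulFirst P G) = act P (S.actionPart act s n G) := by
  have h1 : P = (S.coeffs 0 P).sum fun w c => c.on U le_rfl Fin.elim0 • S.divDeriv w := by
    conv_lhs => rw [S.eq_sum P]
    refine Finsupp.sum_congr fun w _ => ?_
    ext V hV a
    rw [DSec.on_mulFirst, DSec.on_smul, mul_comm, DSec.rs_on]
    congr 2
    · exact Subsingleton.elim _ _
    · funext i
      rw [Subsingleton.elim i 0]
  conv_rhs => rw [h1, map_finsuppSum, Finsupp.sum, LinearMap.sum_apply]
  rw [Coordinates.actionPart, LinearMap.comp_apply, S.coeffs_mulFirst, Finsupp.lsum_apply,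
    Finsupp.sum_mapRange_index (fun w => map_zero _)]
  refine Finset.sum_congr rfl fun w _ => ?_
  beta_reduce
  rw [LinearMap.comp_apply, map_smul, map_smul, map_smul, LinearMap.smul_apply]

/-- The action of the algebra of polydifferential operators extending an action of the differential
operators, on an element `s`. -/
noncomputable def Coordinates.action : DAlg f U →ₗ[Γ(X, U)] N :=
  DirectSum.toModule Γ(X, U) ℕ N (S.actionPart act s)

lemma Coordinates.action_one : S.action act s 1 = s := by
  refine (DirectSum.toModule_lof (M := fun n => DSec f n U) Γ(X, U) 0 (DSec.const 1)).trans ?_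
  change rs le_rfl (1 : Γ(X, U)) • s = s
  rw [map_one, one_smul]

lemma Coordinates.action_mul (P : DSec f 1 U) (b : DAlg f U) :
    S.action act s (DirectSum.lof Γ(X, U) ℕ (fun n => DSec f n U) 1 P * b) =
      act P (S.action act s b) := by
  induction b using DirectSum.induction_on with
  | zero => simp only [mul_zero, map_zero]
  | add x y hx hy => rw [mul_add, map_add, map_add, map_add, hx, hy]
  | of n G =>
    rw [DirectSum.lof_eq_of, DAlg.of_mul_of_one, Coordinates.action,
      ← DirectSum.lof_eq_of Γ(X, U), ← DirectSum.lof_eq_of Γ(X, U), DirectSum.toModule_lof,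
      DirectSum.toModule_lof, S.actionPart_mulFirst]

include S in
/-- The algebra of polydifferential operators is generated by the differential operators. -/
lemma Coordinates.mem_span_prod {n : ℕ} (F : DSec f n U) :
    DirectSum.lof Γ(X, U) ℕ (fun n => DSec f n U) n F ∈ Submodule.span Γ(X, U)
      (Set.range fun P : Fin n → DSec f 1 U =>
        (List.ofFn fun i => DirectSum.lof Γ(X, U) ℕ (fun n => DSec f n U) 1 (P i)).prod) := by
  induction n with
  | zero =>
    have h : DirectSum.lof Γ(X, U) ℕ (fun n => DSec f n U) 0 F =
        F.on U le_rfl Fin.elim0 • (1 : DAlg f U) := by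
      conv_lhs => rw [DSec.on_zero_arg F]
      change _ = _ • DirectSum.lof Γ(X, U) ℕ (fun n => DSec f n U) 0 (DSec.const 1)
      rw [← map_smul]
      congr 1
      ext V hV a
      rw [DSec.on_const, DSec.on_smul, DSec.on_const, map_one, mul_one]
    rw [h]
    exact Submodule.smul_mem _ _ (Submodule.subset_span ⟨Fin.elim0, by simp⟩)
  | succ n ih =>
    rw [S.eq_sum F, map_finsuppSum]
    refine Submodule.sum_mem _ fun w _ => ?_
    beta_reduce
    rw [DirectSum.lof_eq_of, ← DAlg.of_mul_of_one, ← DirectSum.lof_eq_of Γ(X, U),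
      ← DirectSum.lof_eq_of Γ(X, U)]
    have h := ih (S.coeffs n F w)
    generalize DirectSum.lof Γ(X, U) ℕ (fun n => DSec f n U) n (S.coeffs n F w) = y at h ⊢
    induction h using Submodule.span_induction with
    | mem x hx =>
      obtain ⟨P, rfl⟩ := hx
      refine Submodule.subset_span ⟨Fin.cons (S.divDeriv w) P, ?_⟩
      simp only [List.ofFn_succ, List.prod_cons, Fin.cons_zero, Fin.cons_succ]
    | zero => rw [mul_zero]; exact Submodule.zero_mem _
    | add x y _ _ hx hy => rw [mul_add]; exact Submodule.add_mem _ hx hy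
    | smul c x _ hx => rw [mul_smul_comm]; exact Submodule.smul_mem _ _ hx

end Coordinates

end PolyDiff

namespace PolyDiff

section HochschildDerivation

/-- The Hochschild coboundary is a graded derivation. -/
lemma hoch_cmul {A : Type*} [CommRing A] {p q : ℕ} (F : Coch p A) (G : Coch q A) (a : ℕ → A) :
    hoch (cmul F G) (fun i => a i) = cmul (hoch F) G (fun i : Fin (p + 1 + q) => a i) +
      (-1) ^ p * cmul F (hoch G) (fun i : Fin (p + (q + 1)) => a i) := by
  have h1 : ∀ i ∈ Finset.range p, (-1 : A) ^ (i + 1) * cmul F G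
      (merge i fun i : Fin (p + q + 1) => a i) = ((-1) ^ (i + 1) *
        F (merge i fun i : Fin (p + 1) => a i)) * G (fun i : Fin q => a (p + 1 + i)) := by
    intro i hi
    have hi := Finset.mem_range.1 hi
    rw [cmul, mul_assoc]
    refine congrArg (_ * ·) (congrArg₂ (fun x y => F x * G y) ?_ ?_)
    · rfl
    · funext j
      simp only [merge, Fin.val_natAdd, Fin.val_succ]
      rw [if_neg (by omega), if_neg (by omega), add_right_comm]
  have h2 : ∀ j ∈ Finset.range q, (-1 : A) ^ (p + j + 1) * cmul F G
      (merge (p + j) fun i : Fin (p + q + 1) => a i) = (-1) ^ p * F (fun i : Fin p => a i) *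
        ((-1) ^ (j + 1) * G (merge j fun i : Fin (q + 1) => a (p + i))) := by
    intro j hj
    have e1 : (fun i : Fin p => merge (p + j) (fun i : Fin (p + q + 1) => a i)
        (Fin.castAdd q i)) = fun i : Fin p => a i := by
      funext i
      simp only [merge, Fin.val_castAdd, Fin.val_castSucc]
      rw [if_pos (by omega)]
    have e2 : (fun i : Fin q => merge (p + j) (fun i : Fin (p + q + 1) => a i)
        (Fin.natAdd p i)) = merge j fun i : Fin (q + 1) => a (p + i) := by
      funext i
      simp only [merge, Fin.val_natAdd, Fin.val_castSucc, Fin.val_succ, add_assoc,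
        Nat.add_lt_add_iff_left, Nat.add_left_cancel_iff]
    rw [cmul, e1, e2, add_assoc, pow_add]
    ring
  have h3 : cmul F G (fun i : Fin (p + q) => a (i.succ : Fin (p + q + 1))) =
      F (fun i : Fin p => a (i.succ : Fin (p + 1))) * G (fun i : Fin q => a (p + 1 + i)) := by
    refine congrArg₂ (fun x y => F x * G y) rfl ?_
    funext j
    simp only [Fin.val_natAdd, Fin.val_succ, add_right_comm]
  have h4 : hoch (cmul F G) (fun i => a i) = a 0 * (F (fun i : Fin p => a (i.succ : Fin (p + 1))) *
      G (fun i : Fin q => a (p + 1 + i))) +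
      (∑ i ∈ Finset.range (p + q), (-1) ^ (i + 1) * cmul F G
        (merge i fun i : Fin (p + q + 1) => a i)) +
      (-1) ^ (p + q + 1) * (F (fun i : Fin p => a i) * G (fun i : Fin q => a (p + i)) *
        a (p + q)) := by
    rw [← h3]; rfl
  have h5 : cmul (hoch F) G (fun i : Fin (p + 1 + q) => a i) =
      (a 0 * F (fun i : Fin p => a (i.succ : Fin (p + 1))) +
        (∑ i ∈ Finset.range p, (-1) ^ (i + 1) * F (merge i fun i : Fin (p + 1) => a i)) +
        (-1) ^ (p + 1) * (F (fun i : Fin p => a i) * a p)) * G (fun i : Fin q => a (p + 1 + i)) :=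
    rfl
  have h6 : cmul F (hoch G) (fun i : Fin (p + (q + 1)) => a i) = F (fun i : Fin p => a i) *
      (a p * G (fun i : Fin q => a (p + 1 + i)) +
        (∑ i ∈ Finset.range q, (-1) ^ (i + 1) * G (merge i fun i : Fin (q + 1) => a (p + i))) +
        (-1) ^ (q + 1) * (G (fun i : Fin q => a (p + i)) * a (p + q))) := by
    have : (fun i : Fin q => a (p + 1 + i)) = fun i => a (p + (i.succ : Fin (q + 1))) := by
      funext i
      rw [Fin.val_succ, add_assoc, add_comm 1]
    rw [this]
    rfl
  rw [h4, h5, h6, Finset.sum_range_add, Finset.sum_congr rfl h1, Finset.sum_congr rfl h2,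
    ← Finset.sum_mul, ← Finset.mul_sum, add_assoc p q 1, pow_add]
  ring

variable {K : Type u} [Field K] {X : Scheme.{u}} {f : X ⟶ Spec (.of K)} {U : X.Opens}

/-- Polydifferential operators with a different name for the number of arguments. -/
def DSec.reindex {m n : ℕ} (h : m = n) (F : DSec f m U) : DSec f n U :=
  DSec.mk (fun V hV a => F.on V hV fun i => a (Fin.cast h i))
    (fun V W hV h a => by simp only [F.rs_on])
    (fun V hV hVa => (F.isPolyDiff hV hVa).reindex h)

lemma DSec.of_reindex {m n : ℕ} (h : m = n) (F : DSec f m U) :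
    DirectSum.of (fun n => DSec f n U) n (F.reindex h) = DirectSum.of (fun n => DSec f n U) m F :=
  DirectSum.of_eq_of_gradedMonoid_eq (DSec.sigma_ext h.symm _ _ fun _ _ _ => rfl)

lemma DSec.ext_seq {n : ℕ} {F G : DSec f n U} (h : ∀ (V : X.Opens) (hV : V ≤ U) (a : ℕ → Γ(X, V)),
    F.on V hV (fun i => a i) = G.on V hV (fun i => a i)) : F = G := by
  ext V hV a
  have := h V hV (fun i => if hi : i < n then a ⟨i, hi⟩ else 0)
  simpa using this

/-- Evaluation on sections is additive. -/
def DSec.onHom (n : ℕ) (V : X.Opens) (hV : V ≤ U) : DSec f n U →+ Coch n Γ(X, V) where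
  toFun F := F.on V hV
  map_zero' := rfl
  map_add' _ _ := rfl

lemma DSec.on_sum {n : ℕ} {α : Type*} (s : Finset α) (F : α → DSec f n U) {V : X.Opens}
    (hV : V ≤ U) (a : Fin n → Γ(X, V)) :
    (∑ i ∈ s, F i).on V hV a = ∑ i ∈ s, (F i).on V hV a := by
  have := congrFun (map_sum (DSec.onHom (f := f) n V hV) F s) a
  rwa [Finset.sum_apply] at this

lemma DSec.on_zsmul {n : ℕ} (k : ℤ) (F : DSec f n U) {V : X.Opens} (hV : V ≤ U)
    (a : Fin n → Γ(X, V)) : (k • F).on V hV a = k • F.on V hV a :=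
  congrFun (map_zsmul (DSec.onHom (f := f) n V hV) k F) a

variable (f U) in
/-- The Hochschild coboundary on the algebra of polydifferential operators. -/
noncomputable def hochAlg : DAlg f U →ₗ[Γ(X, U)] DAlg f U :=
  DirectSum.toModule Γ(X, U) ℕ _ fun n =>
    DirectSum.lof Γ(X, U) ℕ (fun n => DSec f n U) (n + 1) ∘ₗ DSec.hoch

lemma hochAlg_of (n : ℕ) (F : DSec f n U) : hochAlg f U (DirectSum.of (fun n => DSec f n U) n F) =
    DirectSum.of (fun n => DSec f n U) (n + 1) (DSec.hoch F) :=
  DirectSum.toModule_lof (M := fun n => DSec f n U) Γ(X, U) n F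

lemma hochAlg_one : hochAlg f U 1 = 0 := by
  refine (hochAlg_of 0 (DSec.const 1)).trans ?_
  have : DSec.hoch (DSec.const (f := f) (1 : Γ(X, U))) = 0 := by
    ext V hV a
    rw [DSec.on_hoch, DSec.on_zero, Pi.zero_apply, hoch]
    simp
  rw [this, map_zero]

lemma hochAlg_of_mul (p : ℕ) (F : DSec f p U) (b : DAlg f U) :
    hochAlg f U (DirectSum.of (fun n => DSec f n U) p F * b) =
      DirectSum.of (fun n => DSec f n U) (p + 1) (DSec.hoch F) * b +
        (-1 : ℤ) ^ p • (DirectSum.of (fun n => DSec f n U) p F * hochAlg f U b) := by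
  induction b using DirectSum.induction_on with
  | zero => simp
  | add x y hx hy => rw [mul_add, map_add, hx, hy, mul_add, map_add, mul_add, smul_add]; abel
  | of q G =>
    rw [DirectSum.of_mul_of, hochAlg_of, hochAlg_of, DirectSum.of_mul_of, DirectSum.of_mul_of,
      ← DSec.of_reindex (show p + 1 + q = p + q + 1 by omega),
      ← DSec.of_reindex (show p + (q + 1) = p + q + 1 by omega), ← map_zsmul, ← map_add]
    congr 1
    refine DSec.ext_seq fun V hV a => ?_
    refine (hoch_cmul (F.on V hV) (G.on V hV) a).trans ?_
    rw [DSec.on_add, Pi.add_apply, DSec.on_zsmul, zsmul_eq_mul]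
    push_cast
    rfl

lemma of_mem_range_lof {n : ℕ} (F : DSec f n U) : DirectSum.of (fun n => DSec f n U) n F ∈
    LinearMap.range (DirectSum.lof Γ(X, U) ℕ (fun n => DSec f n U) n) := ⟨F, rfl⟩

lemma mul_mem_range_lof {m n k : ℕ} (h : m + n = k) {x y : DAlg f U}
    (hx : x ∈ LinearMap.range (DirectSum.lof Γ(X, U) ℕ (fun n => DSec f n U) m))
    (hy : y ∈ LinearMap.range (DirectSum.lof Γ(X, U) ℕ (fun n => DSec f n U) n)) :
    x * y ∈ LinearMap.range (DirectSum.lof Γ(X, U) ℕ (fun n => DSec f n U) k) := by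
  subst h
  obtain ⟨F, rfl⟩ := hx
  obtain ⟨G, rfl⟩ := hy
  rw [DirectSum.lof_eq_of, DirectSum.lof_eq_of, DirectSum.of_mul_of]
  exact of_mem_range_lof _

lemma lof_component {n : ℕ} {x : DAlg f U}
    (hx : x ∈ LinearMap.range (DirectSum.lof Γ(X, U) ℕ (fun n => DSec f n U) n)) :
    DirectSum.lof Γ(X, U) ℕ (fun n => DSec f n U) n
      (DirectSum.component Γ(X, U) ℕ (fun n => DSec f n U) n x) = x := by
  obtain ⟨F, rfl⟩ := hx
  rw [DirectSum.component.lof_self]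

lemma evalWord_mem_range_lof (u : FreeMagma (DSec f 1 U)) :
    evalWord (DirectSum.lof Γ(X, U) ℕ (fun n => DSec f n U) 1) u ∈
      LinearMap.range (DirectSum.lof Γ(X, U) ℕ (fun n => DSec f n U) u.length) := by
  induction u using FreeMagma.recOnMul with
  | ih1 x => exact ⟨x, rfl⟩
  | ih2 u v hu hv =>
    rw [evalWord_mul, neg_one_pow_mul]
    exact Submodule.sub_mem _ (mul_mem_range_lof rfl hu hv)
      (zsmul_mem (mul_mem_range_lof (add_comm _ _) hv hu) _)

lemma symmetrize_mem_range_lof {M : ℕ → Type*} [∀ n, AddCommGroup (M n)]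
    [∀ n, Module Γ(X, U) (M n)] (c : ℕ → Γ(X, U)) (ψ : ∀ n, M n →ₗ[Γ(X, U)] DAlg f U)
    (hψ : ∀ n x, ψ n x ∈ LinearMap.range (DirectSum.lof Γ(X, U) ℕ (fun n => DSec f n U) n))
    {n : ℕ} {x : GSym Γ(X, U) M} (hx : x ∈ GSym.deg Γ(X, U) M n) :
    GSym.symmetrize c ψ x ∈
      LinearMap.range (DirectSum.lof Γ(X, U) ℕ (fun n => DSec f n U) n) := by
  have key : ∀ (k : ℕ) (z : Fin k → Σ n, M n), (List.ofFn fun i => sigmaEval ψ (z i)).prod ∈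
      LinearMap.range (DirectSum.lof Γ(X, U) ℕ (fun n => DSec f n U) (∑ i, (z i).1)) := by
    intro k
    induction k with
    | zero => exact fun z => ⟨DSec.const 1, by simp; rfl⟩
    | succ k ih =>
      intro z
      rw [List.ofFn_succ, List.prod_cons]
      exact mul_mem_range_lof (Fin.sum_univ_succ _).symm (hψ _ _) (ih _)
  induction hx using Submodule.span_induction with
  | mem x h =>
    obtain ⟨w, hw, rfl⟩ := h
    rw [GSym.symmetrize_word]
    refine Submodule.smul_mem _ _ (Submodule.sum_mem _ fun σ _ => zsmul_mem ?_ _)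
    have := key w.1 fun i => w.2 (σ i)
    rwa [Equiv.sum_comp σ fun i => (w.2 i).1, show ∑ i, (w.2 i).1 = n from hw] at this
  | zero => rw [map_zero]; exact Submodule.zero_mem _
  | add x y _ _ hx hy => rw [map_add]; exact Submodule.add_mem _ hx hy
  | smul c x _ hx => rw [map_smul]; exact Submodule.smul_mem _ _ hx

end HochschildDerivation

section LocalStructure

set_option linter.unusedSectionVars false

variable {K : Type u} [Field K] {X : Scheme.{u}} (f : X ⟶ Spec (.of K)) (U : X.Opens)

/-- The graded pieces of the free graded Lie algebra of differential operators. -/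
noncomputable def lieGrading : LieGrading Γ(X, U) (DSec f 1 U) (fun n => LSec f n U) := fun n =>
  LinearEquiv.refl Γ(X, U) (FreeGLie.deg Γ(X, U) (DSec f 1 U) n)

/-- The map from the free graded Lie algebra to the algebra of polydifferential operators. -/
noncomputable abbrev lieAlgMap (n : ℕ) : LSec f n U →ₗ[Γ(X, U)] DAlg f U :=
  lieToAlg (lieGrading f U) (DirectSum.lof Γ(X, U) ℕ (fun n => DSec f n U) 1) n

lemma lieAlgMap_eq_lof (n : ℕ) (x : LSec f n U) :
    lieAlgMap f U n x = DirectSum.lof Γ(X, U) ℕ (fun n => DSec f n U) n (lieEval f n U x) := by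
  refine (lof_component ?_).symm
  exact range_lieToAlg_induction (e := lieGrading f U) (n := n)
    (φ := DirectSum.lof Γ(X, U) ℕ (fun n => DSec f n U) 1) (p := fun b => b ∈ LinearMap.range
    (DirectSum.lof Γ(X, U) ℕ (fun n => DSec f n U) n)) (Submodule.zero_mem _)
    (fun _ _ => Submodule.add_mem _) (fun c _ => Submodule.smul_mem _ c)
    (fun u hu => hu ▸ evalWord_mem_range_lof u) (LinearMap.mem_range_self _ x)

variable {f U} [CharZero K] (S : Coordinates f U)

lemma structMap_factorial (k : ℕ) :
    structMap f U (k.factorial : K)⁻¹ * (k.factorial : Γ(X, U)) = 1 :=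
  structMap_mul_natCast U k.factorial_ne_zero

include S in
lemma Coordinates.lieEval_injective (n : ℕ) : Function.Injective (lieEval f n U) := by
  have h := lieToAlg_injective (lieGrading f U)
    (φ := DirectSum.lof Γ(X, U) ℕ (fun n => DSec f n U) 1)
    (J := S.action (lieAct (lieGrading f U)) (GSym.word Γ(X, U) ⟨0, Fin.elim0⟩))
    (fun P b => S.action_mul _ _ P b) (S.action_one _ _) (ν := fun n => structMap f U (n : K)⁻¹)
    (fun n hn => structMap_mul_natCast U hn) n
  intro x y hxy
  refine h ?_
  change lieAlgMap f U n x = lieAlgMap f U n y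
  rw [lieAlgMap_eq_lof, lieAlgMap_eq_lof, hxy]

include S in
lemma Coordinates.symmetrize_injective : Function.Injective
    (GSym.symmetrize (fun k => structMap f U (k.factorial : K)⁻¹) (lieAlgMap f U)) :=
  PolyDiff.symmetrize_injective (lieGrading f U)
    (J := S.action (lieAct (lieGrading f U)) (GSym.word Γ(X, U) ⟨0, Fin.elim0⟩))
    (fun P b => S.action_mul _ _ P b) (S.action_one _ _) structMap_factorial
    (ν := fun n => structMap f U (n : K)⁻¹) (fun _ hn => structMap_mul_natCast U hn)

include S in
lemma Coordinates.lof_mem_map_symmetrize {n : ℕ} (F : DSec f n U) :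
    DirectSum.lof Γ(X, U) ℕ (fun n => DSec f n U) n F ∈
      (GSym.deg Γ(X, U) (fun n => LSec f n U) n).map
        (GSym.symmetrize (fun k => structMap f U (k.factorial : K)⁻¹) (lieAlgMap f U)) := by
  refine (Submodule.span_le.2 ?_) (S.mem_span_prod F)
  rintro _ ⟨P, rfl⟩
  exact prod_generators_mem_map_symmetrize (lieGrading f U) _ structMap_factorial P

lemma DSec.hoch_symm (P : DSec f 1 U) {V : X.Opens} (hV : V ≤ U) (a : Fin 2 → Γ(X, V)) :
    (DSec.hoch P).on V hV a = (DSec.hoch P).on V hV (a ∘ Equiv.swap 0 1) := by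
  have h1 : merge 0 a = fun _ => a 0 * a 1 := by
    funext i; rw [Subsingleton.elim i 0]; rfl
  have h2 : merge 0 (a ∘ Equiv.swap 0 1) = fun _ => a 1 * a 0 := by
    funext i; rw [Subsingleton.elim i 0]; rfl
  have h3 : ∀ b : Fin 2 → Γ(X, V), (fun i : Fin 1 => b i.succ) = fun _ => b 1 := fun b => by
    funext i; rw [Subsingleton.elim i 0]; rfl
  have h4 : ∀ b : Fin 2 → Γ(X, V), (fun i : Fin 1 => b i.castSucc) = fun _ => b 0 := fun b => by
    funext i; rw [Subsingleton.elim i 0]; rfl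
  rw [DSec.on_hoch, PolyDiff.hoch, PolyDiff.hoch, Finset.sum_range_one, Finset.sum_range_one, h1, h2, h3, h3, h4, h4]
  simp only [Function.comp_apply, Equiv.swap_apply_left, Equiv.swap_apply_right,
    show Fin.last 1 = 1 from rfl, mul_comm (a 1) (a 0)]
  ring

include S in
lemma Coordinates.hoch_mem_range (P : DSec f 1 U) :
    hochAlg f U (DirectSum.lof Γ(X, U) ℕ (fun n => DSec f n U) 1 P) ∈
      LinearMap.range (lieAlgMap f U 2) := by
  have h1 := S.eq_sum (DSec.hoch P)
  set T := S.coeffs 1 (DSec.hoch P)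
  have h2 : DSec.hoch P = T.sum fun w G => DSec.mulFirst G (S.divDeriv w) := by
    ext V hV a
    rw [DSec.hoch_symm]
    conv_lhs => rw [h1]
    rw [Finsupp.sum, Finsupp.sum, DSec.on_sum, DSec.on_sum]
    refine Finset.sum_congr rfl fun w _ => ?_
    rw [DSec.on_mulFirst, DSec.on_mulFirst, mul_comm]
    refine congrArg₂ (fun x y => (T w).on V hV x * (S.divDeriv w).on V hV y) ?_ ?_
    · funext i; rw [Subsingleton.elim i 0]; rfl
    · funext i; rw [Subsingleton.elim i 0]; rfl
  have h3 : (2 : Γ(X, U)) • DirectSum.of (fun n => DSec f n U) 2 (DSec.hoch P) ∈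
      LinearMap.range (lieAlgMap f U 2) := by
    rw [two_smul]
    nth_rewrite 1 [h1]
    rw [h2, ← DirectSum.lof_eq_of Γ(X, U), map_finsuppSum, map_finsuppSum, Finsupp.sum,
      Finsupp.sum, ← Finset.sum_add_distrib]
    refine Submodule.sum_mem _ fun w _ => ?_
    have h4 := bracket_mem_range (lieGrading f U) (DirectSum.lof Γ(X, U) ℕ (fun n => DSec f n U) 1)
      (evalWord_mem_range (lieGrading f U) _ (FreeMagma.of (S.divDeriv w)))
      (evalWord_mem_range (lieGrading f U) _ (FreeMagma.of (T w)))
    have h5 : ∀ x : DAlg f U, (-1 : ℤ) ^ ((FreeMagma.of (S.divDeriv w)).length *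
        (FreeMagma.of (T w)).length) • x = - x := fun x => by
      change (-1 : ℤ) ^ (1 * 1) • x = _
      simp
    rw [h5, sub_neg_eq_add] at h4
    exact Set.mem_of_eq_of_mem (congrArg₂ (· + ·)
      (DAlg.of_mul_of_one (S.divDeriv w) (T w)).symm
      (DAlg.of_mul_of_one (T w) (S.divDeriv w)).symm) h4
  have h6 := Submodule.smul_mem _ (structMap f U ((2 : ℕ) : K)⁻¹) h3
  have h7 : structMap f U ((2 : ℕ) : K)⁻¹ * (2 : Γ(X, U)) = 1 := by
    have h8 := structMap_mul_natCast (K := K) (f := f) U (n := 2) two_ne_zero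
    rwa [Nat.cast_ofNat (R := Γ(X, U))] at h8
  rw [smul_smul, h7, one_smul] at h6
  rwa [DirectSum.lof_eq_of, hochAlg_of]

include S in
/-- The Hochschild coboundary preserves the free graded Lie algebra of differential operators. -/
lemma Coordinates.exists_lieEval_eq_hoch {n : ℕ} (x : LSec f n U) :
    ∃ y : LSec f (n + 1) U, lieEval f (n + 1) U y = DSec.hoch (lieEval f n U x) := by
  have h := der_mem_range (lieGrading f U) (d := hochAlg f U) (n := n) (fun m x b => by
    change hochAlg f U (lieAlgMap f U m x * b) = hochAlg f U (lieAlgMap f U m x) * b +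
      _ • (lieAlgMap f U m x * _)
    rw [lieAlgMap_eq_lof, DirectSum.lof_eq_of, hochAlg_of_mul, hochAlg_of]) S.hoch_mem_range
    (b := lieAlgMap f U n x) ⟨x, rfl⟩
  obtain ⟨y, hy⟩ := h
  refine ⟨y, ?_⟩
  change lieAlgMap f U (n + 1) y = _ at hy
  rw [lieAlgMap_eq_lof, lieAlgMap_eq_lof, DirectSum.lof_eq_of, DirectSum.lof_eq_of, hochAlg_of] at hy
  exact DirectSum.of_injective (β := fun n => DSec f n U) _ hy

end LocalStructure

end PolyDiff

namespace PolyDiff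

section EtaleCoordinates

variable {K A : Type u} [Field K] [CommRing A] {n : ℕ} {g : MvPolynomial (Fin n) K →+* A}

open TensorProduct in
/-- The differentials of étale coordinates form a basis of the Kähler differentials. -/
lemma exists_basis_of_etale [Algebra K A] (hg : g.Etale) (hκ : g.comp MvPolynomial.C = algebraMap K A) :
    ∃ b : Module.Basis (Fin n) A (Ω[A⁄K]), ∀ i, b i = KaehlerDifferential.D K A (g (.X i)) := by
  let := g.toAlgebra
  have : IsScalarTower K (MvPolynomial (Fin n) K) A := IsScalarTower.of_algebraMap_eq' hκ.symm
  have : Algebra.Etale (MvPolynomial (Fin n) K) A := hg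
  refine ⟨((KaehlerDifferential.mvPolynomialBasis K (Fin n)).baseChange A).map
    (KaehlerDifferential.tensorKaehlerEquivOfFormallyEtale K (MvPolynomial (Fin n) K) A),
    fun i => ?_⟩
  rw [Module.Basis.map_apply, Module.Basis.baseChange_apply, KaehlerDifferential.mvPolynomialBasis_apply]
  exact (LinearEquiv.eq_symm_apply _).1
    (KaehlerDifferential.tensorKaehlerEquivOfFormallyEtale_symm_D_algebraMap K _ A _).symm

variable {κ : K →+* A} (hg : g.Etale) (hκ : g.comp MvPolynomial.C = κ)

include hg hκ in
lemma derivation_eq_zero_of_etale {T : Type*} [CommRing T] (r : A →+* T) (δ : A →+ T)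
    (hδκ : ∀ c, δ (κ c) = 0) (hδ : ∀ a b, δ (a * b) = r a * δ b + r b * δ a)
    (hx : ∀ i, δ (g (.X i)) = 0) : δ = 0 := by
  let := κ.toAlgebra
  let := r.toAlgebra
  let := (r.comp κ).toAlgebra
  have : IsScalarTower K A T := IsScalarTower.of_algebraMap_eq' rfl
  obtain ⟨b, hb⟩ := exists_basis_of_etale hg hκ
  let D : Derivation K A T := Derivation.mk'
    { δ with
      map_smul' := fun c a => by
        change δ (κ c * a) = r (κ c) * δ a
        rw [hδ, hδκ, mul_zero, add_zero] } hδ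
  have h : D.liftKaehlerDifferential = 0 := b.ext fun i => by
    rw [hb, Derivation.liftKaehlerDifferential_comp_D]
    exact hx i
  ext a
  change D a = 0
  rw [← Derivation.liftKaehlerDifferential_comp_D, h, LinearMap.zero_apply]

include hg hκ in
lemma isRigid_of_etale : IsRigid κ fun i => g (.X i) := fun δ h1 h2 h3 =>
  derivation_eq_zero_of_etale hg hκ (RingHom.id A) δ h1 h2 h3

include hg hκ in
lemma exists_partial_of_etale (i : Fin n) : ∃ D : AddMonoid.End A,
    (∀ a b, D (a * b) = a * D b + b * D a) ∧ (∀ c, D (κ c) = 0) ∧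
      ∀ j, D (g (.X j)) = if i = j then 1 else 0 := by
  let := κ.toAlgebra
  obtain ⟨b, hb⟩ := exists_basis_of_etale hg hκ
  let D : Derivation K A A := (b.coord i).compDer (KaehlerDifferential.D K A)
  refine ⟨D.toLinearMap.toAddMonoidHom, D.leibniz, D.map_algebraMap, fun j => ?_⟩
  change b.coord i (KaehlerDifferential.D K A (g (.X j))) = _
  rw [← hb, Module.Basis.coord_apply, Module.Basis.repr_self, Finsupp.single_apply]
  simp only [eq_comm]

end EtaleCoordinates

section Existence

variable {K : Type u} [Field K] {X : Scheme.{u}} (f : X ⟶ Spec (.of K))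

lemma etale_rs {U V : X.Opens} (h : V ≤ U) (hU : IsAffineOpen U) (hV : IsAffineOpen V) :
    (rs h).Etale := by
  have := Scheme.Hom.etale_appLE (𝟙 X) hU hV h
  have h1 : Scheme.Hom.appLE (𝟙 X) U V h = X.presheaf.map (homOfLE h).op := Category.id_comp _
  rwa [h1] at this

lemma isStandardSmooth_structMap [Smooth f] (x : X) : ∃ U : X.Opens, x ∈ U ∧ IsAffineOpen U ∧
    (structMap f U).IsStandardSmooth := by
  obtain ⟨W, hW, U, hU, hx, e, h⟩ := Smooth.exists_isStandardSmooth f x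
  have hWtop : W = ⊤ := by
    refine top_unique fun y _ => ?_
    have : Subsingleton (Spec (.of K)) := inferInstanceAs (Subsingleton (PrimeSpectrum K))
    rw [Subsingleton.elim y (f x)]
    exact e hx
  subst hWtop
  refine ⟨U, hx, hU, ?_⟩
  exact RingHom.isStandardSmooth_respectsIso.right _ (Scheme.ΓSpecIso (.of K)).symm.commRingCatIsoToRingEquiv h

lemma exists_etale_coordinates [Smooth f] (x : X) : ∃ U : X.Opens, x ∈ U ∧ IsAffineOpen U ∧
    ∃ (n : ℕ) (g : MvPolynomial (Fin n) K →+* Γ(X, U)),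
      g.comp MvPolynomial.C = structMap f U ∧ g.Etale := by
  obtain ⟨U, hx, hU, h⟩ := isStandardSmooth_structMap f x
  exact ⟨U, hx, hU, h.exists_etale_mvPolynomial⟩

variable {f} {U : X.Opens} (hU : IsAffineOpen U) {n : ℕ} {g : MvPolynomial (Fin n) K →+* Γ(X, U)}
  (hg : g.Etale) (hκ : g.comp MvPolynomial.C = structMap f U)

include hU hg in
lemma etale_comp_rs {V : X.Opens} (h : V ≤ U) (hV : IsAffineOpen V) : ((rs h).comp g).Etale :=
  RingHom.Etale.stableUnderComposition _ _ hg (etale_rs h hU hV)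

include hκ in
lemma rs_comp_C {V : X.Opens} (h : V ≤ U) :
    ((rs h).comp g).comp MvPolynomial.C = structMap f V := by
  rw [RingHom.comp_assoc, hκ]
  ext c
  exact rs_structMap f h c

include hU hg hκ in
/-- The partial derivatives with respect to étale coordinates are compatible with restriction. -/
lemma exists_partial_family (i : Fin n) : ∃ D : ∀ V : X.Opens, V ≤ U → Γ(X, V) → Γ(X, V),
    (∀ (V W : X.Opens) (hV : V ≤ U) (h : W ≤ V) (a : Γ(X, V)),
      rs h (D V hV a) = D W (h.trans hV) (rs h a)) ∧
    (∀ (V : X.Opens) (hV : V ≤ U), IsAffineOpen V → ∃ E : AddMonoid.End Γ(X, V),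
      (∀ a, D V hV a = E a) ∧ (∀ a b, E (a * b) = a * E b + b * E a) ∧
      (∀ c, E (structMap f V c) = 0) ∧ ∀ j, E (rs hV (g (.X j))) = if i = j then 1 else 0) := by
  have h0 : ∀ V : {V : X.Opens // V ≤ U ∧ IsAffineOpen V}, ∃ E : AddMonoid.End Γ(X, V.1),
      (∀ a b, E (a * b) = a * E b + b * E a) ∧ (∀ c, E (structMap f V.1 c) = 0) ∧
        ∀ j, E (rs V.2.1 (g (.X j))) = if i = j then 1 else 0 := fun V =>
    exists_partial_of_etale (etale_comp_rs hU hg V.2.1 V.2.2) (rs_comp_C hκ V.2.1) i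
  choose E hE using h0
  have h1 : ∀ (V W : {V : X.Opens // V ≤ U ∧ IsAffineOpen V}) (h : W.1 ≤ V.1) (a : Γ(X, V.1)),
      rs h (E V a) = E W (rs h a) := by
    intro V W h a
    have := derivation_eq_zero_of_etale (etale_comp_rs hU hg V.2.1 V.2.2) (rs_comp_C hκ V.2.1)
      (rs h) ((rs h).toAddMonoidHom.comp (E V) - AddMonoidHom.comp (E W) (rs h).toAddMonoidHom)
      (fun c => by
        change rs h (E V _) - E W (rs h _) = 0
        rw [(hE V).2.1, rs_structMap, (hE W).2.1, map_zero, sub_zero])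
      (fun a b => by
        change rs h (E V _) - E W (rs h _) = _ * (rs h (E V _) - E W (rs h _)) +
          _ * (rs h (E V _) - E W (rs h _))
        rw [(hE V).1, map_mul, (hE W).1, map_add, map_mul, map_mul]
        ring)
      (fun j => by
        change rs h (E V (rs _ _)) - E W (rs h (rs _ _)) = 0
        rw [(hE V).2.2, rs_rs, (hE W).2.2]
        split_ifs <;> simp)
    exact sub_eq_zero.1 (DFunLike.congr_fun this a)
  have h2 : ∀ (V : X.Opens) (hV : V ≤ U) (a : Γ(X, V)), ∃ s : Γ(X, V),
      ∀ (W : X.Opens) (hW : W ≤ V) (hWa : IsAffineOpen W),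
        rs hW s = E ⟨W, hW.trans hV, hWa⟩ (rs hW a) := by
    intro V hV a
    obtain ⟨s, hs, -⟩ := X.sheaf.existsUnique_gluing'
      (fun W : {W : X.Opens // W ≤ V ∧ IsAffineOpen W} => W.1) V (fun W => homOfLE W.2.1)
      (fun x hx => by
        obtain ⟨W, hW, hxW, hWV⟩ :=
          TopologicalSpace.Opens.isBasis_iff_nbhd.1 X.isBasis_affineOpens hx
        exact TopologicalSpace.Opens.mem_iSup.2 ⟨⟨W, hWV, hW⟩, hxW⟩)
      (fun W => E ⟨W.1, W.2.1.trans hV, W.2.2⟩ (rs W.2.1 a)) (fun W W' => by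
        change rs inf_le_left _ = rs inf_le_right _
        refine rs_ext fun Z hZ hZa => ?_
        have h3 : ∀ (W : {W : X.Opens // W ≤ V ∧ IsAffineOpen W}) (h : Z ≤ W.1),
            rs h (E ⟨W.1, W.2.1.trans hV, W.2.2⟩ (rs W.2.1 a)) =
              E ⟨Z, h.trans (W.2.1.trans hV), hZa⟩ (rs (h.trans W.2.1) a) := fun W h =>
          (h1 ⟨W.1, W.2.1.trans hV, W.2.2⟩ ⟨Z, h.trans (W.2.1.trans hV), hZa⟩ h _).trans
            (congrArg _ (rs_rs W.2.1 h a))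
        exact (rs_rs _ _ _).trans ((h3 W (hZ.trans inf_le_left)).trans
          ((rs_rs _ _ _).trans (h3 W' (hZ.trans inf_le_right))).symm))
    exact ⟨s, fun W hW hWa => hs ⟨W, hW, hWa⟩⟩
  choose D hD using h2
  refine ⟨D, fun V W hV h a => rs_ext fun Z hZ hZa => ?_, fun V hV hVa => ⟨E ⟨V, hV, hVa⟩,
    fun a => ?_, hE ⟨V, hV, hVa⟩⟩⟩
  · rw [rs_rs, hD V hV a Z _ hZa, hD W _ _ Z hZ hZa, rs_rs]
  · have := hD V hV a V le_rfl hVa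
    rwa [rs_self, rs_self] at this

include hU hg hκ in
lemma nonempty_coordinates : Nonempty (Coordinates f U) := by
  choose D hD hDa using exists_partial_family hU hg hκ
  have hmul : ∀ (i : Fin n) (V : X.Opens) (hV : V ≤ U) (a b : Γ(X, V)), D i V hV (a * b) =
      a * D i V hV b + b * D i V hV a := by
    intro i V hV a b
    refine rs_ext fun W hW hWa => ?_
    obtain ⟨E, hE, h1, -⟩ := hDa i W (hW.trans hV) hWa
    rw [map_add, map_mul, map_mul, hD, hD, hD, hE, hE, hE, map_mul, h1]
  exact ⟨{
    dim := n
    x := fun i => g (.X i)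
    D := fun i => DSec.mk (fun V hV a => D i V hV (a 0)) (fun V W hV h a => hD i V W hV h _)
      (fun V hV hVa => by
        obtain ⟨E, hE, h1, h2, -⟩ := hDa i V hV hVa
        have hE1 : IsDiff 2 E := by
          have := IsDiff.mul_derivation h1 (N := 1) (g := mulEnd 1) fun b => adEnd_mulEnd _ _
          rwa [map_one, one_mul] at this
        convert isPolyDiff_unary (κ := structMap f V) hE1 fun c => ?_ using 1
        · funext a
          exact hE _
        · ext a
          rw [adEnd_apply, h1, h2, mul_zero, add_zero, sub_self]
          rfl)
    isAffine := hU
    D_mul := fun i V hV a b => hmul i V hV a b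
    D_x := fun i j => by
      obtain ⟨E, hE, -, -, h3⟩ := hDa i U le_rfl hU
      refine (hE _).trans ?_
      rw [← h3, rs_self]
    rigid := fun V hV hVa =>
      isRigid_of_etale (etale_comp_rs hU hg hV hVa) (rs_comp_C hκ hV) }⟩

variable (f) in
/-- On a smooth scheme, every point has arbitrarily small neighbourhoods with coordinates. -/
theorem exists_coordinates [Smooth f] {V : X.Opens} {x : X} (hx : x ∈ V) :
    ∃ U : X.Opens, x ∈ U ∧ U ≤ V ∧ Nonempty (Coordinates f U) := by
  obtain ⟨U, hxU, hU, n, g, hκ, hg⟩ := exists_etale_coordinates f x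
  obtain ⟨S⟩ := nonempty_coordinates hU hg hκ
  obtain ⟨W, hW, hxW, hWV⟩ := TopologicalSpace.Opens.isBasis_iff_nbhd.1 X.isBasis_affineOpens
    (show x ∈ U ⊓ V from ⟨hxU, hx⟩)
  exact ⟨W, hxW, hWV.trans inf_le_right, ⟨S.restrict (hWV.trans inf_le_left) hW⟩⟩

end Existence

end PolyDiff

namespace PolyDiff
variable {X : Scheme.{u}}

/-- The unit of sheafification, on sections. -/
noncomputable def toSheaf (P : X.PresheafOfModules) (U : X.Opens) : P.obj (op U) →+ Γ(sheafify P, U) :=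
  ((CategoryTheory.toSheafify (Opens.grothendieckTopology X) P.presheaf).app (op U)).hom

lemma toSheaf_res (P : X.PresheafOfModules) {U V : X.Opens} (h : V ≤ U) (x : P.obj (op U)) :
    toSheaf P V (P.map (homOfLE h).op x) = modRes (sheafify P) h (toSheaf P U x) :=
  ConcreteCategory.congr_hom ((CategoryTheory.toSheafify (Opens.grothendieckTopology X)
    P.presheaf).naturality (homOfLE h).op) x

lemma toSheaf_smul (P : X.PresheafOfModules) {U : X.Opens} (c : Γ(X, U)) (x : P.obj (op U)) :
    toSheaf P U (HSMul.hSMul (α := X.ringCatSheaf.obj.obj (op U)) c x) = c • toSheaf P U x :=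
  (((PresheafOfModules.sheafificationAdjunction (𝟙 X.ringCatSheaf.obj)).unit.app P).app
    (op U)).hom.map_smul c x

lemma sheafifyLift_toSheaf {P : X.PresheafOfModules} {F : X.Modules} (φ : P ⟶ F.val) {U : X.Opens}
    (x : P.obj (op U)) : modApp (sheafifyLift φ) U (toSheaf P U x) = φ.app (op U) x := by
  have h := (congrArg (PresheafOfModules.toPresheaf _).map ((PresheafOfModules.sheafificationHomEquiv
    (𝟙 X.ringCatSheaf.obj) (P := P) (F := F)).apply_symm_apply φ)).symm.trans
    (PresheafOfModules.toPresheaf_map_sheafificationHomEquiv_def (𝟙 X.ringCatSheaf.obj) _)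
  exact (ConcreteCategory.congr_hom (NatTrans.congr_app h (op U)) x).symm

lemma sheafifyMap_toSheaf {P Q : X.PresheafOfModules} (φ : P ⟶ Q) {U : X.Opens}
    (x : P.obj (op U)) :
    modApp (sheafifyMap φ) U (toSheaf P U x) = toSheaf Q U (φ.app (op U) x) :=
  (ConcreteCategory.congr_hom (NatTrans.congr_app (toSheafify_naturality
    (Opens.grothendieckTopology X) ((PresheafOfModules.toPresheaf _).map φ)) (op U)) x).symm

lemma exists_toSheaf {P : X.PresheafOfModules} {U : X.Opens} (s : Γ(sheafify P, U)) {x : X}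
    (hx : x ∈ U) : ∃ (V : X.Opens) (hV : V ≤ U) (t : P.obj (op V)), x ∈ V ∧
      toSheaf P V t = modRes (sheafify P) hV s := by
  obtain ⟨V, i, ⟨t, ht⟩, hxV⟩ := Presheaf.imageSieve_mem (Opens.grothendieckTopology X)
    (CategoryTheory.toSheafify (Opens.grothendieckTopology X) P.presheaf) (U := op U) s x hx
  exact ⟨V, i.le, t, hxV, ht⟩

lemma eq_of_locally_eq {F : X.Modules} {U : X.Opens} {s t : Γ(F, U)}
    (h : ∀ x ∈ U, ∃ (V : X.Opens) (hV : V ≤ U), x ∈ V ∧ modRes F hV s = modRes F hV t) : s = t := by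
  choose! V hV hxV hst using h
  refine TopCat.Sheaf.eq_of_locally_eq' ⟨F.presheaf, F.isSheaf⟩ (fun x : U => V x) U
    (fun x => homOfLE (hV x x.2)) (fun x hx => ?_) s t fun x => hst x x.2
  exact TopologicalSpace.Opens.mem_iSup.2 ⟨⟨x, hx⟩, hxV x hx⟩

lemma sheafify_hom_ext {P : X.PresheafOfModules} {F : X.Modules} {φ ψ : sheafify P ⟶ F}
    (h : ∀ (U : X.Opens) (x : P.obj (op U)),
      modApp φ U (toSheaf P U x) = modApp ψ U (toSheaf P U x)) : φ = ψ := by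
  refine Scheme.Modules.hom_ext _ _ fun U => ?_
  ext s
  refine eq_of_locally_eq fun x hx => ?_
  obtain ⟨V, hV, t, hxV, ht⟩ := exists_toSheaf s hx
  refine ⟨V, hV, hxV, ?_⟩
  have := h V t
  rw [ht, modApp_modRes, modApp_modRes] at this
  exact this

lemma injective_of_locally {F G : X.Modules} (φ : F ⟶ G)
    (h : ∀ (U : X.Opens) (s : Γ(F, U)), modApp φ U s = 0 → ∀ x ∈ U,
      ∃ (V : X.Opens) (hV : V ≤ U), x ∈ V ∧ modRes F hV s = 0) (U : X.Opens) :
    Function.Injective (modApp φ U) := by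
  refine (injective_iff_map_eq_zero _).2 fun s hs => eq_of_locally_eq fun x hx => ?_
  obtain ⟨V, hV, hxV, h⟩ := h U s hs x hx
  exact ⟨V, hV, hxV, by rw [h, map_zero]⟩

lemma mono_of_injective {F G : X.Modules} (φ : F ⟶ G)
    (h : ∀ U, Function.Injective (modApp φ U)) : Mono φ := by
  refine ⟨fun α β hαβ => Scheme.Modules.hom_ext _ _ fun U => ?_⟩
  ext s
  refine h U ?_
  exact ConcreteCategory.congr_hom (congrArg (fun γ => Scheme.Modules.Hom.app γ U) hαβ) s

lemma exists_modApp_eq {F G : X.Modules} (φ : F ⟶ G) (hφ : ∀ U, Function.Injective (modApp φ U))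
    {U : X.Opens} (s : Γ(G, U)) (h : ∀ x ∈ U, ∃ (V : X.Opens) (hV : V ≤ U) (t : Γ(F, V)), x ∈ V ∧
      modApp φ V t = modRes G hV s) : ∃ t, modApp φ U t = s := by
  choose! V hV t hxV ht using h
  have hcov : U ≤ iSup fun x : U => V x := fun x hx =>
    TopologicalSpace.Opens.mem_iSup.2 ⟨⟨x, hx⟩, hxV x hx⟩
  obtain ⟨g, hg, -⟩ := TopCat.Sheaf.existsUnique_gluing' ⟨F.presheaf, F.isSheaf⟩
    (fun x : U => V x) U (fun x => homOfLE (hV x x.2)) hcov (fun x => t x) (fun x y => by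
      refine hφ _ ?_
      refine (modApp_modRes φ inf_le_left _).trans (.trans ?_ (modApp_modRes φ inf_le_right _).symm)
      rw [ht _ x.2, ht _ y.2, modRes_modRes, modRes_modRes])
  refine ⟨g, eq_of_locally_eq fun x hx => ⟨V x, hV x hx, hxV x hx, ?_⟩⟩
  rw [← modApp_modRes, ← ht x hx]
  exact congrArg _ (hg ⟨x, hx⟩)

lemma isIso_of_locally {F G : X.Modules} (φ : F ⟶ G) (hφ : ∀ U, Function.Injective (modApp φ U))
    (h : ∀ (U : X.Opens) (s : Γ(G, U)), ∀ x ∈ U, ∃ (V : X.Opens) (hV : V ≤ U) (t : Γ(F, V)), x ∈ V ∧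
      modApp φ V t = modRes G hV s) : IsIso φ := by
  refine Scheme.Modules.Hom.isIso_iff_isIso_app.2 fun U => ?_
  rw [ConcreteCategory.isIso_iff_bijective]
  exact ⟨hφ U, fun s => exists_modApp_eq φ hφ s (h U s)⟩

lemma exists_factor {F G H : X.Modules} (φ : F ⟶ G) (hφ : ∀ U, Function.Injective (modApp φ U))
    (ψ : H ⟶ G) (h : ∀ (U : X.Opens) (s : Γ(H, U)), ∀ x ∈ U,
      ∃ (V : X.Opens) (hV : V ≤ U) (t : Γ(F, V)), x ∈ V ∧
        modApp φ V t = modApp ψ V (modRes H hV s)) : ∃ χ : H ⟶ F, χ ≫ φ = ψ := by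
  have h (U : X.Opens) (s : Γ(H, U)) : ∃ t, modApp φ U t = modApp ψ U s :=
    exists_modApp_eq φ hφ _ fun x hx => by
      obtain ⟨V, hV, t, hxV, ht⟩ := h U s x hx
      exact ⟨V, hV, t, hxV, ht.trans (modApp_modRes ψ hV s)⟩
  choose χ hχ using h
  refine ⟨⟨mkHom H.val F.val (fun U => AddMonoidHom.mk' (χ U) fun s t => hφ U ?_)
    (fun {U V} h x => hφ V ?_) fun U c x => hφ U ?_⟩, Scheme.Modules.hom_ext _ _ fun U => ?_⟩
  · refine (hχ U _).trans (.trans ((modApp ψ U).map_add s t) ?_)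
    exact .trans (congrArg₂ (· + ·) (hχ U s).symm (hχ U t).symm) ((modApp φ U).map_add _ _).symm
  · refine (hχ V _).trans (.trans (modApp_modRes ψ h x) ?_)
    exact .trans (congrArg _ (hχ U x).symm) (modApp_modRes φ h _).symm
  · refine (hχ U _).trans (.trans ((modApp ψ U).map_smul c x) ?_)
    exact .trans (congrArg _ (hχ U x).symm) ((modApp φ U).map_smul c _).symm
  · ext s
    exact hχ U s
end PolyDiff

namespace PolyDiff
section LieSheaf

variable {K : Type u} [Field K] {X : Scheme.{u}} (f : X ⟶ Spec (.of K))

/-- Restriction in the free graded Lie algebras as a semilinear map. -/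
noncomputable def LSec.resₛₗ (n : ℕ) {U V : X.Opens} (h : V ≤ U) :
    LSec f n U →ₛₗ[rs h] LSec f n V :=
  { LSec.res f n h with
    map_smul' := fun c x => Subtype.ext
      (map_smulₛₗ (FreeGLie.map (rs h) (DSec.resₛₗ f 1 h)) c x.1) }

/-- The map from the free graded Lie algebra of sections to sections of the sheaf of free graded
Lie algebras. -/
noncomputable def toLieSheaf (n : ℕ) (U : X.Opens) : LSec f n U →ₗ[Γ(X, U)] Γ(lieSheaf f n, U) :=
  { toSheaf (LPre f n) U with map_smul' := fun c x => toSheaf_smul (LPre f n) c x }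

lemma toLieSheaf_res (n : ℕ) {U V : X.Opens} (h : V ≤ U) (x : LSec f n U) :
    toLieSheaf f n V (LSec.resₛₗ f n h x) = modRes (lieSheaf f n) h (toLieSheaf f n U x) :=
  toSheaf_res (LPre f n) h x

lemma lieIncl_toLieSheaf (n : ℕ) {U : X.Opens} (x : LSec f n U) :
    modApp (lieIncl f n) U (toLieSheaf f n U x) = lieEval f n U x :=
  sheafifyLift_toSheaf (P := LPre f n) (F := Dpoly f n) (mkHom (LPre f n) (DPre f n)
    (fun U => (lieEval f n U).toAddMonoidHom) (fun h x => lieEval_res f n h x)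
    (fun U c x => (lieEval f n U).map_smul c x)) x

lemma exists_toLieSheaf {n : ℕ} {U : X.Opens} (s : Γ(lieSheaf f n, U)) {x : X} (hx : x ∈ U) :
    ∃ (V : X.Opens) (hV : V ≤ U) (t : LSec f n V), x ∈ V ∧
      toLieSheaf f n V t = modRes (lieSheaf f n) hV s :=
  exists_toSheaf (P := LPre f n) s hx

/-- Every section of the sheaf of free graded Lie algebras comes, locally, from the free graded Lie
algebra of sections over an open set with coordinates. -/
lemma exists_coordinates_toLieSheaf [Smooth f] {n : ℕ} {U : X.Opens} (s : Γ(lieSheaf f n, U))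
    {x : X} (hx : x ∈ U) : ∃ (V : X.Opens) (hV : V ≤ U) (t : LSec f n V), x ∈ V ∧
      Nonempty (Coordinates f V) ∧ toLieSheaf f n V t = modRes (lieSheaf f n) hV s := by
  obtain ⟨V, hV, t, hxV, ht⟩ := exists_toLieSheaf f s hx
  obtain ⟨W, hxW, hW, S⟩ := exists_coordinates f hxV
  exact ⟨W, hW.trans hV, LSec.resₛₗ f n hW t, hxW, S, by rw [toLieSheaf_res, ht, modRes_modRes]⟩

variable [CharZero K] [Smooth f]

lemma lieIncl_injective (n : ℕ) (U : X.Opens) : Function.Injective (modApp (lieIncl f n) U) := by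
  refine injective_of_locally _ (fun U s hs x hx => ?_) U
  obtain ⟨V, hV, t, hxV, ⟨S⟩, ht⟩ := exists_coordinates_toLieSheaf f s hx
  have : lieEval f n V t = 0 := by
    rw [← lieIncl_toLieSheaf, ht, modApp_modRes, hs]
    exact map_zero _
  rw [(map_eq_zero_iff _ (S.lieEval_injective n)).1 this, map_zero] at ht
  exact ⟨V, hV, hxV, ht.symm⟩

/-- The Hochschild differential preserves the sheaf of free graded Lie algebras. -/
lemma exists_lieIncl_hochD (n : ℕ) : ∃ dL : lieSheaf f n ⟶ lieSheaf f (n + 1),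
    dL ≫ lieIncl f (n + 1) = lieIncl f n ≫ hochD f n := by
  refine exists_factor _ (lieIncl_injective f (n + 1)) _ fun U s x hx => ?_
  obtain ⟨V, hV, t, hxV, ⟨S⟩, ht⟩ := exists_coordinates_toLieSheaf f s hx
  obtain ⟨y, hy⟩ := S.exists_lieEval_eq_hoch t
  refine ⟨V, hV, toLieSheaf f _ V y, hxV, ?_⟩
  rw [lieIncl_toLieSheaf, hy, ← ht, ← lieIncl_toLieSheaf]
  rfl

end LieSheaf

section Symmetrization

variable {K : Type u} [Field K] {X : Scheme.{u}} (f : X ⟶ Spec (.of K))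

/-- The map from the symmetric powers of sections to sections of the symmetric powers. -/
noncomputable def toSymSheaf (L : ℕ → X.Modules) (n : ℕ) (U : X.Opens) :
    SymSec L n U →ₗ[Γ(X, U)] Γ(symSheaf L n, U) :=
  { toSheaf (SymPre L n) U with map_smul' := fun c x => toSheaf_smul (SymPre L n) c x }

lemma toSymSheaf_res (L : ℕ → X.Modules) (n : ℕ) {U V : X.Opens} (h : V ≤ U) (x : SymSec L n U) :
    toSymSheaf L n V (SymSec.res L n h x) = modRes (symSheaf L n) h (toSymSheaf L n U x) :=
  toSheaf_res (SymPre L n) h x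

lemma exists_toSymSheaf {L : ℕ → X.Modules} {n : ℕ} {U : X.Opens} (s : Γ(symSheaf L n, U)) {x : X}
    (hx : x ∈ U) : ∃ (V : X.Opens) (hV : V ≤ U) (t : SymSec L n V), x ∈ V ∧
      toSymSheaf L n V t = modRes (symSheaf L n) hV s :=
  exists_toSheaf (P := SymPre L n) s hx

lemma symSheaf_hom_ext {L : ℕ → X.Modules} {n : ℕ} {F : X.Modules} {φ ψ : symSheaf L n ⟶ F}
    (h : ∀ (U : X.Opens) (t : SymSec L n U),
      modApp φ U (toSymSheaf L n U t) = modApp ψ U (toSymSheaf L n U t)) : φ = ψ :=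
  sheafify_hom_ext h

lemma symmetrization_toSymSheaf {L : ℕ → X.Modules} (j : ∀ n, L n ⟶ Dpoly f n) (n : ℕ)
    {U : X.Opens} (t : SymSec L n U) :
    modApp (symmetrization f j n) U (toSymSheaf L n U t) = symSecMap f j n U t :=
  sheafifyLift_toSheaf (P := SymPre L n) (F := Dpoly f n) (mkHom (SymPre L n) (DPre f n)
    (fun U => (symSecMap f j n U).toAddMonoidHom) (fun h x => symSecMap_res f j n h x)
    (fun U c x => (symSecMap f j n U).map_smul c x)) t

lemma symD_toSymSheaf {L : ℕ → X.Modules} (δ : ∀ n, L n ⟶ L (n + 1)) (n : ℕ) {U : X.Opens}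
    (t : SymSec L n U) : modApp (symD δ n) U (toSymSheaf L n U t) =
      toSymSheaf L (n + 1) U (symSecD δ n U t) :=
  sheafifyMap_toSheaf (P := SymPre L n) (Q := SymPre L (n + 1)) (mkHom (SymPre L n)
    (SymPre L (n + 1)) (fun U => (symSecD δ n U).toAddMonoidHom)
    (fun {U V} h x => Subtype.ext (GSym.der_map (rs h) (fun m => modRes (L m) h)
      (fun m => modApp (δ m) U) (fun m => modApp (δ m) V) (fun m x => modApp_modRes (δ m) h x) x.1))
    (fun U c x => (symSecD δ n U).map_smul c x)) t

lemma lof_symSecMap {L : ℕ → X.Modules} (j : ∀ n, L n ⟶ Dpoly f n) (n : ℕ)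
    {U : X.Opens} (t : SymSec L n U) :
    DirectSum.lof Γ(X, U) ℕ (fun n => DSec f n U) n (symSecMap f j n U t) = symAlg f j U t.1 :=
  lof_component (x := symAlg f j U t.1) (symmetrize_mem_range_lof
    (fun k => structMap f U (k.factorial : K)⁻¹)
    (fun m => (DirectSum.lof Γ(X, U) ℕ (fun n => DSec f n U) m) ∘ₗ modApp (j m) U)
    (fun m x => ⟨modApp (j m) U x, rfl⟩) t.2)

/-- Symmetrization along maps compatible with differentials is a map of complexes. -/
lemma symD_symmetrization {L : ℕ → X.Modules} {j : ∀ n, L n ⟶ Dpoly f n}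
    {δ : ∀ n, L n ⟶ L (n + 1)} (h : ∀ n, δ n ≫ j (n + 1) = j n ≫ hochD f n) (n : ℕ) :
    symD δ n ≫ symmetrization f j (n + 1) = symmetrization f j n ≫ hochD f n := by
  refine symSheaf_hom_ext fun U t => ?_
  change modApp (symmetrization f j (n + 1)) U (modApp (symD δ n) U (toSymSheaf L n U t)) =
    DSec.hoch (f := f) (modApp (symmetrization f j n) U (toSymSheaf L n U t))
  rw [symD_toSymSheaf, symmetrization_toSymSheaf, symmetrization_toSymSheaf]
  refine DirectSum.of_injective (β := fun n => DSec f n U) _ ?_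
  have h' (m : ℕ) (x : Γ(L m, U)) : modApp (j (m + 1)) U (modApp (δ m) U x) =
      DSec.hoch (f := f) (modApp (j m) U x) :=
    ConcreteCategory.congr_hom (congrArg (fun γ => Scheme.Modules.Hom.app γ U) (h m)) x
  have key : symAlg f j U (symSecD δ n U t).1 = hochAlg f U (symAlg f j U t.1) := symmetrize_der (d := hochAlg f U) (δ := fun m => modApp (δ m) U)
    (ψ := fun m => DirectSum.lof Γ(X, U) ℕ (fun n => DSec f n U) m ∘ₗ modApp (j m) U)
    hochAlg_one (fun m x b => by
      refine (hochAlg_of_mul m _ b).trans ?_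
      exact congrArg (fun y => DirectSum.of (fun n => DSec f n U) (m + 1) y * b + (-1 : ℤ) ^ m •
        (DirectSum.of (fun n => DSec f n U) m (modApp (j m) U x) * hochAlg f U b)) (h' m x).symm)
    (fun k => structMap f U (k.factorial : K)⁻¹) t.1
  refine ((lof_symSecMap f j (n + 1) _).trans key).trans ?_
  refine (congrArg _ (lof_symSecMap f j n t).symm).trans ?_
  exact hochAlg_of n _

/-- Symmetrization on the free graded Lie algebra of sections. -/
lemma symAlg_map_toLieSheaf {U : X.Opens} (y : GSym Γ(X, U) (fun m => LSec f m U)) :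
    symAlg f (lieIncl f) U (GSym.map (RingHom.id _) (fun m => toLieSheaf f m U) y) =
      GSym.symmetrize (fun k => structMap f U (k.factorial : K)⁻¹) (lieAlgMap f U) y := by
  refine GSym.symmetrize_map (RingHom.id _) (fun m => toLieSheaf f m U) _ _ (fun _ => rfl)
    _ _ (RingHom.id (DAlg f U)) (fun _ _ => rfl) (fun m x => ?_) y
  refine (lieAlgMap_eq_lof f U m x).trans ?_
  rw [← lieIncl_toLieSheaf]
  rfl

lemma map_res_toLieSheaf {U V : X.Opens} (h : V ≤ U) (y : GSym Γ(X, U) (fun m => LSec f m U)) :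
    GSym.map (RingHom.id _) (fun m => toLieSheaf f m V)
        (GSym.map (rs h) (fun m => LSec.resₛₗ f m h) y) =
      GSym.map (rs h) (fun m => modRes (lieSheaf f m) h)
        (GSym.map (RingHom.id _) (fun m => toLieSheaf f m U) y) := by
  refine (GSym.map_map (rs h) (fun m => LSec.resₛₗ f m h) (RingHom.id _)
    (fun m => toLieSheaf f m V) (rs h)
    (fun m => (modRes (lieSheaf f m) h).comp (toLieSheaf f m U)) (fun _ => rfl)
    (fun m x => toLieSheaf_res f m h x) y).trans ?_
  exact (GSym.map_map _ _ _ _ _ _ (fun _ => rfl) (fun _ _ => rfl) y).symm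

lemma map_modRes_modRes {L : ℕ → X.Modules} {U V W : X.Opens} (h : V ≤ U) (h' : W ≤ V)
    (x : GSym Γ(X, U) (fun m => Γ(L m, U))) :
    GSym.map (rs h') (fun m => modRes (L m) h') (GSym.map (rs h) (fun m => modRes (L m) h) x) =
      GSym.map (rs (h'.trans h)) (fun m => modRes (L m) (h'.trans h)) x :=
  GSym.map_map _ _ _ _ _ _ (rs_rs h h') (fun m => modRes_modRes (L m) h h') x

/-- Elements of the symmetric powers of the sections of the sheaf of free graded Lie algebras come,
locally, from the symmetric powers of the free graded Lie algebra of sections. -/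
lemma exists_map_toLieSheaf {U : X.Opens} (s : GSym Γ(X, U) (fun m => Γ(lieSheaf f m, U)))
    {x : X} (hx : x ∈ U) : ∃ (V : X.Opens) (hV : V ≤ U) (y : GSym Γ(X, V) (fun m => LSec f m V)),
      x ∈ V ∧ GSym.map (RingHom.id _) (fun m => toLieSheaf f m V) y =
        GSym.map (rs hV) (fun m => modRes (lieSheaf f m) hV) s := by
  induction s using GSym.induction with
  | h0 => exact ⟨U, le_rfl, 0, hx, by rw [map_zero, map_zero]⟩
  | ha s t hs ht =>
    obtain ⟨V, hV, y, hxV, hy⟩ := hs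
    obtain ⟨W, hW, z, hxW, hz⟩ := ht
    refine ⟨V ⊓ W, inf_le_left.trans hV, GSym.map (rs inf_le_left)
      (fun m => LSec.resₛₗ f m inf_le_left) y + GSym.map (rs inf_le_right)
      (fun m => LSec.resₛₗ f m inf_le_right) z, ⟨hxV, hxW⟩, ?_⟩
    rw [map_add, map_add, map_res_toLieSheaf, map_res_toLieSheaf, hy, hz, map_modRes_modRes,
      map_modRes_modRes]
  | hw c u =>
    obtain ⟨k, u⟩ := u
    choose V hV t hxV ht using fun i => exists_toLieSheaf f (u i).2 hx
    let W : X.Opens := ⟨⋂ i, V i, isOpen_iInter_of_finite fun i => (V i).isOpen⟩ ⊓ U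
    have hW (i : Fin k) : W ≤ V i := fun z hz => Set.mem_iInter.1 hz.1 i
    refine ⟨W, inf_le_right, rs (inf_le_right : W ≤ U) c • GSym.word Γ(X, W)
      (⟨k, fun i => ⟨(u i).1, LSec.resₛₗ f _ (hW i) (t i)⟩⟩ :
        GWord fun m => LSec f m W), ⟨Set.mem_iInter.2 hxV, hx⟩, ?_⟩
    simp only [map_smulₛₗ, GSym.map_word, RingHom.id_apply]
    refine congrArg (fun v => rs (inf_le_right : W ≤ U) c • GSym.word Γ(X, W)
      (⟨k, v⟩ : GWord fun m => Γ(lieSheaf f m, W))) ?_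
    funext i
    congr 1
    rw [toLieSheaf_res, ht, modRes_modRes]

variable [CharZero K] [Smooth f]

lemma symmetrization_injective (n : ℕ) (U : X.Opens) :
    Function.Injective (modApp (symmetrization f (lieIncl f) n) U) := by
  refine injective_of_locally _ (fun U s hs x hx => ?_) U
  obtain ⟨V, hV, t, hxV, ht⟩ := exists_toSymSheaf s hx
  obtain ⟨W, hW, y, hxW, hy⟩ := exists_map_toLieSheaf f t.1 hxV
  obtain ⟨Z, hxZ, hZ, ⟨S⟩⟩ := exists_coordinates f hxW
  refine ⟨Z, (hZ.trans hW).trans hV, hxZ, ?_⟩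
  have h0 : symAlg f (lieIncl f) V t.1 = 0 := by
    rw [← lof_symSecMap, ← symmetrization_toSymSheaf, ht, modApp_modRes, hs, map_zero]
    exact map_zero _
  have h1 : GSym.map (RingHom.id _) (fun m => toLieSheaf f m Z)
      (GSym.map (rs hZ) (fun m => LSec.resₛₗ f m hZ) y) =
      GSym.map (rs (hZ.trans hW)) (fun m => modRes (lieSheaf f m) (hZ.trans hW)) t.1 := by
    rw [map_res_toLieSheaf, hy, map_modRes_modRes]
  have h2 : GSym.map (rs hZ) (fun m => LSec.resₛₗ f m hZ) y = 0 := by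
    refine (map_eq_zero_iff _ S.symmetrize_injective).1 ?_
    rw [← symAlg_map_toLieSheaf, h1, symAlg_res, h0, map_zero]
  rw [h2, map_zero] at h1
  have h3 : SymSec.res (lieSheaf f) n (hZ.trans hW) t = 0 := Subtype.ext h1.symm
  have h4 := toSymSheaf_res (lieSheaf f) n (hZ.trans hW) t
  refine ((modRes_modRes _ hV (hZ.trans hW) s).symm.trans (congrArg _ ht.symm)).trans ?_
  exact h4.symm.trans ((congrArg _ h3).trans (map_zero _))

instance isIso_symmetrization (n : ℕ) : IsIso (symmetrization f (lieIncl f) n) := by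
  refine isIso_of_locally _ (symmetrization_injective f n) fun U F x hx => ?_
  obtain ⟨V, hxV, hV, ⟨S⟩⟩ := exists_coordinates f hx
  obtain ⟨y, hyn, hy⟩ := S.lof_mem_map_symmetrize (DSec.res (f := f) (n := n) hV F)
  let t : SymSec (lieSheaf f) n V := ⟨GSym.map (RingHom.id _)
    (fun m => toLieSheaf f m V) y, GSym.map_mem_deg _ _ n hyn⟩
  refine ⟨V, hV, toSymSheaf (lieSheaf f) n V t, hxV, ?_⟩
  rw [symmetrization_toSymSheaf]
  refine DirectSum.of_injective (β := fun n => DSec f n V) n ?_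
  exact (lof_symSecMap f _ n _).trans ((symAlg_map_toLieSheaf f y).trans hy)

end Symmetrization
end PolyDiff

theorem lemma1 {K : Type u} [Field K] [CharZero K] {X : AlgebraicGeometry.Scheme.{u}}
    (f : X ⟶ AlgebraicGeometry.Spec (.of K)) [AlgebraicGeometry.Smooth f] :
    (∀ n : ℕ, Mono (PolyDiff.lieIncl f n)) ∧
    ∃ dL : ∀ n : ℕ, PolyDiff.lieSheaf f n ⟶ PolyDiff.lieSheaf f (n + 1),
      (∀ n : ℕ, dL n ≫ PolyDiff.lieIncl f (n + 1) = PolyDiff.lieIncl f n ≫ PolyDiff.hochD f n) ∧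
      ∃ (hS : ∀ n : ℕ, PolyDiff.symD dL n ≫ PolyDiff.symD dL (n + 1) = 0)
        (Φ : CochainComplex.of (PolyDiff.symSheaf (PolyDiff.lieSheaf f)) (PolyDiff.symD dL) hS ⟶
          PolyDiff.DpolyComplex f),
        (∀ n : ℕ, Φ.f n = PolyDiff.symmetrization f (PolyDiff.lieIncl f) n) ∧ IsIso Φ := by
  refine ⟨fun n => PolyDiff.mono_of_injective _ (PolyDiff.lieIncl_injective f n), ?_⟩
  choose dL hdL using PolyDiff.exists_lieIncl_hochD f
  have hΦ := PolyDiff.symD_symmetrization f hdL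
  have hS (n : ℕ) : PolyDiff.symD dL n ≫ PolyDiff.symD dL (n + 1) = 0 := by
    rw [← cancel_mono (PolyDiff.symmetrization f (PolyDiff.lieIncl f) (n + 1 + 1)), Category.assoc,
      hΦ, ← Category.assoc, hΦ, Category.assoc, PolyDiff.hochD_comp, Limits.comp_zero,
      Limits.zero_comp]
  let Φ : CochainComplex.of (PolyDiff.symSheaf (PolyDiff.lieSheaf f)) (PolyDiff.symD dL) hS ⟶
      PolyDiff.DpolyComplex f :=
    CochainComplex.ofHom (PolyDiff.symmetrization f (PolyDiff.lieIncl f)) fun n =>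
      (congrArg (_ ≫ ·) (CochainComplex.of_d _ (PolyDiff.hochD f) n)).trans ((hΦ n).symm.trans
        (congrArg (· ≫ _) (CochainComplex.of_d _ (PolyDiff.symD dL) n).symm))
  refine ⟨dL, hdL, hS, Φ, fun _ => rfl, ?_⟩
  have (n : ℕ) : IsIso (Φ.f n) := PolyDiff.isIso_symmetrization f n
  exact HomologicalComplex.Hom.isIso_of_components Φ
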